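/- For $0<s<1$ let $K_s\in L^1(\mathbb R)$ be the function with $\int_{\mathbb R}K_s(x)e^{-ix\xi}\,dx=\left(\frac{\tanh\xi}{\xi}\right)^{s}$ (with value $1$ at $\xi=0$), and put $K=K_{1/2}$. Fix $\alpha>0$ and let $\Psi=\Psi_\alpha:\mathbb R\to[0,\infty)$ be the even function with $$\Psi(y)=\begin{cases}\alpha y^2-\frac13y^3, & 0\le y<\alpha,\\ \frac23\alpha^3+\alpha^2(y-\alpha)+(y-\alpha)^3, & y\ge\alpha.\end{cases}$$ Let $\mathcal L^\Psi$ be the Orlicz space of measurable $f:\mathbb R\to\mathbb R$ with $\int\Psi(af)\,dx<\infty$ for some $a>0$, with gauge norm $N_\Psi(f)=\inf\{c>0:\int_{\mathbb R}\Psi(f(x)/c)\,dx\le1\}$. Put $$J_\alpha=\sup_{N_\Psi(f)=1}\|K_{1/4}*f\|_{L^2},\qquad J_l=\sup_{\substack{N_\Psi(f)=1\\ \operatorname{supp}f\subset[-2^l,2^l]}}\|K_{1/4}*f\|_{L^2}\quad(l\in\mathbb N=\{0,1,2,\dots\}).$$ A function is called bell-shaped if it agrees almost everywhere with an even, nonnegative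 function that is nonincreasing on $(0,\infty)$. For every $l\in\mathbb N$ let $f_l$ be any bell-shaped maximiser for $J_l$, that is, $f_l$ is bell-shaped, $N_\Psi(f_l)=1$, $\operatorname{supp}f_l\subset[-2^l,2^l]$ and $\|K_{1/4}*f_l\|_{L^2}=J_l$. Then there are a subsequence $\{f_{l_k}\}_k$ and a function $f_\alpha:\mathbb R\to\mathbb R$ such that: 1. $f_{l_k}\to f_\alpha$ pointwise: each $f_l$ has a representative that is continuous on $(-2^l,2^l)$, and for suitable such representatives the convergence holds at every $x\in\mathbb R$ (so it holds almost everywhere for any choice of representatives); 2. for every $p\in(1,\infty]$, the functions $f_{l_k}$ and $f_\alpha$ belong to $L^p(\mathbb R)$ and $f_{l_k}\to f_\alpha$ in $L^p(\mathbb R)$; 3. $f_\alpha$ is not almost everywhere zero, is bell-shaped, and is a maximiser of the global problem: $N_\Psi(f_\alpha)=1$ and $\|K_{1/4}*f_\alpha\|_{L^2}=J_\alpha$; 4. $f_\alpha\Psi'(f_\alpha)$ is integrable, the integral defining $K*f_\alpha(x)$ converges absolutely for every $x$, $0<J_\alpha<\infty$, and, with $\langle f_\alpha,\Psi'(f_\alpha)\rangle=\int_{\mathbb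 R}f_\alpha\Psi'(f_\alpha)\,dx$, the Euler–Lagrange equation $$\frac{\langle f_\alpha,\Psi'(f_\alpha)\rangle}{J_\alpha^2}\,K*f_\alpha(x)=\Psi'(f_\alpha(x))$$ holds for every $x\in\mathbb R$. -/

import Mathlib

open MeasureTheory Set Filter Topology
open scoped ENNReal

noncomputable section

/-- The function `tanh ξ / ξ`, with its limiting value `1` at the origin. -/
def tanhQuotient (ξ : ℝ) : ℝ := if ξ = 0 then 1 else Real.tanh ξ / ξ

/-- `K` is an integrable function whose Fourier transform, normalised as
`∫ K(x) e^{-ixξ} dx`, is `(tanh ξ / ξ)^s`. By injectivity of the Fourier transform on `L¹`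
there is, up to null sets, at most one such function. -/
def IsWhithamKernel (s : ℝ) (K : ℝ → ℝ) : Prop :=
  Integrable K ∧
    ∀ ξ : ℝ, ∫ x : ℝ, (K x : ℂ) * Complex.exp (-(Complex.I * (x : ℂ) * (ξ : ℂ)))
      = ((tanhQuotient ξ ^ s : ℝ) : ℂ)

open Classical in
/-- The kernel `K_s`: the integrable function with Fourier transform `(tanh ξ / ξ)^s`.
It exists for every `s ∈ (0,1)`, so that the second branch is never used there. -/
def whithamKernel (s : ℝ) : ℝ → ℝ :=
  if h : ∃ K : ℝ → ℝ, IsWhithamKernel s K then Classical.choose h else 0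

/-- The convolution `(K_s ∗ f)(x) = ∫ K_s(y) f(x - y) dy`. -/
def whithamConv (s : ℝ) (f : ℝ → ℝ) : ℝ → ℝ :=
  convolution (whithamKernel s) f (ContinuousLinearMap.mul ℝ ℝ) volume

/-- The Young function `Ψ` with parameter `α > 0`, extended evenly to the whole line. -/
def youngPsi (α x : ℝ) : ℝ :=
  if |x| < α then α * |x| ^ 2 - |x| ^ 3 / 3
  else 2 / 3 * α ^ 3 + α ^ 2 * (|x| - α) + (|x| - α) ^ 3

/-- Membership in the Orlicz space of a (nonnegative) Young function `Ψ` on the real line. -/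
def MemOrlicz (Ψ : ℝ → ℝ) (f : ℝ → ℝ) : Prop :=
  AEStronglyMeasurable f ∧ ∃ a : ℝ, 0 < a ∧ ∫⁻ x, ENNReal.ofReal (Ψ (a * f x)) < ∞

/-- The gauge norm `N_Ψ(f) = inf {c > 0 : ∫ Ψ(f(x)/c) dx ≤ 1}`. -/
def gaugeNorm (Ψ : ℝ → ℝ) (f : ℝ → ℝ) : ℝ :=
  sInf {c : ℝ | 0 < c ∧ ∫⁻ x, ENNReal.ofReal (Ψ (f x / c)) ≤ 1}

/-- The constraint set `N_Ψ(f) = 1`. -/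
def admissible (α : ℝ) : Set (ℝ → ℝ) :=
  {f | MemOrlicz (youngPsi α) f ∧ gaugeNorm (youngPsi α) f = 1}

/-- The constraint set `N_Ψ(f) = 1`, `supp f ⊆ [-2^l, 2^l]` (as elements of a Lebesgue space,
that is, `f` vanishes almost everywhere outside the interval). -/
def localAdmissible (α : ℝ) (l : ℕ) : Set (ℝ → ℝ) :=
  {f | f ∈ admissible α ∧ ∀ᵐ x : ℝ, x ∉ Icc (-(2 : ℝ) ^ l) ((2 : ℝ) ^ l) → f x = 0}

/-- The functional `𝒥(f) = ‖K_{1/4} ∗ f‖_{L²}`. -/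
def energyJ (f : ℝ → ℝ) : ℝ≥0∞ := eLpNorm (whithamConv (1 / 4) f) 2 volume

/-- The supremum of `𝒥` over a constraint set. -/
def supJ (C : Set (ℝ → ℝ)) : ℝ≥0∞ := ⨆ f ∈ C, energyJ f

/-- `f` belongs to the constraint set and realises the supremum of `𝒥` over it. -/
def IsMaximiser (C : Set (ℝ → ℝ)) (f : ℝ → ℝ) : Prop := f ∈ C ∧ energyJ f = supJ C

/-- Bell-shaped: almost everywhere equal to an even, nonnegative function that is
nonincreasing on the positive half-axis. -/
def BellShaped (f : ℝ → ℝ) : Prop :=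
  ∃ g : ℝ → ℝ, f =ᵐ[volume] g ∧ (∀ x, g (-x) = g x) ∧ (∀ x, 0 ≤ g x) ∧ AntitoneOn g (Ioi 0)

/-- The pairing `⟨f, Ψ'(f)⟩ = ∫ f Ψ'(f) dx`. -/
def pairingPsi (α : ℝ) (f : ℝ → ℝ) : ℝ := ∫ x, f x * deriv (youngPsi α) (f x)

end

/-! Write `B(f,g) = ∬ f(x) K(x-y) g(y)`. Since `K_{1/4} ∗ K_{1/4} = K` and the kernels are even,
`‖K_{1/4} ∗ f‖² = B(f,f)`. The condition `N_Ψ(f) = 1` means `∫ Ψ(f) = 1`, and the Orlicz space is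
`L² ∩ L³`. The problem is thus to maximise a quadratic form, and the danger is loss of mass when the
intervals grow.

The kernel. By partial fractions, `exp(-r ξ coth ξ)` is positive definite for every `r > 0`, and
`(tanh ξ/ξ)^s` is a Gamma mixture of these functions. Hence `K_s ≥ 0`, with total mass one, `K ∈
L^{3/2}`, and `K` has a finite first moment. As `ξ coth ξ` increases with `|ξ|`, for nonnegative `f`
the dilation `f(·/τ)`, `τ ≥ 1`, multiplies `B(f,f)` by at least `τ`, while it multiplies `∫ Ψ(f)` by
exactly `τ`. So `B(f,f) ≤ m J²` whenever `∫ Ψ(f) = m ≤ 1` (`bform_le_maxSq_mul`).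

Compactness. The Euler–Lagrange equation on `[-2^l, 2^l]` reads `f_l = G(c_l K ∗ f_l)`, where `G` is
the inverse of `Ψ'`. The functions `K ∗ f_l` are uniformly bounded and equicontinuous and the
multipliers `c_l` are bounded, so a subsequence converges pointwise to some `f` with `∫ Ψ(f) = m ≤
1`. Bell shape and the `L²` bound give the common majorant `C (1+|x|)^{-1/2}`, which lies in `L³`.
Everything cubic at the origin therefore passes to the limit, and only the quadratic part `α y²` of
`Ψ` can lose mass: `‖f_l - f‖₂² → (1-m)/α`. Since `B(r,r) ≤ ‖r‖₂²`, the limit of the energies gives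
`J² ≤ B(f,f) + (1-m)/α ≤ m J² + (1-m)/α`. Long low plateaus show that `J² > 1/α`
(`one_div_lt_maxSq`), because the cubic term of `Ψ` is negative near the origin. Hence `m = 1`, and
`f` is a maximiser (`integral_youngPsi_limit`).

Convergence in `L^p`. The dilation bound applied to `(1+t) f` with `t < 0` gives `⟨f, Ψ'(f)⟩ ≤ 2`,
hence a limiting multiplier strictly below `2α = Ψ''(0)`. Far from the origin `f_l ≤ θ K ∗ f_l` with
`θ < 1`. Integration bounds `‖f_l‖₁` uniformly, and bell shape turns this into decay like `1/|x|`, a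
majorant in `L^p` for finite `p > 1`. For `p = ∞` the representation through `G` is used on bounded
sets and the decay outside. -/

/-! ### The symbol `ξ coth ξ` and its partial fractions -/

/-- The Mittag-Leffler expansion of the cotangent at the imaginary point `iξ/π`, multiplied by that
point. -/
theorem mul_coth_sub_one_eq_tsum {ξ : ℝ} (hξ : ξ ≠ 0) :
    ξ * Real.cosh ξ / Real.sinh ξ - 1 = ∑' n : ℕ, 2 * ξ ^ 2 / (ξ ^ 2 + Real.pi ^ 2 * (n + 1) ^ 2) := by
  have hpi : (Real.pi : ℂ) ≠ 0 := by exact_mod_cast Real.pi_ne_zero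
  have hξ' : (ξ : ℂ) ≠ 0 := by exact_mod_cast hξ
  set z : ℂ := Complex.I * ξ / Real.pi with hz
  have hmem : z ∈ Complex.integerComplement := by
    rw [Complex.mem_integerComplement_iff]
    rintro ⟨n, hn⟩
    have := congrArg Complex.im hn
    have h2 : (Complex.I * ξ / Real.pi : ℂ).im = ξ / Real.pi := by
      rw [Complex.div_ofReal_im]; simp
    rw [hz, h2] at this
    exact hξ (by simpa [Real.pi_ne_zero] using this.symm)
  have h := cot_series_rep' hmem
  have hzz : (Real.pi : ℂ) * z = ξ * Complex.I := by rw [hz]; field_simp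
  rw [hzz] at h
  have h1 : z * (Real.pi * Complex.cot (ξ * Complex.I) - 1 / z) =
      ((ξ * Real.cosh ξ / Real.sinh ξ - 1 : ℝ) : ℂ) := by
    rw [Complex.cot_eq_cos_div_sin, Complex.cos_mul_I, Complex.sin_mul_I]
    have hz0 : z ≠ 0 := by rw [hz]; simp [hξ', hpi]
    have hs : Complex.sinh (ξ : ℂ) ≠ 0 := by
      rw [← Complex.ofReal_sinh]; exact_mod_cast (Real.sinh_ne_zero.2 hξ)
    push_cast
    rw [mul_sub, mul_one_div_cancel hz0, ← mul_assoc, mul_comm z, hzz]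
    field_simp
  have h2 : ∀ n : ℕ, z * (1 / (z - (n + 1)) + 1 / (z + (n + 1))) =
      ((2 * ξ ^ 2 / (ξ ^ 2 + Real.pi ^ 2 * (n + 1) ^ 2) : ℝ) : ℂ) := by
    intro n
    have e1 : z - (n + 1) ≠ 0 := by
      simpa [sub_eq_add_neg] using Complex.integerComplement_add_ne_zero hmem (-(n + 1) : ℤ)
    have e2 : z + (n + 1) ≠ 0 := by
      simpa using Complex.integerComplement_add_ne_zero hmem ((n : ℤ) + 1)
    have e3 : (ξ : ℂ) ^ 2 + Real.pi ^ 2 * (n + 1) ^ 2 ≠ 0 := by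
      have : (0:ℝ) < ξ ^ 2 + Real.pi ^ 2 * (n + 1) ^ 2 := by positivity
      exact_mod_cast this.ne'
    have hsq : z ^ 2 = - ξ ^ 2 / Real.pi ^ 2 := by rw [hz, div_pow, mul_pow, Complex.I_sq]; ring
    push_cast
    have : z * (1 / (z - (n + 1)) + 1 / (z + (n + 1))) = 2 * z ^ 2 / (z ^ 2 - (n + 1) ^ 2) := by
      have e4 : z ^ 2 - (n + 1) ^ 2 ≠ 0 := by
        rw [sq_sub_sq]; exact mul_ne_zero e2 e1
      rw [eq_div_iff e4, sq_sub_sq]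
      field_simp
      ring
    rw [this, hsq]
    have e5 : (- ξ ^ 2 / Real.pi ^ 2 : ℂ) - (n + 1) ^ 2 = - (ξ ^ 2 + Real.pi ^ 2 * (n + 1) ^ 2) / Real.pi ^ 2 := by
      field_simp; ring
    rw [e5]
    field_simp
  have h3 := congrArg (fun w => z * w) h
  beta_reduce at h3
  rw [h1, ← tsum_mul_left] at h3
  simp_rw [h2] at h3
  rw [← Complex.ofReal_tsum] at h3
  exact_mod_cast h3

/-- The function `ξ coth ξ`, the reciprocal of `tanh ξ / ξ`. -/
noncomputable def cothSymbol (ξ : ℝ) : ℝ := (tanhQuotient ξ)⁻¹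

theorem cothSymbol_term_summable (ξ : ℝ) :
    Summable fun n : ℕ => 2 * ξ ^ 2 / (ξ ^ 2 + Real.pi ^ 2 * (n + 1) ^ 2) := by
  have h : Summable fun n : ℕ => (2 * ξ ^ 2 / Real.pi ^ 2) * (1 / ((n : ℝ) + 1) ^ 2) := by
    apply Summable.mul_left
    exact_mod_cast (summable_nat_add_iff 1).2 (Real.summable_one_div_nat_pow.2 one_lt_two)
  refine Summable.of_nonneg_of_le (fun n => by positivity) (fun n => ?_) h
  rw [div_mul_div_comm, mul_one]
  gcongr
  nlinarith [sq_nonneg ξ]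

theorem cothSymbol_eq (ξ : ℝ) :
    cothSymbol ξ = 1 + ∑' n : ℕ, 2 * ξ ^ 2 / (ξ ^ 2 + Real.pi ^ 2 * (n + 1) ^ 2) := by
  by_cases hξ : ξ = 0
  · simp [cothSymbol, tanhQuotient, hξ]
  · rw [← mul_coth_sub_one_eq_tsum hξ, cothSymbol, tanhQuotient, if_neg hξ,
      Real.tanh_eq_sinh_div_cosh, inv_div, div_div_eq_mul_div]
    ring

theorem one_le_cothSymbol (ξ : ℝ) : 1 ≤ cothSymbol ξ := by
  rw [cothSymbol_eq]
  have : 0 ≤ ∑' n : ℕ, 2 * ξ ^ 2 / (ξ ^ 2 + Real.pi ^ 2 * ((n : ℝ) + 1) ^ 2) :=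
    tsum_nonneg fun n => by positivity
  linarith

theorem cothSymbol_pos (ξ : ℝ) : 0 < cothSymbol ξ := one_pos.trans_le (one_le_cothSymbol ξ)

/-- Each partial fraction increases with `ξ²`. This monotonicity is what makes dilation favourable
to the quadratic form. -/
theorem cothSymbol_mono {ξ η : ℝ} (h : |ξ| ≤ |η|) : cothSymbol ξ ≤ cothSymbol η := by
  rw [cothSymbol_eq, cothSymbol_eq]
  refine add_le_add_right (Summable.tsum_le_tsum (fun n => ?_) (cothSymbol_term_summable ξ)
    (cothSymbol_term_summable η)) 1
  · have h2 : ξ ^ 2 ≤ η ^ 2 := sq_le_sq.2 h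
    have : (0:ℝ) < Real.pi ^ 2 * ((n : ℝ) + 1) ^ 2 := by positivity
    rw [div_le_div_iff₀ (by positivity) (by positivity)]
    nlinarith

theorem cothSymbol_neg (ξ : ℝ) : cothSymbol (-ξ) = cothSymbol ξ :=
  le_antisymm (cothSymbol_mono (by simp)) (cothSymbol_mono (by simp))

theorem exists_cothSymbol_le : ∃ C : ℝ, 0 ≤ C ∧ ∀ ξ, cothSymbol ξ ≤ 1 + C * ξ ^ 2 := by
  have h : Summable fun n : ℕ => (2 / Real.pi ^ 2) * (1 / ((n : ℝ) + 1) ^ 2) := by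
    apply Summable.mul_left
    exact_mod_cast (summable_nat_add_iff 1).2 (Real.summable_one_div_nat_pow.2 one_lt_two)
  refine ⟨∑' n : ℕ, (2 / Real.pi ^ 2) * (1 / ((n : ℝ) + 1) ^ 2),
    tsum_nonneg fun n => by positivity, fun ξ => ?_⟩
  rw [cothSymbol_eq, ← tsum_mul_right]
  gcongr with n
  · exact cothSymbol_term_summable ξ
  · exact h.mul_right _
  · rw [div_mul_div_comm, mul_one, div_mul_eq_mul_div]
    gcongr
    nlinarith [sq_nonneg ξ]

theorem abs_le_cothSymbol (ξ : ℝ) : |ξ| ≤ cothSymbol ξ := by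
  rw [cothSymbol, tanhQuotient]
  split_ifs with h
  · simp [h]
  rw [inv_div]
  have key : ∀ x : ℝ, 0 < x → x ≤ x / Real.tanh x := fun x hx => by
    have h1 : 0 < Real.tanh x := by
      rw [Real.tanh_eq_sinh_div_cosh]
      exact div_pos (Real.sinh_pos_iff.2 hx) (Real.cosh_pos x)
    rw [le_div_iff₀ h1]
    nlinarith [Real.tanh_lt_one x]
  rcases lt_or_gt_of_ne h with h | h
  · have := key (-ξ) (by linarith)
    rw [abs_of_neg h]
    simpa [Real.tanh_neg] using this
  · rw [abs_of_pos h]; exact key ξ h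

theorem continuous_cothSymbol : Continuous cothSymbol := by
  rw [continuous_iff_continuousAt]
  intro x
  by_cases hx : x = 0
  · subst hx
    obtain ⟨C, -, hC⟩ := exists_cothSymbol_le
    have h0 : cothSymbol 0 = 1 := by simp [cothSymbol, tanhQuotient]
    rw [ContinuousAt, h0]
    refine tendsto_of_tendsto_of_tendsto_of_le_of_le tendsto_const_nhds ?_ one_le_cothSymbol hC
    have : Continuous fun ξ : ℝ => 1 + C * ξ ^ 2 := by fun_prop
    simpa using this.tendsto 0
  · have : cothSymbol =ᶠ[𝓝 x] fun ξ => ξ * Real.cosh ξ / Real.sinh ξ := by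
      filter_upwards [isOpen_ne.mem_nhds hx] with ξ hξ
      rw [cothSymbol, tanhQuotient, if_neg hξ, Real.tanh_eq_sinh_div_cosh, inv_div,
        div_div_eq_mul_div]
    refine ContinuousAt.congr ?_ this.symm
    have := Real.sinh_ne_zero.2 hx
    fun_prop (disch := assumption)

theorem tanhQuotient_eq_inv (ξ : ℝ) : tanhQuotient ξ = (cothSymbol ξ)⁻¹ := by
  rw [cothSymbol, inv_inv]

theorem tanhQuotient_pos (ξ : ℝ) : 0 < tanhQuotient ξ := by
  rw [tanhQuotient_eq_inv]; exact inv_pos.2 (cothSymbol_pos ξ)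

/-! ### Functions with nonnegative cosine transform -/

theorem integrable_exp_neg_mul_abs {r : ℝ} (hr : 0 < r) :
    Integrable fun ξ : ℝ => Real.exp (-(r * |ξ|)) := by
  have h1 : IntegrableOn (fun ξ : ℝ => Real.exp (-(r * |ξ|))) (Ioi 0) := by
    refine (integrableOn_exp_mul_Ioi (neg_lt_zero.2 hr) 0).congr_fun (fun x hx => ?_)
      measurableSet_Ioi
    simp [abs_of_pos (show (0:ℝ) < x from hx)]
  have h2 : IntegrableOn (fun ξ : ℝ => Real.exp (-(r * |ξ|))) (Iic 0) := by
    refine (integrableOn_exp_mul_Iic hr 0).congr_fun (fun x hx => ?_) measurableSet_Iic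
    simp [abs_of_nonpos (show x ≤ (0:ℝ) from hx)]
  rw [← integrableOn_univ, ← Iic_union_Ioi (a := (0:ℝ))]
  exact h2.union h1

theorem integral_exp_neg_mul_abs {r : ℝ} (hr : 0 < r) :
    ∫ ξ : ℝ, Real.exp (-(r * |ξ|)) = 2 / r := by
  rw [integral_comp_abs (f := fun x => Real.exp (-(r * x)))]
  have := integral_exp_mul_Ioi (neg_lt_zero.2 hr) 0
  simp only [neg_mul] at this
  rw [this]
  simp
  field_simp

/-- Integrable functions whose cosine transform is nonnegative. -/
def PosType (h : ℝ → ℝ) : Prop := Integrable h ∧ ∀ x, 0 ≤ ∫ ξ, h ξ * Real.cos (x * ξ)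

theorem Integrable.mul_cos {h : ℝ → ℝ} (hh : Integrable h) (x : ℝ) :
    Integrable fun ξ => h ξ * Real.cos (x * ξ) := by
  refine hh.mul_bdd (c := 1) (by fun_prop) (ae_of_all _ fun ξ => ?_)
  simpa using Real.abs_cos_le_one _

namespace PosType

variable {h : ℝ → ℝ}

/-- Modulation by `cos (a ξ)` averages the transform over its translates by `±a`. -/
theorem mul_cos (hh : PosType h) (a : ℝ) : PosType fun ξ => h ξ * Real.cos (a * ξ) := by
  refine ⟨Integrable.mul_cos hh.1 a, fun x => ?_⟩
  have e : ∀ ξ, h ξ * Real.cos (a * ξ) * Real.cos (x * ξ) =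
      (1 / 2) * (h ξ * Real.cos ((a + x) * ξ) + h ξ * Real.cos ((a - x) * ξ)) := fun ξ => by
    rw [add_mul, sub_mul, Real.cos_add, Real.cos_sub]; ring
  simp_rw [e]
  rw [integral_const_mul, integral_add (Integrable.mul_cos hh.1 _) (Integrable.mul_cos hh.1 _)]
  have := hh.2 (a + x)
  have := hh.2 (a - x)
  positivity

theorem const_mul (hh : PosType h) {c : ℝ} (hc : 0 ≤ c) : PosType fun ξ => c * h ξ := by
  refine ⟨hh.1.const_mul c, fun x => ?_⟩
  simp_rw [mul_assoc]
  rw [integral_const_mul]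
  exact mul_nonneg hc (hh.2 x)

theorem add {k : ℝ → ℝ} (hh : PosType h) (hk : PosType k) : PosType fun ξ => h ξ + k ξ := by
  refine ⟨hh.1.add hk.1, fun x => ?_⟩
  simp_rw [add_mul]
  rw [integral_add (Integrable.mul_cos hh.1 _) (Integrable.mul_cos hk.1 _)]
  exact add_nonneg (hh.2 x) (hk.2 x)

theorem of_tendsto {F : ℕ → ℝ → ℝ} (hF : ∀ n, PosType (F n)) {g : ℝ → ℝ} (hg : Integrable g)
    (hle : ∀ n ξ, |F n ξ| ≤ g ξ) (hlim : ∀ ξ, Tendsto (fun n => F n ξ) atTop (𝓝 (h ξ))) :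
    PosType h := by
  have hm : AEStronglyMeasurable h :=
    aestronglyMeasurable_of_tendsto_ae atTop (fun n => (hF n).1.1) (ae_of_all _ hlim)
  have hi : Integrable h := by
    refine hg.mono' hm (ae_of_all _ fun ξ => ?_)
    exact le_of_tendsto (hlim ξ).abs (Eventually.of_forall fun n => hle n ξ)
  refine ⟨hi, fun x => ?_⟩
  refine ge_of_tendsto (tendsto_integral_of_dominated_convergence g
    (F := fun n ξ => F n ξ * Real.cos (x * ξ)) (f := fun ξ => h ξ * Real.cos (x * ξ)) (fun n =>
    (Integrable.mul_cos (hF n).1 x).1) hg (fun n => ae_of_all _ fun ξ => ?_)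
    (ae_of_all _ fun ξ => (hlim ξ).mul_const _)) (Eventually.of_forall fun n => (hF n).2 x)
  rw [Real.norm_eq_abs, abs_mul]
  exact (mul_le_of_le_one_right (abs_nonneg _) (Real.abs_cos_le_one _)).trans (hle n ξ)

end PosType

theorem integral_exp_neg_mul_abs_mul_cos {b : ℝ} (hb : 0 < b) (ξ : ℝ) :
    ∫ a : ℝ, b / 2 * Real.exp (-(b * |a|)) * Real.cos (a * ξ) = b ^ 2 / (b ^ 2 + ξ ^ 2) := by
  have e : ∀ a : ℝ, b / 2 * Real.exp (-(b * |a|)) * Real.cos (a * ξ) =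
      (fun t => b / 2 * (Real.exp (-(b * t)) * Real.cos (t * ξ))) |a| := fun a => by
    have : Real.cos (|a| * ξ) = Real.cos (a * ξ) := by
      rcases abs_choice a with h | h <;> simp [h]
    simp only [this]; ring
  rw [integral_congr_ae (ae_of_all _ e),
    integral_comp_abs (f := fun t => b / 2 * (Real.exp (-(b * t)) * Real.cos (t * ξ))),
    integral_const_mul]
  have hre : (-(b : ℂ) + ξ * Complex.I).re < 0 := by simpa using hb
  have h1 := integral_exp_mul_complex_Ioi hre 0
  have hint : IntegrableOn (fun x : ℝ => Complex.exp ((-(b : ℂ) + ξ * Complex.I) * x)) (Ioi 0) :=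
    integrableOn_exp_mul_complex_Ioi hre 0
  have h2 := congrArg Complex.re h1
  rw [← RCLike.re_eq_complex_re, ← integral_re hint] at h2
  have e2 : ∀ x : ℝ, RCLike.re (Complex.exp ((-(b : ℂ) + ξ * Complex.I) * x)) =
      Real.exp (-(b * x)) * Real.cos (x * ξ) := fun x => by
    rw [RCLike.re_eq_complex_re, Complex.exp_re]
    simp [mul_comm]
  simp_rw [e2] at h2
  rw [h2]
  simp [Complex.normSq_apply, Complex.div_re]
  have : b * b + ξ * ξ ≠ 0 := by nlinarith [mul_pos hb hb, mul_self_nonneg ξ]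
  have : b ^ 2 + ξ ^ 2 ≠ 0 := by positivity
  field_simp

theorem integral_gaussian_mul_cos {ε : ℝ} (hε : 0 < ε) (x : ℝ) :
    ∫ ξ : ℝ, Real.exp (-ε * ξ ^ 2) * Real.cos (x * ξ) =
      (Real.pi / ε) ^ (1 / 2 : ℝ) * Real.exp (-x ^ 2 / (4 * ε)) := by
  have hre : 0 < (ε : ℂ).re := by simpa using hε
  have h1 := fourierIntegral_gaussian hre x
  have e0 : ∀ ξ : ℝ, Complex.exp (Complex.I * x * ξ) * Complex.exp (-(ε : ℂ) * ξ ^ 2) =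
      Complex.exp (Complex.I * x * ξ) * ((Real.exp (-ε * ξ ^ 2) : ℝ) : ℂ) := fun ξ => by
    push_cast; rfl
  have hint : Integrable (fun ξ : ℝ =>
      Complex.exp (Complex.I * x * ξ) * ((Real.exp (-ε * ξ ^ 2) : ℝ) : ℂ)) := by
    refine (integrable_exp_neg_mul_sq hε).ofReal.bdd_mul (c := 1) (by fun_prop)
      (ae_of_all _ fun ξ => ?_)
    rw [Complex.norm_exp]; simp
  simp_rw [e0] at h1
  have h2 := congrArg Complex.re h1
  rw [← RCLike.re_eq_complex_re, ← integral_re hint] at h2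
  have e2 : ∀ ξ : ℝ, RCLike.re (Complex.exp (Complex.I * x * ξ) *
      ((Real.exp (-ε * ξ ^ 2) : ℝ) : ℂ)) = Real.exp (-ε * ξ ^ 2) * Real.cos (x * ξ) := fun ξ => by
    rw [RCLike.re_eq_complex_re, Complex.re_mul_ofReal, Complex.exp_re]
    simp [mul_comm]
  simp_rw [e2] at h2
  rw [h2]
  have e3 : ((Real.pi : ℂ) / ε) ^ (1 / 2 : ℂ) * Complex.exp (-(x : ℂ) ^ 2 / (4 * ε)) =
      (((Real.pi / ε) ^ (1 / 2 : ℝ) * Real.exp (-x ^ 2 / (4 * ε)) : ℝ) : ℂ) := by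
    push_cast
    rw [Complex.ofReal_cpow (by positivity)]
    push_cast
    rfl
  rw [e3, RCLike.re_eq_complex_re, Complex.ofReal_re]

namespace PosType

variable {h : ℝ → ℝ}

/-- The Lorentzian is the mean of `cos (a ξ)` under the density `(b/2) exp(-b|a|)`, so the product
is a positive mixture of modulations of `h`. -/
theorem mul_lorentz (hh : PosType h) {b : ℝ} (hb : 0 < b) :
    PosType fun ξ => b ^ 2 / (b ^ 2 + ξ ^ 2) * h ξ := by
  have hbd : ∀ ξ : ℝ, b ^ 2 / (b ^ 2 + ξ ^ 2) ≤ 1 := fun ξ =>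
    div_le_one_of_le₀ (by nlinarith [sq_nonneg ξ]) (by positivity)
  have hmeas : Measurable fun ξ : ℝ => b ^ 2 / (b ^ 2 + ξ ^ 2) := by fun_prop
  refine ⟨hh.1.bdd_mul (c := 1) hmeas.aestronglyMeasurable (ae_of_all _ fun ξ => ?_), fun x => ?_⟩
  · rw [Real.norm_eq_abs, abs_of_nonneg (by positivity)]; exact hbd ξ
  have he := (integrable_exp_neg_mul_abs hb).const_mul (b / 2)
  have hx := Integrable.mul_cos hh.1 x
  have hprod : Integrable (Function.uncurry fun ξ a : ℝ => b / 2 * Real.exp (-(b * |a|)) *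
      Real.cos (a * ξ) * (h ξ * Real.cos (x * ξ))) (volume.prod volume) := by
    have h1 := (hx.mul_prod he).bdd_mul (c := 1) (f := fun p : ℝ × ℝ => Real.cos (p.2 * p.1))
      (by fun_prop) (ae_of_all _ fun p => by simpa using Real.abs_cos_le_one _)
    refine h1.congr (ae_of_all _ fun p => ?_)
    simp only [Function.uncurry]; ring
  have e : ∀ ξ, b ^ 2 / (b ^ 2 + ξ ^ 2) * h ξ * Real.cos (x * ξ) =
      ∫ a : ℝ, b / 2 * Real.exp (-(b * |a|)) * Real.cos (a * ξ) * (h ξ * Real.cos (x * ξ)) :=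
    fun ξ => by rw [integral_mul_const, integral_exp_neg_mul_abs_mul_cos hb]; ring
  simp_rw [e]
  rw [integral_integral_swap hprod]
  refine integral_nonneg fun a => ?_
  have e2 : ∀ ξ, b / 2 * Real.exp (-(b * |a|)) * Real.cos (a * ξ) * (h ξ * Real.cos (x * ξ)) =
      b / 2 * Real.exp (-(b * |a|)) * (h ξ * Real.cos (a * ξ) * Real.cos (x * ξ)) :=
    fun ξ => by ring
  simp_rw [e2]
  rw [integral_const_mul]
  exact mul_nonneg (by positivity) ((hh.mul_cos a).2 x)

/-- The exponential series has nonnegative coefficients, so its partial sums preserve the class. The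
Lorentzian is at most one, hence all products are dominated by `exp(c) |h|`. -/
theorem mul_exp_lorentz (hh : PosType h) {b c : ℝ} (hb : 0 < b) (hc : 0 ≤ c) :
    PosType fun ξ => Real.exp (c * (b ^ 2 / (b ^ 2 + ξ ^ 2))) * h ξ := by
  set w : ℝ → ℝ := fun ξ => b ^ 2 / (b ^ 2 + ξ ^ 2) with hw
  have hw0 : ∀ ξ, 0 ≤ w ξ := fun ξ => by positivity
  have hw1 : ∀ ξ, w ξ ≤ 1 := fun ξ =>
    div_le_one_of_le₀ (by nlinarith [sq_nonneg ξ]) (by positivity)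
  have hpow : ∀ n : ℕ, PosType fun ξ => w ξ ^ n * h ξ := by
    intro n
    induction n with
    | zero => simpa using hh
    | succ n ih =>
      have := ih.mul_lorentz hb
      convert this using 2 with ξ
      rw [pow_succ]; ring
  have hsum : ∀ N : ℕ, PosType fun ξ =>
      (∑ k ∈ Finset.range N, (c * w ξ) ^ k / k.factorial) * h ξ := by
    intro N
    induction N with
    | zero => simpa using hh.const_mul le_rfl
    | succ N ih =>
      have := ih.add ((hpow N).const_mul (c := c ^ N / N.factorial) (by positivity))
      convert this using 2 with ξ
      rw [Finset.sum_range_succ]; ring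
  refine of_tendsto hsum (g := fun ξ => Real.exp c * |h ξ|) (hh.1.abs.const_mul _)
    (fun N ξ => ?_) (fun ξ => ?_)
  · have h0 : 0 ≤ c * w ξ := mul_nonneg hc (hw0 ξ)
    rw [abs_mul, abs_of_nonneg (Finset.sum_nonneg fun k _ => by positivity)]
    gcongr
    exact (Real.sum_le_exp_of_nonneg h0 N).trans
      (Real.exp_le_exp.2 (mul_le_of_le_one_right hc (hw1 ξ)))
  · refine Tendsto.mul_const _ ?_
    rw [Real.exp_eq_exp_ℝ]
    exact (NormedSpace.expSeries_div_hasSum_exp (c * w ξ)).tendsto_sum_nat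

theorem gaussian {ε : ℝ} (hε : 0 < ε) : PosType fun ξ => Real.exp (-ε * ξ ^ 2) := by
  refine ⟨integrable_exp_neg_mul_sq hε, fun x => ?_⟩
  rw [integral_gaussian_mul_cos hε]
  positivity

theorem comp_mul (hh : PosType h) {c : ℝ} (hc : c ≠ 0) : PosType fun ξ => h (c * ξ) := by
  refine ⟨hh.1.comp_mul_left' hc, fun x => ?_⟩
  have e : ∀ ξ, h (c * ξ) * Real.cos (x * ξ) =
      (fun u => h u * Real.cos (x / c * u)) (c * ξ) := fun ξ => by
    simp only []; congr 2; field_simp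
  simp_rw [e]
  rw [Measure.integral_comp_mul_left (fun u => h u * Real.cos (x / c * u)) c]
  exact smul_nonneg (abs_nonneg _) (hh.2 _)

end PosType

/-! ### Positive definiteness of `exp(-r ξ coth ξ)` and the kernel it defines -/

theorem integrable_exp_neg_mul_cothSymbol {r : ℝ} (hr : 0 < r) :
    Integrable fun ξ => Real.exp (-(r * cothSymbol ξ)) := by
  have := continuous_cothSymbol
  refine (integrable_exp_neg_mul_abs hr).mono' (by fun_prop) (ae_of_all _ fun ξ => ?_)
  rw [Real.norm_eq_abs, abs_of_pos (Real.exp_pos _)]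
  gcongr
  exact abs_le_cothSymbol ξ

/-- With `b = π(n+1)`, each partial fraction equals `2 - 2b²/(b²+ξ²)`, so it contributes `exp(-2r)`
times the exponential of a positive multiple of a Lorentzian. A Gaussian factor supplies an
integrable start for the induction on the number of terms. It is removed at the end, after the
partial sums have converged. -/
theorem posType_exp_neg_mul_cothSymbol {r : ℝ} (hr : 0 < r) :
    PosType fun ξ => Real.exp (-(r * cothSymbol ξ)) := by
  have h1 : ∀ ε : ℝ, 0 < ε → ∀ N : ℕ, PosType fun ξ =>
      Real.exp (-(r * (1 + ∑ n ∈ Finset.range N, 2 * ξ ^ 2 / (ξ ^ 2 + Real.pi ^ 2 * (n + 1) ^ 2)))) *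
        Real.exp (-ε * ξ ^ 2) := by
    intro ε hε N
    induction N with
    | zero => simpa using (PosType.gaussian hε).const_mul (c := Real.exp (-r)) (Real.exp_pos _).le
    | succ N ih =>
      have hb : 0 < Real.pi * ((N : ℝ) + 1) := by positivity
      have := (ih.mul_exp_lorentz hb (c := 2 * r) (by positivity)).const_mul
        (c := Real.exp (-(2 * r))) (Real.exp_pos _).le
      convert this using 2 with ξ
      rw [Finset.sum_range_succ]
      generalize ∑ n ∈ Finset.range N, 2 * ξ ^ 2 / (ξ ^ 2 + Real.pi ^ 2 * ((n : ℝ) + 1) ^ 2) = S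
      simp only [← Real.exp_add]
      congr 1
      have : ξ ^ 2 + Real.pi ^ 2 * ((N : ℝ) + 1) ^ 2 ≠ 0 := by positivity
      rw [mul_pow, add_comm (Real.pi ^ 2 * ((N : ℝ) + 1) ^ 2)]
      field_simp
      ring
  have h2 : ∀ ε : ℝ, 0 < ε → PosType fun ξ =>
      Real.exp (-(r * cothSymbol ξ)) * Real.exp (-ε * ξ ^ 2) := by
    intro ε hε
    refine PosType.of_tendsto (h1 ε hε) (PosType.gaussian hε).1 (fun N ξ => ?_) (fun ξ => ?_)
    · rw [abs_of_pos (by positivity)]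
      refine mul_le_of_le_one_left (Real.exp_pos _).le ?_
      rw [Real.exp_le_one_iff, neg_nonpos]
      exact mul_nonneg hr.le (add_nonneg zero_le_one (Finset.sum_nonneg fun n _ => by positivity))
    · refine Tendsto.mul_const _ ?_
      rw [cothSymbol_eq]
      refine (Real.continuous_exp.tendsto _).comp (Tendsto.neg (Tendsto.const_mul r ?_))
      exact ((cothSymbol_term_summable ξ).hasSum.tendsto_sum_nat).const_add 1
  refine PosType.of_tendsto (fun n : ℕ => h2 (1 / ((n : ℝ) + 1)) (by positivity))
    (integrable_exp_neg_mul_cothSymbol hr) (fun n ξ => ?_) (fun ξ => ?_)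
  · rw [abs_of_pos (by positivity)]
    refine mul_le_of_le_one_right (Real.exp_pos _).le ?_
    rw [Real.exp_le_one_iff]
    have : 0 ≤ 1 / ((n : ℝ) + 1) * ξ ^ 2 := by positivity
    linarith
  · have h3 : Tendsto (fun n : ℕ => -(1 / ((n : ℝ) + 1)) * ξ ^ 2) atTop (𝓝 0) := by
      simpa using (tendsto_one_div_add_atTop_nhds_zero_nat (𝕜 := ℝ)).neg.mul_const (ξ ^ 2)
    simpa using ((Real.continuous_exp.tendsto _).comp h3).const_mul
      (Real.exp (-(r * cothSymbol ξ)))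

/-- The inverse Fourier transform of `exp (-r ξ coth ξ)`. -/
noncomputable def cothKernel (r x : ℝ) : ℝ :=
  ∫ v, Real.exp (-(r * cothSymbol (2 * Real.pi * v))) * Real.cos (2 * Real.pi * x * v)

theorem cothKernel_nonneg {r : ℝ} (hr : 0 < r) (x : ℝ) : 0 ≤ cothKernel r x :=
  ((posType_exp_neg_mul_cothSymbol hr).comp_mul Real.two_pi_pos.ne').2 _

theorem cothKernel_neg (r x : ℝ) : cothKernel r (-x) = cothKernel r x := by
  simp [cothKernel]

theorem integrable_exp_neg_mul_cothSymbol_two_pi {r : ℝ} (hr : 0 < r) :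
    Integrable fun v => Real.exp (-(r * cothSymbol (2 * Real.pi * v))) :=
  (integrable_exp_neg_mul_cothSymbol hr).comp_mul_left' Real.two_pi_pos.ne'

theorem cothKernel_le {r : ℝ} (hr : 0 < r) (x : ℝ) : cothKernel r x ≤ 1 / (Real.pi * r) := by
  have h0 := integrable_exp_neg_mul_cothSymbol_two_pi hr
  have hr' : 0 < r * (2 * Real.pi) := by positivity
  calc cothKernel r x ≤ ∫ v, Real.exp (-(r * (2 * Real.pi) * |v|)) := by
        refine integral_mono (Integrable.mul_cos h0 _) (integrable_exp_neg_mul_abs hr') fun v => ?_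
        refine (mul_le_of_le_one_right (Real.exp_pos _).le (Real.cos_le_one _)).trans ?_
        refine Real.exp_le_exp.2 (neg_le_neg ?_)
        have := abs_le_cothSymbol (2 * Real.pi * v)
        rw [abs_mul, abs_of_pos Real.two_pi_pos] at this
        rw [mul_assoc]
        gcongr
    _ = 1 / (Real.pi * r) := by
        rw [integral_exp_neg_mul_abs hr']; field_simp

theorem measurable_cothKernel : Measurable fun p : ℝ × ℝ => cothKernel p.1 p.2 := by
  have hc := continuous_cothSymbol
  have : StronglyMeasurable (Function.uncurry fun (p : ℝ × ℝ) (v : ℝ) =>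
      Real.exp (-(p.1 * cothSymbol (2 * Real.pi * v))) * Real.cos (2 * Real.pi * p.2 * v)) := by
    apply Continuous.stronglyMeasurable
    unfold Function.uncurry
    fun_prop
  exact this.integral_prod_right.measurable

theorem measurable_cothKernel_right (r : ℝ) : Measurable (cothKernel r) :=
  measurable_cothKernel.comp measurable_prodMk_left

/-- By Fubini the left side is the mean of `exp(-r ξ coth ξ) ≤ 1`, at `ξ = 2πv`, under a Gaussian
probability density in `v`. -/
theorem integral_cothKernel_mul_gaussian_le {r : ℝ} (hr : 0 < r) {ε : ℝ} (hε : 0 < ε) :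
    ∫ x, cothKernel r x * Real.exp (-ε * x ^ 2) ≤ 1 := by
  have h0 := integrable_exp_neg_mul_cothSymbol_two_pi hr
  have hg := integrable_exp_neg_mul_sq hε
  have hprod : Integrable (Function.uncurry fun x v : ℝ =>
      Real.exp (-(r * cothSymbol (2 * Real.pi * v))) * Real.cos (2 * Real.pi * x * v) *
        Real.exp (-ε * x ^ 2)) (volume.prod volume) := by
    have h1 := (hg.mul_prod h0).bdd_mul (c := 1)
      (f := fun p : ℝ × ℝ => Real.cos (2 * Real.pi * p.1 * p.2))
      (by fun_prop) (ae_of_all _ fun p => by simpa using Real.abs_cos_le_one _)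
    refine h1.congr (ae_of_all _ fun p => ?_)
    simp only [Function.uncurry]; ring
  simp_rw [cothKernel, ← integral_mul_const]
  rw [integral_integral_swap hprod]
  have e : ∀ v x : ℝ, Real.exp (-(r * cothSymbol (2 * Real.pi * v))) *
      Real.cos (2 * Real.pi * x * v) * Real.exp (-ε * x ^ 2) =
      Real.exp (-(r * cothSymbol (2 * Real.pi * v))) *
        (Real.exp (-ε * x ^ 2) * Real.cos (2 * Real.pi * v * x)) := fun v x => by
    rw [mul_assoc, mul_comm (Real.cos _), mul_right_comm (2 * Real.pi)]
  simp_rw [e, integral_const_mul, integral_gaussian_mul_cos hε]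
  have e2 : ∀ v : ℝ, (Real.pi / ε) ^ (1 / 2 : ℝ) *
      Real.exp (-(2 * Real.pi * v) ^ 2 / (4 * ε)) =
      (Real.pi / ε) ^ (1 / 2 : ℝ) * Real.exp (-(Real.pi ^ 2 / ε) * v ^ 2) := fun v => by
    congr 2; field_simp; ring
  simp_rw [e2]
  have hb : 0 < Real.pi ^ 2 / ε := by positivity
  have hg2 := (integrable_exp_neg_mul_sq hb).const_mul ((Real.pi / ε) ^ (1 / 2 : ℝ))
  calc _ ≤ ∫ v : ℝ, (Real.pi / ε) ^ (1 / 2 : ℝ) * Real.exp (-(Real.pi ^ 2 / ε) * v ^ 2) := by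
        refine integral_mono_of_nonneg (ae_of_all _ fun v => by positivity) hg2
          (ae_of_all _ fun v => mul_le_of_le_one_left (by positivity) ?_)
        rw [Real.exp_le_one_iff, neg_nonpos]
        exact mul_nonneg hr.le (cothSymbol_pos _).le
    _ = 1 := by
        rw [integral_const_mul, integral_gaussian, ← Real.sqrt_eq_rpow, ← Real.sqrt_mul (by positivity)]
        rw [Real.sqrt_eq_one]
        field_simp

/-- The kernel is nonnegative and its Gaussian means are bounded by one, so Fatou's lemma as the
Gaussian flattens replaces any decay estimate. -/
theorem integrable_cothKernel {r : ℝ} (hr : 0 < r) : Integrable (cothKernel r) := by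
  refine ⟨(measurable_cothKernel_right r).aestronglyMeasurable, ?_⟩
  rw [hasFiniteIntegral_iff_ofReal (ae_of_all _ (cothKernel_nonneg hr))]
  set F : ℕ → ℝ → ℝ≥0∞ := fun n x =>
    ENNReal.ofReal (cothKernel r x * Real.exp (-(1 / ((n : ℝ) + 1)) * x ^ 2)) with hF
  have hmeas : ∀ n, Measurable (F n) := fun n =>
    ((measurable_cothKernel_right r).mul (by fun_prop)).ennreal_ofReal
  have hlim : ∀ x, Tendsto (fun n => F n x) atTop (𝓝 (ENNReal.ofReal (cothKernel r x))) := by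
    intro x
    refine (ENNReal.continuous_ofReal.tendsto _).comp ?_
    have h3 : Tendsto (fun n : ℕ => -(1 / ((n : ℝ) + 1)) * x ^ 2) atTop (𝓝 0) := by
      simpa using (tendsto_one_div_add_atTop_nhds_zero_nat (𝕜 := ℝ)).neg.mul_const (x ^ 2)
    simpa using ((Real.continuous_exp.tendsto _).comp h3).const_mul (cothKernel r x)
  have hle : ∀ n, ∫⁻ x, F n x ≤ 1 := by
    intro n
    have hε : 0 < 1 / ((n : ℝ) + 1) := by positivity
    have hint : Integrable fun x => cothKernel r x * Real.exp (-(1 / ((n : ℝ) + 1)) * x ^ 2) := by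
      refine (integrable_exp_neg_mul_sq hε).bdd_mul (c := 1 / (Real.pi * r))
        (measurable_cothKernel_right r).aestronglyMeasurable (ae_of_all _ fun x => ?_)
      rw [Real.norm_eq_abs, abs_of_nonneg (cothKernel_nonneg hr x)]
      exact cothKernel_le hr x
    rw [hF, ← ofReal_integral_eq_lintegral_ofReal hint (ae_of_all _ fun x =>
      mul_nonneg (cothKernel_nonneg hr x) (Real.exp_pos _).le), ← ENNReal.ofReal_one]
    exact ENNReal.ofReal_le_ofReal (integral_cothKernel_mul_gaussian_le hr hε)
  calc ∫⁻ x, ENNReal.ofReal (cothKernel r x) = ∫⁻ x, liminf (fun n => F n x) atTop := by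
        simp_rw [fun x => (hlim x).liminf_eq]
    _ ≤ liminf (fun n => ∫⁻ x, F n x) atTop := lintegral_liminf_le hmeas
    _ ≤ 1 := by
        refine (liminf_le_liminf (Eventually.of_forall hle)).trans ?_
        simp
    _ < ∞ := ENNReal.one_lt_top

theorem fourier_exp_cothSymbol {r : ℝ} (hr : 0 < r) (x : ℝ) :
    FourierTransform.fourier
      (fun v : ℝ => ((Real.exp (-(r * cothSymbol (2 * Real.pi * v))) : ℝ) : ℂ)) x =
        (cothKernel r x : ℂ) := by
  have h0 := integrable_exp_neg_mul_cothSymbol_two_pi hr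
  set φ : ℝ → ℝ := fun v => Real.exp (-(r * cothSymbol (2 * Real.pi * v))) with hφ
  have hsin : ∫ v, φ v * Real.sin (2 * Real.pi * x * v) = 0 := by
    have h1 := integral_neg_eq_self (fun v => φ v * Real.sin (2 * Real.pi * x * v)) volume
    have h2 : ∀ v, φ (-v) * Real.sin (2 * Real.pi * x * -v) =
        -(φ v * Real.sin (2 * Real.pi * x * v)) := fun v => by
      simp [hφ, cothSymbol_neg]
    rw [integral_congr_ae (ae_of_all _ h2), integral_neg] at h1
    linarith
  have hi1 : Integrable fun v => φ v * Real.cos (2 * Real.pi * x * v) := Integrable.mul_cos h0 _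
  have hi2 : Integrable fun v => φ v * Real.sin (2 * Real.pi * x * v) := by
    refine h0.mul_bdd (c := 1) (by fun_prop) (ae_of_all _ fun ξ => ?_)
    simpa using Real.abs_sin_le_one _
  rw [Real.fourier_real_eq_integral_exp_smul]
  have e : ∀ v : ℝ, Complex.exp (((-2 * Real.pi * v * x : ℝ) : ℂ) * Complex.I) • (φ v : ℂ) =
      ((φ v * Real.cos (2 * Real.pi * x * v) : ℝ) : ℂ) -
        ((φ v * Real.sin (2 * Real.pi * x * v) : ℝ) : ℂ) * Complex.I := fun v => by
    have : (-2 * Real.pi * v * x : ℝ) = -(2 * Real.pi * x * v) := by ring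
    rw [Complex.exp_mul_I, smul_eq_mul, this, ← Complex.ofReal_cos, ← Complex.ofReal_sin,
      Real.cos_neg, Real.sin_neg]
    push_cast
    ring
  rw [integral_congr_ae (ae_of_all _ e), integral_sub hi1.ofReal (hi2.ofReal.mul_const _), integral_mul_const,
    integral_complex_ofReal, integral_complex_ofReal, hsin]
  simp [cothKernel, hφ]

theorem integral_cothKernel_mul_exp {r : ℝ} (hr : 0 < r) (ξ : ℝ) :
    ∫ x : ℝ, (cothKernel r x : ℂ) * Complex.exp (-(Complex.I * (x : ℂ) * (ξ : ℂ))) =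
      ((Real.exp (-(r * cothSymbol ξ)) : ℝ) : ℂ) := by
  have h0 := integrable_exp_neg_mul_cothSymbol_two_pi hr
  have hc := continuous_cothSymbol
  have hcont : Continuous fun v : ℝ =>
      ((Real.exp (-(r * cothSymbol (2 * Real.pi * v))) : ℝ) : ℂ) := by fun_prop
  have hF : FourierTransform.fourier (fun v : ℝ =>
      ((Real.exp (-(r * cothSymbol (2 * Real.pi * v))) : ℝ) : ℂ)) =
      fun x => (cothKernel r x : ℂ) := funext (fourier_exp_cothSymbol hr)
  -- Fourier inversion is evaluated at `-ξ/(2π)` to match the normalisation `e^{-ixξ}`. The sign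
  -- disappears because the symbol is even.
  have h1 := congrFun (hcont.fourierInv_fourier_eq h0.ofReal
    (by rw [hF]; exact (integrable_cothKernel hr).ofReal)) (-(ξ / (2 * Real.pi)))
  rw [hF, Real.fourierInv_eq'] at h1
  have e1 : 2 * Real.pi * -(ξ / (2 * Real.pi)) = -ξ := by field_simp
  rw [e1, cothSymbol_neg] at h1
  rw [← h1]
  congr 1
  ext x
  rw [smul_eq_mul, mul_comm]
  congr 2
  have : 2 * Real.pi * inner ℝ x (-(ξ / (2 * Real.pi))) = -(x * ξ) := by
    simp only [RCLike.inner_apply, conj_trivial]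
    field_simp
  rw [this]
  push_cast
  ring

theorem integral_cothKernel {r : ℝ} (hr : 0 < r) : ∫ x, cothKernel r x = Real.exp (-r) := by
  have h := integral_cothKernel_mul_exp hr 0
  have h0 : cothSymbol 0 = 1 := by simp [cothSymbol, tanhQuotient]
  simp only [Complex.ofReal_zero, mul_zero, neg_zero, Complex.exp_zero, mul_one, h0] at h
  rw [integral_complex_ofReal] at h
  exact_mod_cast h

/-! ### Uniqueness of the transform and `K_s` as a Gamma mixture -/

/-- The positive and negative parts of `h` are densities of two finite measures with the same
characteristic function. These measures coincide, so both parts agree almost everywhere and must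
vanish. -/
theorem ae_eq_zero_of_fourier_eq_zero {h : ℝ → ℝ} (hh : Integrable h)
    (h0 : ∀ ξ : ℝ, ∫ x : ℝ, (h x : ℂ) * Complex.exp (-(Complex.I * (x : ℂ) * (ξ : ℂ))) = 0) :
    h =ᵐ[volume] 0 := by
  have key : ∀ g : ℝ → ℝ, Integrable g → ∀ t : ℝ,
      charFun (volume.withDensity fun x => ENNReal.ofReal (g x)) t =
        ∫ x : ℝ, ((max (g x) 0 : ℝ) : ℂ) * Complex.exp (-(Complex.I * (x : ℂ) * ((-t : ℝ) : ℂ))) := by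
    intro g hg t
    rw [charFun_apply_real, integral_withDensity_eq_integral_toReal_smul₀
      hg.1.aemeasurable.ennreal_ofReal (ae_of_all _ fun x => ENNReal.ofReal_lt_top)]
    congr 1
    ext x
    rw [ENNReal.toReal_ofReal', Complex.real_smul]
    congr 2
    push_cast
    ring
  have hexp : ∀ g : ℝ → ℝ, Integrable g → ∀ t : ℝ, Integrable fun x : ℝ =>
      ((g x : ℝ) : ℂ) * Complex.exp (-(Complex.I * (x : ℂ) * ((-t : ℝ) : ℂ))) := by
    intro g hg t
    refine hg.ofReal.mul_bdd (c := 1) (by fun_prop) (ae_of_all _ fun x => ?_)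
    rw [Complex.norm_exp]
    simp
  have f1 := isFiniteMeasure_withDensity_ofReal hh.2
  have f2 := isFiniteMeasure_withDensity_ofReal hh.neg.2
  have heq : (volume.withDensity fun x => ENNReal.ofReal (h x)) =
      volume.withDensity fun x => ENNReal.ofReal ((-h) x) := by
    apply Measure.ext_of_charFun
    ext t
    rw [key h hh t, key (-h) hh.neg t, ← sub_eq_zero,
      ← integral_sub (hexp _ hh.pos_part t) (hexp _ hh.neg.pos_part t), ← h0 (-t)]
    congr 1
    ext x
    rw [← sub_mul, ← Complex.ofReal_sub]
    congr 2
    rcases le_total 0 (h x) with hx | hx <;> simp [hx]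
  have h3 := (withDensity_eq_iff hh.1.aemeasurable.ennreal_ofReal
    hh.neg.1.aemeasurable.ennreal_ofReal hh.lintegral_lt_top.ne).1 heq
  filter_upwards [h3] with x hx
  rcases le_total 0 (h x) with h4 | h4
  · have : ENNReal.ofReal (-h x) = 0 := ENNReal.ofReal_of_nonpos (by linarith)
    simp only [Pi.neg_apply, this, ENNReal.ofReal_eq_zero] at hx
    exact le_antisymm hx h4
  · have : ENNReal.ofReal (h x) = 0 := ENNReal.ofReal_of_nonpos h4
    simp only [Pi.neg_apply, this] at hx
    have := ENNReal.ofReal_eq_zero.1 hx.symm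
    exact le_antisymm h4 (neg_nonpos.1 this)

theorem IsWhithamKernel.ae_eq {s : ℝ} {K L : ℝ → ℝ} (hK : IsWhithamKernel s K)
    (hL : IsWhithamKernel s L) : K =ᵐ[volume] L := by
  have hexp : ∀ g : ℝ → ℝ, Integrable g → ∀ t : ℝ, Integrable fun x : ℝ =>
      ((g x : ℝ) : ℂ) * Complex.exp (-(Complex.I * (x : ℂ) * (t : ℂ))) := by
    intro g hg t
    refine hg.ofReal.mul_bdd (c := 1) (by fun_prop) (ae_of_all _ fun x => ?_)
    rw [Complex.norm_exp]
    simp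
  have := ae_eq_zero_of_fourier_eq_zero (hK.1.sub hL.1) fun ξ => by
    have e : ∀ x : ℝ, (((K - L) x : ℝ) : ℂ) * Complex.exp (-(Complex.I * (x : ℂ) * (ξ : ℂ))) =
        (K x : ℂ) * Complex.exp (-(Complex.I * (x : ℂ) * (ξ : ℂ))) -
        (L x : ℂ) * Complex.exp (-(Complex.I * (x : ℂ) * (ξ : ℂ))) := fun x => by
      simp [sub_mul]
    simp_rw [e]
    rw [integral_sub (hexp K hK.1 ξ) (hexp L hL.1 ξ), hK.2, hL.2, sub_self]
  filter_upwards [this] with x hx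
  exact sub_eq_zero.1 hx

/-- The Whitham kernel as a mixture of the kernels `cothKernel r`. -/
noncomputable def whithamDensity (s x : ℝ) : ℝ :=
  (Real.Gamma s)⁻¹ * ∫ r in Ioi (0 : ℝ), r ^ (s - 1) * cothKernel r x

theorem whithamDensity_nonneg {s : ℝ} (hs : 0 < s) (x : ℝ) : 0 ≤ whithamDensity s x :=
  mul_nonneg (inv_nonneg.2 (Real.Gamma_pos_of_pos hs).le)
    (setIntegral_nonneg measurableSet_Ioi fun _ hr =>
      mul_nonneg (Real.rpow_nonneg (le_of_lt hr) _) (cothKernel_nonneg hr x))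

theorem whithamDensity_neg (s x : ℝ) : whithamDensity s (-x) = whithamDensity s x := by
  simp [whithamDensity, cothKernel_neg]

theorem measurable_whithamDensity (s : ℝ) : Measurable (whithamDensity s) := by
  have : StronglyMeasurable (Function.uncurry fun x r : ℝ => r ^ (s - 1) * cothKernel r x) :=
    ((measurable_snd.pow_const _).mul (measurable_cothKernel.comp measurable_swap)).stronglyMeasurable
  exact (this.integral_prod_right (ν := volume.restrict (Ioi 0))).measurable.const_mul _

theorem integrableOn_rpow_mul_exp_neg_mul {a r : ℝ} (ha : 0 < a) (hr : 0 < r) :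
    IntegrableOn (fun t : ℝ => t ^ (a - 1) * Real.exp (-(r * t))) (Ioi 0) := by
  have h := Real.integral_rpow_mul_exp_neg_mul_Ioi ha hr
  -- The Gamma formula gives the integral a positive value, whereas the integral of a non-integrable
  -- function is `0` by convention.
  by_contra hc
  rw [integral_undef hc] at h
  exact (mul_pos (Real.rpow_pos_of_pos (one_div_pos.2 hr) a) (Real.Gamma_pos_of_pos ha)).ne h

theorem integrable_whithamDensity_prod {s : ℝ} (hs : 0 < s) :
    Integrable (fun p : ℝ × ℝ => p.1 ^ (s - 1) * cothKernel p.1 p.2)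
      ((volume.restrict (Ioi 0)).prod volume) := by
  have hmeas : Measurable fun p : ℝ × ℝ => p.1 ^ (s - 1) * cothKernel p.1 p.2 :=
    (measurable_fst.pow_const _).mul measurable_cothKernel
  rw [integrable_prod_iff hmeas.aestronglyMeasurable]
  constructor
  · filter_upwards [ae_restrict_mem measurableSet_Ioi] with r hr
    exact (integrable_cothKernel hr).const_mul _
  · have h1 := integrableOn_rpow_mul_exp_neg_mul hs one_pos
    refine h1.congr ?_
    filter_upwards [ae_restrict_mem measurableSet_Ioi] with r hr
    have e : ∀ x, ‖r ^ (s - 1) * cothKernel r x‖ = r ^ (s - 1) * cothKernel r x := fun x => by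
      rw [Real.norm_eq_abs, abs_of_nonneg]
      exact mul_nonneg (Real.rpow_nonneg (le_of_lt hr) _) (cothKernel_nonneg hr x)
    simp_rw [e, integral_const_mul, integral_cothKernel hr, one_mul]

/-- For `ψ = ξ coth ξ > 0` one has `ψ^{-s} = Γ(s)⁻¹ ∫ r^{s-1} e^{-rψ} dr`. Absolute integrability on
the product space allows the transform to be taken under the `r`-integral. -/
theorem isWhithamKernel_whithamDensity {s : ℝ} (hs : 0 < s) :
    IsWhithamKernel s (whithamDensity s) := by
  have hprod := integrable_whithamDensity_prod hs
  refine ⟨(hprod.integral_prod_right).const_mul _, fun ξ => ?_⟩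
  have hΓ := (Real.Gamma_pos_of_pos hs).ne'
  have hprod2 : Integrable (Function.uncurry fun x r : ℝ =>
      ((r ^ (s - 1) * cothKernel r x : ℝ) : ℂ) *
        Complex.exp (-(Complex.I * (x : ℂ) * (ξ : ℂ)))) (volume.prod (volume.restrict (Ioi 0))) := by
    refine hprod.swap.ofReal.mul_bdd (c := 1) (g := fun p : ℝ × ℝ =>
      Complex.exp (-(Complex.I * (p.1 : ℂ) * (ξ : ℂ)))) (by fun_prop) (ae_of_all _ fun x => ?_)
    rw [Complex.norm_exp]
    simp
  have e1 : ∀ x : ℝ, (whithamDensity s x : ℂ) * Complex.exp (-(Complex.I * (x : ℂ) * (ξ : ℂ))) =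
      ((Real.Gamma s)⁻¹ : ℝ) * ∫ r in Ioi (0 : ℝ), ((r ^ (s - 1) * cothKernel r x : ℝ) : ℂ) *
        Complex.exp (-(Complex.I * (x : ℂ) * (ξ : ℂ))) := fun x => by
    rw [integral_mul_const, integral_complex_ofReal, whithamDensity]
    push_cast
    ring
  rw [integral_congr_ae (ae_of_all _ e1), integral_const_mul, integral_integral_swap hprod2]
  have e2 : ∀ r ∈ Ioi (0 : ℝ), ∫ x : ℝ, ((r ^ (s - 1) * cothKernel r x : ℝ) : ℂ) *
        Complex.exp (-(Complex.I * (x : ℂ) * (ξ : ℂ))) =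
      ((r ^ (s - 1) * Real.exp (-(cothSymbol ξ * r)) : ℝ) : ℂ) := fun r hr => by
    have e3 : ∀ x : ℝ, ((r ^ (s - 1) * cothKernel r x : ℝ) : ℂ) *
        Complex.exp (-(Complex.I * (x : ℂ) * (ξ : ℂ))) = ((r ^ (s - 1) : ℝ) : ℂ) *
        ((cothKernel r x : ℂ) * Complex.exp (-(Complex.I * (x : ℂ) * (ξ : ℂ)))) := fun x => by
      rw [Complex.ofReal_mul, mul_assoc]
    rw [integral_congr_ae (ae_of_all _ e3), integral_const_mul, integral_cothKernel_mul_exp hr,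
      ← Complex.ofReal_mul, mul_comm r]
  rw [setIntegral_congr_fun measurableSet_Ioi e2, integral_complex_ofReal,
    Real.integral_rpow_mul_exp_neg_mul_Ioi hs (cothSymbol_pos ξ), ← Complex.ofReal_mul,
    tanhQuotient_eq_inv, one_div]
  congr 1
  field_simp

theorem whithamKernel_ae_eq {s : ℝ} (hs : 0 < s) :
    whithamKernel s =ᵐ[volume] whithamDensity s := by
  have h : ∃ K : ℝ → ℝ, IsWhithamKernel s K := ⟨_, isWhithamKernel_whithamDensity hs⟩
  have h1 : IsWhithamKernel s (whithamKernel s) := by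
    rw [whithamKernel, dif_pos h]
    exact Classical.choose_spec h
  exact h1.ae_eq (isWhithamKernel_whithamDensity hs)

theorem whithamConv_eq {s : ℝ} (hs : 0 < s) (f : ℝ → ℝ) (x : ℝ) :
    whithamConv s f x = ∫ y, whithamDensity s (x - y) * f y := by
  rw [whithamConv, convolution_mul, ← integral_sub_left_eq_self _ volume x]
  refine integral_congr_ae ?_
  have := (quasiMeasurePreserving_sub_left volume x).ae_eq_comp (whithamKernel_ae_eq hs)
  filter_upwards [this] with y hy
  simp only [Function.comp_apply] at hy
  simp [hy]

theorem integrable_whithamDensity {s : ℝ} (hs : 0 < s) : Integrable (whithamDensity s) :=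
  (isWhithamKernel_whithamDensity hs).1

theorem integral_whithamDensity {s : ℝ} (hs : 0 < s) : ∫ x, whithamDensity s x = 1 := by
  have h := (isWhithamKernel_whithamDensity hs).2 0
  simp only [Complex.ofReal_zero, mul_zero, neg_zero, Complex.exp_zero, mul_one] at h
  rw [integral_complex_ofReal] at h
  have h2 : tanhQuotient 0 = 1 := by simp [tanhQuotient]
  rw [h2, Real.one_rpow] at h
  exact_mod_cast h

/-- Only an inequality at every point: where the `r`-integral diverges, the Bochner integral is `0`
by convention. Equality holds almost everywhere. -/
theorem ofReal_whithamDensity_le {s : ℝ} (hs : 0 < s) (x : ℝ) :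
    ENNReal.ofReal (whithamDensity s x) ≤ ENNReal.ofReal (Real.Gamma s)⁻¹ *
      ∫⁻ r in Ioi (0 : ℝ), ENNReal.ofReal (r ^ (s - 1) * cothKernel r x) := by
  rw [whithamDensity, ENNReal.ofReal_mul (inv_nonneg.2 (Real.Gamma_pos_of_pos hs).le)]
  gcongr
  refine (Real.ofReal_le_enorm _).trans ((enorm_integral_le_lintegral_enorm _).trans_eq ?_)
  refine setLIntegral_congr_fun measurableSet_Ioi fun r hr => ?_
  exact Real.enorm_eq_ofReal (mul_nonneg (Real.rpow_nonneg (le_of_lt hr) _) (cothKernel_nonneg hr x))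

theorem ofReal_whithamDensity_ae_eq {s : ℝ} (hs : 0 < s) :
    ∀ᵐ x, ENNReal.ofReal (whithamDensity s x) = ENNReal.ofReal (Real.Gamma s)⁻¹ *
      ∫⁻ r in Ioi (0 : ℝ), ENNReal.ofReal (r ^ (s - 1) * cothKernel r x) := by
  filter_upwards [(integrable_whithamDensity_prod hs).prod_left_ae] with x hx
  rw [whithamDensity, ENNReal.ofReal_mul (inv_nonneg.2 (Real.Gamma_pos_of_pos hs).le),
    ofReal_integral_eq_lintegral_ofReal hx]
  filter_upwards [ae_restrict_mem measurableSet_Ioi] with r hr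
  exact mul_nonneg (Real.rpow_nonneg (le_of_lt hr) _) (cothKernel_nonneg hr x)

/-! ### Integrability, semigroup law and moments of `K_{1/2}` -/

theorem lintegral_cothKernel_rpow_le {r : ℝ} (hr : 0 < r) :
    ∫⁻ x, ENNReal.ofReal (cothKernel r x ^ (3 / 2 : ℝ)) ≤
      ENNReal.ofReal ((Real.pi * r) ^ (-(1 / 2) : ℝ) * Real.exp (-r)) := by
  have hπ : 0 < Real.pi * r := by positivity
  calc ∫⁻ x, ENNReal.ofReal (cothKernel r x ^ (3 / 2 : ℝ))
      ≤ ∫⁻ x, ENNReal.ofReal ((Real.pi * r) ^ (-(1 / 2) : ℝ) * cothKernel r x) := by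
        refine lintegral_mono fun x => ENNReal.ofReal_le_ofReal ?_
        have h0 := cothKernel_nonneg hr x
        rw [show (3 / 2 : ℝ) = 1 / 2 + 1 by norm_num, Real.rpow_add_one' h0 (by norm_num),
          Real.rpow_neg hπ.le, ← Real.inv_rpow hπ.le]
        gcongr
        simpa using cothKernel_le hr x
    _ = _ := by
        rw [← ofReal_integral_eq_lintegral_ofReal ((integrable_cothKernel hr).const_mul _)
          (ae_of_all _ fun x => mul_nonneg (by positivity) (cothKernel_nonneg hr x)),
          integral_const_mul, integral_cothKernel hr]

/-- Hölder in `r` with exponents 3 and 3/2, after writing `r^{-1/2} = (r^{-1/4} e^{-r/6}) (r^{-1/4}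
e^{r/6})`. The cube of the first factor is `r^{-3/4} e^{-r/2}`. The second factor times the kernel,
raised to the power 3/2 and integrated in `x`, is at most a constant times `r^{-7/8} e^{-3r/4}`.
Both are integrable on the half-line. The exponent 3/2 is dual to the `L³` control that the cubic
growth of `Ψ` provides. -/
theorem memLp_whithamDensity_half : MemLp (whithamDensity (1 / 2)) (3 / 2) := by
  refine ⟨(measurable_whithamDensity _).aestronglyMeasurable, ?_⟩
  have h32 : ((3 / 2 : ℝ≥0∞)).toReal = 3 / 2 := by simp
  rw [eLpNorm_lt_top_iff_lintegral_rpow_enorm_lt_top (by simp)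
    (ENNReal.div_ne_top (by simp) (by simp)), h32]
  set A : ℝ → ℝ≥0∞ := fun r => ENNReal.ofReal (r ^ (-(1 / 4) : ℝ) * Real.exp (-(r / 6))) with hA
  set B : ℝ → ℝ → ℝ≥0∞ := fun x r =>
    ENNReal.ofReal (r ^ (-(1 / 4) : ℝ) * Real.exp (r / 6) * cothKernel r x) with hB
  set c := ENNReal.ofReal (Real.Gamma (1 / 2))⁻¹ with hc
  have hmA : Measurable A := by
    apply Measurable.ennreal_ofReal
    exact (measurable_id.pow_const _).mul (by fun_prop)
  have hmB : Measurable (Function.uncurry B) := by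
    apply Measurable.ennreal_ofReal
    exact ((measurable_snd.pow_const _).mul (by fun_prop)).mul
      (measurable_cothKernel.comp measurable_swap)
  have hA3 : ∫⁻ r in Ioi (0 : ℝ), A r ^ (3 : ℝ) < ∞ := by
    have h := (integrableOn_rpow_mul_exp_neg_mul (a := 1 / 4) (r := 1 / 2) (by norm_num)
      (by norm_num)).lintegral_lt_top
    refine lt_of_le_of_lt (setLIntegral_mono' measurableSet_Ioi fun r hr => ?_) h
    have hr : 0 < r := hr
    rw [hA, ENNReal.ofReal_rpow_of_nonneg (by positivity) (by norm_num)]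
    refine ENNReal.ofReal_le_ofReal (le_of_eq ?_)
    rw [Real.mul_rpow (by positivity) (by positivity), ← Real.rpow_mul hr.le, ← Real.exp_mul]
    congr 2 <;> ring
  have hBB : ∫⁻ x, ∫⁻ r in Ioi (0 : ℝ), B x r ^ (3 / 2 : ℝ) < ∞ := by
    rw [lintegral_lintegral_swap (hmB.pow_const _).aemeasurable]
    have h := ((integrableOn_rpow_mul_exp_neg_mul (a := 1 / 8) (r := 3 / 4) (by norm_num)
      (by norm_num)).const_mul (Real.pi ^ (-(1 / 2) : ℝ))).lintegral_lt_top
    refine lt_of_le_of_lt (setLIntegral_mono' measurableSet_Ioi fun r hr => ?_) h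
    have hr : 0 < r := hr
    calc ∫⁻ x, B x r ^ (3 / 2 : ℝ)
        = ∫⁻ x, ENNReal.ofReal ((r ^ (-(1 / 4) : ℝ) * Real.exp (r / 6)) ^ (3 / 2 : ℝ)) *
            ENNReal.ofReal (cothKernel r x ^ (3 / 2 : ℝ)) := by
          congr 1
          ext x
          have h0 := cothKernel_nonneg hr x
          rw [hB, ENNReal.ofReal_rpow_of_nonneg (by positivity) (by norm_num),
            Real.mul_rpow (by positivity) h0, ENNReal.ofReal_mul (by positivity)]
      _ ≤ ENNReal.ofReal ((r ^ (-(1 / 4) : ℝ) * Real.exp (r / 6)) ^ (3 / 2 : ℝ)) *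
            ENNReal.ofReal ((Real.pi * r) ^ (-(1 / 2) : ℝ) * Real.exp (-r)) := by
          rw [lintegral_const_mul' _ _ ENNReal.ofReal_ne_top]
          gcongr
          exact lintegral_cothKernel_rpow_le hr
      _ = _ := by
          rw [← ENNReal.ofReal_mul (by positivity)]
          congr 1
          rw [Real.mul_rpow (by positivity) (by positivity), ← Real.rpow_mul hr.le, ← Real.exp_mul,
            Real.mul_rpow Real.pi_pos.le hr.le]
          have e1 : r ^ (1 / 8 - 1 : ℝ) = r ^ (-(1 / 4) * (3 / 2) : ℝ) * r ^ (-(1 / 2) : ℝ) := by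
            rw [← Real.rpow_add hr]; norm_num
          have e2 : Real.exp (-(3 / 4 * r)) = Real.exp (r / 6 * (3 / 2)) * Real.exp (-r) := by
            rw [← Real.exp_add]; congr 1; ring
          rw [e1, e2]
          ring
  have hpt : ∀ x, ‖whithamDensity (1 / 2) x‖ₑ ^ (3 / 2 : ℝ) ≤
      (c ^ (3 / 2 : ℝ) * (∫⁻ r in Ioi (0 : ℝ), A r ^ (3 : ℝ)) ^ (1 / 2 : ℝ)) *
        ∫⁻ r in Ioi (0 : ℝ), B x r ^ (3 / 2 : ℝ) := by
    intro x
    have h1 : ‖whithamDensity (1 / 2) x‖ₑ ≤ c * ∫⁻ r in Ioi (0 : ℝ), (A * B x) r := by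
      rw [Real.enorm_eq_ofReal (whithamDensity_nonneg (by norm_num) x)]
      refine (ofReal_whithamDensity_le (by norm_num) x).trans (le_of_eq ?_)
      congr 1
      refine setLIntegral_congr_fun measurableSet_Ioi fun r hr => ?_
      have hr : 0 < r := hr
      have h0 := cothKernel_nonneg hr x
      simp only [hA, hB, Pi.mul_apply]
      rw [← ENNReal.ofReal_mul (by positivity)]
      congr 1
      have e1 : r ^ (1 / 2 - 1 : ℝ) = r ^ (-(1 / 4) : ℝ) * r ^ (-(1 / 4) : ℝ) := by
        rw [← Real.rpow_add hr]; norm_num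
      have e2 : Real.exp (-(r / 6)) * Real.exp (r / 6) = 1 := by
        rw [← Real.exp_add]; simp
      rw [e1]
      linear_combination (-(r ^ (-(1 / 4) : ℝ) * r ^ (-(1 / 4) : ℝ) * cothKernel r x)) * e2
    have hpq : (3 : ℝ).HolderConjugate (3 / 2) := by
      rw [Real.holderConjugate_iff]; norm_num
    have h2 := ENNReal.lintegral_mul_le_Lp_mul_Lq (volume.restrict (Ioi (0 : ℝ))) hpq
      hmA.aemeasurable (hmB.comp measurable_prodMk_left).aemeasurable (g := B x)
    calc ‖whithamDensity (1 / 2) x‖ₑ ^ (3 / 2 : ℝ) ≤ (c *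
          ((∫⁻ r in Ioi (0 : ℝ), A r ^ (3 : ℝ)) ^ (1 / 3 : ℝ) *
            (∫⁻ r in Ioi (0 : ℝ), B x r ^ (3 / 2 : ℝ)) ^ (1 / (3 / 2) : ℝ))) ^ (3 / 2 : ℝ) := by
          gcongr
          exact h1.trans (by gcongr)
      _ = _ := by
          rw [ENNReal.mul_rpow_of_nonneg _ _ (by norm_num),
            ENNReal.mul_rpow_of_nonneg _ _ (by norm_num), ← ENNReal.rpow_mul, ← ENNReal.rpow_mul,
            mul_assoc]
          norm_num
  refine lt_of_le_of_lt (lintegral_mono hpt) ?_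
  rw [lintegral_const_mul _ ((hmB.pow_const _).lintegral_prod_right)]
  refine ENNReal.mul_lt_top (ENNReal.mul_lt_top ?_ ?_) hBB
  · exact ENNReal.rpow_lt_top_of_nonneg (by norm_num) ENNReal.ofReal_ne_top
  · exact ENNReal.rpow_lt_top_of_nonneg (by norm_num) hA3.ne

/-- Convolution multiplies transforms, so `K_{1/4} ∗ K_{1/4}` has the transform of `K_{1/2}`.
Uniqueness then identifies the two almost everywhere. -/
theorem whithamDensity_semigroup :
    ∀ᵐ u, whithamDensity (1 / 2) u =
      ∫ t, whithamDensity (1 / 4) t * whithamDensity (1 / 4) (u - t) := by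
  have h4 : (0 : ℝ) < 1 / 4 := by norm_num
  set k := whithamDensity (1 / 4) with hk
  have hki : Integrable k := integrable_whithamDensity h4
  set K : ℝ → ℝ := convolution k k (ContinuousLinearMap.mul ℝ ℝ) volume with hK
  have hFT : ∀ (g : ℝ → ℝ) (ξ : ℝ), FourierTransform.fourier (fun x => (g x : ℂ))
      (ξ / (2 * Real.pi)) = ∫ x : ℝ, (g x : ℂ) * Complex.exp (-(Complex.I * (x : ℂ) * (ξ : ℂ))) := by
    intro g ξ
    rw [Real.fourier_real_eq_integral_exp_smul]
    congr 1
    ext x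
    rw [smul_eq_mul, mul_comm]
    congr 2
    have : -2 * Real.pi * x * (ξ / (2 * Real.pi)) = -(x * ξ) := by field_simp
    rw [this]; push_cast; ring
  have hKW : IsWhithamKernel (1 / 2) K := by
    refine ⟨hki.integrable_convolution _ hki, fun ξ => ?_⟩
    have h1 := Real.fourier_mul_convolution_eq (R := ℂ) hki.ofReal hki.ofReal (ξ / (2 * Real.pi))
    have h2 : convolution (fun x => (k x : ℂ)) (fun x => (k x : ℂ))
        (ContinuousLinearMap.mul ℂ ℂ) volume = fun x => (K x : ℂ) := by
      ext x
      rw [hK, convolution_def, convolution_def, ← integral_complex_ofReal]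
      simp
    have h3 := (isWhithamKernel_whithamDensity h4).2 ξ
    rw [← hFT, ← h2]
    refine h1.trans ?_
    erw [hFT k ξ]
    rw [h3, ← Complex.ofReal_mul, ← Real.rpow_add (tanhQuotient_pos ξ)]
    norm_num
  filter_upwards [(isWhithamKernel_whithamDensity (by norm_num)).ae_eq hKW] with u hu
  rw [hu, hK, convolution_mul]

/-- The transform is `1 - O(ξ²)`, that is, `∫ K(u)(1 - cos ξu) du ≤ C ξ²`. Dividing by `ξ²` along `ξ
= 1/(n+1)` and applying Fatou bounds the second moment, which dominates the first because `|u| ≤ 1 +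
u²`. -/
theorem integrable_abs_mul_whithamDensity_half :
    Integrable fun u => |u| * whithamDensity (1 / 2) u := by
  have h2 : (0 : ℝ) < 1 / 2 := by norm_num
  set k := whithamDensity (1 / 2) with hk
  have hki : Integrable k := integrable_whithamDensity h2
  have hk0 : ∀ x, 0 ≤ k x := whithamDensity_nonneg h2
  have hkm : Measurable k := measurable_whithamDensity _
  obtain ⟨C, hC0, hC⟩ := exists_cothSymbol_le
  have hcos : ∀ ξ : ℝ, ∫ u, k u * (1 - Real.cos (ξ * u)) ≤ C * ξ ^ 2 := by
    intro ξ
    have hi := Integrable.mul_cos hki ξ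
    have h3 := congrArg Complex.re ((isWhithamKernel_whithamDensity h2).2 ξ)
    have hint : Integrable fun x : ℝ =>
        (k x : ℂ) * Complex.exp (-(Complex.I * (x : ℂ) * (ξ : ℂ))) := by
      refine hki.ofReal.mul_bdd (c := 1) (by fun_prop) (ae_of_all _ fun x => ?_)
      rw [Complex.norm_exp]
      simp
    rw [← RCLike.re_eq_complex_re, ← integral_re hint] at h3
    have e : ∀ x : ℝ, RCLike.re ((k x : ℂ) * Complex.exp (-(Complex.I * (x : ℂ) * (ξ : ℂ)))) =
        k x * Real.cos (ξ * x) := fun x => by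
      rw [RCLike.re_eq_complex_re, Complex.re_ofReal_mul, Complex.exp_re]
      simp [mul_comm]
    rw [integral_congr_ae (ae_of_all _ e), RCLike.re_eq_complex_re, Complex.ofReal_re] at h3
    simp_rw [mul_sub, mul_one]
    rw [integral_sub hki hi, h3, hk, integral_whithamDensity h2, tanhQuotient_eq_inv]
    have hψ := one_le_cothSymbol ξ
    have h5 : (cothSymbol ξ)⁻¹ ≤ (cothSymbol ξ)⁻¹ ^ (1 / 2 : ℝ) := by
      have := Real.rpow_le_rpow_of_exponent_ge (inv_pos.2 (cothSymbol_pos ξ))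
        (inv_le_one_of_one_le₀ hψ) (show (1 / 2 : ℝ) ≤ 1 by norm_num)
      simpa using this
    have h6 : 1 - (cothSymbol ξ)⁻¹ ≤ cothSymbol ξ - 1 := by
      have h7 := mul_inv_cancel₀ (cothSymbol_pos ξ).ne'
      have h8 : 0 ≤ (cothSymbol ξ)⁻¹ := inv_nonneg.2 (cothSymbol_pos ξ).le
      nlinarith [sq_nonneg (cothSymbol ξ - 1), mul_nonneg h8 (sq_nonneg (cothSymbol ξ - 1))]
    have := hC ξ
    linarith
  have hsq : ∫⁻ u, ENNReal.ofReal (k u * (2 / Real.pi ^ 2 * u ^ 2)) ≤ ENNReal.ofReal C := by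
    set F : ℕ → ℝ → ℝ≥0∞ := fun n u =>
      ENNReal.ofReal (((n : ℝ) + 1) ^ 2 * (k u * (1 - Real.cos (1 / ((n : ℝ) + 1) * u)))) with hF
    have hFm : ∀ n, Measurable (F n) := fun n => by fun_prop
    have hle : ∀ n, ∫⁻ u, F n u ≤ ENNReal.ofReal C := by
      intro n
      have hi : Integrable fun u => k u * (1 - Real.cos (1 / ((n : ℝ) + 1) * u)) := by
        simp_rw [mul_sub, mul_one]
        exact hki.sub (Integrable.mul_cos hki _)
      rw [hF, ← ofReal_integral_eq_lintegral_ofReal (hi.const_mul _) (ae_of_all _ fun u =>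
        mul_nonneg (by positivity) (mul_nonneg (hk0 u) (sub_nonneg.2 (Real.cos_le_one _)))),
        integral_const_mul]
      refine ENNReal.ofReal_le_ofReal ?_
      calc _ ≤ ((n : ℝ) + 1) ^ 2 * (C * (1 / ((n : ℝ) + 1)) ^ 2) := by
            gcongr; exact hcos _
        _ = C := by field_simp
    calc _ ≤ ∫⁻ u, liminf (fun n => F n u) atTop := by
          refine lintegral_mono fun u => ?_
          refine le_liminf_of_le (by isBoundedDefault) ?_
          filter_upwards [eventually_ge_atTop ⌈|u|⌉₊] with n hn
          refine ENNReal.ofReal_le_ofReal ?_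
          have hn' : |u| ≤ (n : ℝ) + 1 := (Nat.ceil_le.1 hn).trans (by linarith)
          have h1 : |1 / ((n : ℝ) + 1) * u| ≤ Real.pi := by
            rw [abs_mul, abs_of_pos (by positivity : (0:ℝ) < 1 / ((n : ℝ) + 1)), one_div,
              inv_mul_le_iff₀ (by positivity)]
            nlinarith [Real.pi_gt_three]
          have h4 : Real.cos (1 / ((n : ℝ) + 1) * u) ≤
            1 - 2 / Real.pi ^ 2 * (1 / ((n : ℝ) + 1) * u) ^ 2 := Real.cos_le_one_sub_mul_cos_sq h1
          calc k u * (2 / Real.pi ^ 2 * u ^ 2) = ((n : ℝ) + 1) ^ 2 *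
                (k u * (2 / Real.pi ^ 2 * (1 / ((n : ℝ) + 1) * u) ^ 2)) := by field_simp
            _ ≤ _ := by
                have := hk0 u
                gcongr
                linarith
      _ ≤ liminf (fun n => ∫⁻ u, F n u) atTop := lintegral_liminf_le hFm
      _ ≤ _ := by
          refine (liminf_le_liminf (Eventually.of_forall hle)).trans ?_
          simp
  have hsqi : Integrable fun u => k u * (2 / Real.pi ^ 2 * u ^ 2) := by
    refine ⟨by fun_prop, ?_⟩
    rw [hasFiniteIntegral_iff_ofReal (ae_of_all _ fun u => mul_nonneg (hk0 u) (by positivity))]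
    exact hsq.trans_lt ENNReal.ofReal_lt_top
  refine (hki.add (hsqi.const_mul (Real.pi ^ 2 / 2))).mono' (by fun_prop) (ae_of_all _ fun u => ?_)
  rw [Real.norm_eq_abs, abs_of_nonneg (mul_nonneg (abs_nonneg _) (hk0 u)), Pi.add_apply]
  have e : Real.pi ^ 2 / 2 * (k u * (2 / Real.pi ^ 2 * u ^ 2)) = k u * u ^ 2 := by
    field_simp
  rw [e]
  have := sq_abs u
  nlinarith [hk0 u, sq_nonneg (|u| - 1), mul_nonneg (hk0 u) (sq_nonneg (|u| - 1)), mul_nonneg (hk0 u) (sq_nonneg (|u|))]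

/-! ### Quadratic forms of the kernels under dilation -/

/-- The quadratic form `∬ f(x) k(x - y) f(y)` of a nonnegative kernel and a nonnegative function. -/
noncomputable def lform (k f : ℝ → ℝ) : ℝ≥0∞ := ∫⁻ x, ∫⁻ y, ENNReal.ofReal (f x * k (x - y) * f y)

theorem lform_whithamDensity {s : ℝ} (hs : 0 < s) {f : ℝ → ℝ} (hf : Measurable f)
    (hf0 : ∀ x, 0 ≤ f x) :
    lform (whithamDensity s) f = ENNReal.ofReal (Real.Gamma s)⁻¹ *
      ∫⁻ r in Ioi (0 : ℝ), ENNReal.ofReal (r ^ (s - 1)) * lform (cothKernel r) f := by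
  have hmr : Measurable fun r : ℝ => ENNReal.ofReal (r ^ (s - 1)) :=
    (measurable_id.pow_const _).ennreal_ofReal
  have hG : Measurable fun q : (ℝ × ℝ) × ℝ =>
      ENNReal.ofReal (f q.1.1 * cothKernel q.1.2 (q.1.1 - q.2) * f q.2) := by
    apply Measurable.ennreal_ofReal
    refine ((hf.comp (by fun_prop)).mul ?_).mul (hf.comp (by fun_prop))
    exact measurable_cothKernel.comp (f := fun q : (ℝ × ℝ) × ℝ => (q.1.2, q.1.1 - q.2))
      (by fun_prop)
  have hG' : Measurable fun q : (ℝ × ℝ) × ℝ => ENNReal.ofReal (q.1.2 ^ (s - 1)) *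
      ENNReal.ofReal (f q.1.1 * cothKernel q.1.2 (q.1.1 - q.2) * f q.2) :=
    (hmr.comp (by fun_prop)).mul hG
  have h1 : ∀ x, ∫⁻ y, ENNReal.ofReal (f x * whithamDensity s (x - y) * f y) =
      ENNReal.ofReal (Real.Gamma s)⁻¹ * ∫⁻ r in Ioi (0 : ℝ), ENNReal.ofReal (r ^ (s - 1)) *
        ∫⁻ y, ENNReal.ofReal (f x * cothKernel r (x - y) * f y) := by
    intro x
    have hae := (quasiMeasurePreserving_sub_left volume x).ae (ofReal_whithamDensity_ae_eq hs)
    have hmx : Measurable fun q : ℝ × ℝ => ENNReal.ofReal (q.1 ^ (s - 1)) *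
        ENNReal.ofReal (f x * cothKernel q.1 (x - q.2) * f q.2) :=
      hG'.comp (f := fun q : ℝ × ℝ => ((x, q.1), q.2)) (by fun_prop)
    have hmx' : Measurable (Function.uncurry fun y r : ℝ => ENNReal.ofReal (r ^ (s - 1)) *
        ENNReal.ofReal (f x * cothKernel r (x - y) * f y)) := hmx.comp measurable_swap
    calc _ = ∫⁻ y, ENNReal.ofReal (Real.Gamma s)⁻¹ * ∫⁻ r in Ioi (0 : ℝ),
          ENNReal.ofReal (r ^ (s - 1)) *
            ENNReal.ofReal (f x * cothKernel r (x - y) * f y) := by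
          refine lintegral_congr_ae ?_
          filter_upwards [hae] with y hy
          rw [mul_right_comm, ENNReal.ofReal_mul (mul_nonneg (hf0 x) (hf0 y)), hy,
            mul_left_comm, ← lintegral_const_mul' _ _ ENNReal.ofReal_ne_top]
          congr 1
          refine setLIntegral_congr_fun measurableSet_Ioi fun r hr => ?_
          have hr : 0 < r := hr
          have h0 := cothKernel_nonneg hr (x - y)
          rw [← ENNReal.ofReal_mul (mul_nonneg (hf0 x) (hf0 y)),
            ← ENNReal.ofReal_mul (by positivity)]
          congr 1; ring
      _ = _ := by
          rw [lintegral_const_mul' _ _ ENNReal.ofReal_ne_top,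
            lintegral_lintegral_swap hmx'.aemeasurable]
          congr 1
          refine lintegral_congr fun r => ?_
          rw [lintegral_const_mul' _ _ ENNReal.ofReal_ne_top]
  have hI : Measurable fun q : ℝ × ℝ => ENNReal.ofReal (q.2 ^ (s - 1)) *
      ∫⁻ y, ENNReal.ofReal (f q.1 * cothKernel q.2 (q.1 - y) * f y) :=
    (hmr.comp measurable_snd).mul hG.lintegral_prod_right'
  rw [lform]
  simp_rw [h1]
  rw [lintegral_const_mul' _ _ ENNReal.ofReal_ne_top, lintegral_lintegral_swap hI.aemeasurable]
  congr 1
  refine lintegral_congr fun r => ?_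
  rw [lintegral_const_mul' _ _ ENNReal.ofReal_ne_top, lform]

/-- Expanding the cosine of a difference diagonalises the form: it is the integral of `e` against
the power spectrum of `f`. -/
theorem integral_form_cosine {e f : ℝ → ℝ} (he : Integrable e) (hf : Integrable f) :
    ∫ p : ℝ × ℝ, f p.1 * (∫ v, e v * Real.cos (2 * Real.pi * (p.1 - p.2) * v)) * f p.2 =
      ∫ v, e v * ((∫ x, f x * Real.cos (2 * Real.pi * v * x)) ^ 2 +
        (∫ x, f x * Real.sin (2 * Real.pi * v * x)) ^ 2) := by
  have hff := hf.mul_prod hf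
  have hprod : Integrable (Function.uncurry fun (p : ℝ × ℝ) (v : ℝ) =>
      f p.1 * f p.2 * (e v * Real.cos (2 * Real.pi * (p.1 - p.2) * v)))
      ((volume.prod volume).prod volume) := by
    have h1 := (hff.mul_prod he).mul_bdd (c := 1)
      (g := fun p : (ℝ × ℝ) × ℝ => Real.cos (2 * Real.pi * (p.1.1 - p.1.2) * p.2))
      (by fun_prop) (ae_of_all _ fun p => by simpa using Real.abs_cos_le_one _)
    refine h1.congr (ae_of_all _ fun p => ?_)
    simp only [Function.uncurry]; ring
  have e1 : ∀ p : ℝ × ℝ, f p.1 * (∫ v, e v * Real.cos (2 * Real.pi * (p.1 - p.2) * v)) * f p.2 =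
      ∫ v, f p.1 * f p.2 * (e v * Real.cos (2 * Real.pi * (p.1 - p.2) * v)) := fun p => by
    rw [integral_const_mul]; ring
  rw [integral_congr_ae (ae_of_all _ e1), Measure.volume_eq_prod, integral_integral_swap hprod]
  refine integral_congr_ae (ae_of_all _ fun v => ?_)
  have hc : Integrable fun x => f x * Real.cos (2 * Real.pi * v * x) := Integrable.mul_cos hf _
  have hs : Integrable fun x => f x * Real.sin (2 * Real.pi * v * x) := by
    refine hf.mul_bdd (c := 1) (by fun_prop) (ae_of_all _ fun ξ => ?_)
    simpa using Real.abs_sin_le_one _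
  have e2 : ∀ p : ℝ × ℝ, f p.1 * f p.2 * (e v * Real.cos (2 * Real.pi * (p.1 - p.2) * v)) =
      e v * ((f p.1 * Real.cos (2 * Real.pi * v * p.1)) * (f p.2 * Real.cos (2 * Real.pi * v * p.2))
        + (f p.1 * Real.sin (2 * Real.pi * v * p.1)) *
          (f p.2 * Real.sin (2 * Real.pi * v * p.2))) := fun p => by
    have : 2 * Real.pi * (p.1 - p.2) * v = 2 * Real.pi * v * p.1 - 2 * Real.pi * v * p.2 := by ring
    rw [this, Real.cos_sub]; ring
  simp only []
  rw [integral_congr_ae (ae_of_all _ e2), integral_const_mul,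
    integral_add (hc.mul_prod hc) (hs.mul_prod hs),
    integral_prod_mul (fun x => f x * Real.cos (2 * Real.pi * v * x))
      (fun x => f x * Real.cos (2 * Real.pi * v * x)),
    integral_prod_mul (fun x => f x * Real.sin (2 * Real.pi * v * x))
      (fun x => f x * Real.sin (2 * Real.pi * v * x))]
  ring

theorem lform_cothKernel {r : ℝ} (hr : 0 < r) {f : ℝ → ℝ} (hf : Integrable f)
    (hfm : Measurable f) (hf0 : ∀ x, 0 ≤ f x) :
    lform (cothKernel r) f = ENNReal.ofReal (∫ v, Real.exp (-(r * cothSymbol (2 * Real.pi * v))) *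
      ((∫ x, f x * Real.cos (2 * Real.pi * v * x)) ^ 2 +
        (∫ x, f x * Real.sin (2 * Real.pi * v * x)) ^ 2)) := by
  have hm : Measurable fun p : ℝ × ℝ => f p.1 * cothKernel r (p.1 - p.2) * f p.2 :=
    ((hfm.comp measurable_fst).mul ((measurable_cothKernel_right r).comp (by fun_prop))).mul
      (hfm.comp measurable_snd)
  have hint : Integrable (fun p : ℝ × ℝ => f p.1 * cothKernel r (p.1 - p.2) * f p.2)
      (volume.prod volume) := by
    refine ((hf.mul_prod hf).const_mul (1 / (Real.pi * r))).mono' hm.aestronglyMeasurable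
      (ae_of_all _ fun p => ?_)
    have h0 := hf0 p.1
    have h1 := hf0 p.2
    have h2 := cothKernel_nonneg hr (p.1 - p.2)
    have h3 := cothKernel_le hr (p.1 - p.2)
    rw [Real.norm_eq_abs, abs_of_nonneg (by positivity)]
    calc _ ≤ f p.1 * (1 / (Real.pi * r)) * f p.2 := by gcongr
      _ = _ := by ring
  rw [← integral_form_cosine (integrable_exp_neg_mul_cothSymbol_two_pi hr) hf,
    Measure.volume_eq_prod, lform]
  have := lintegral_prod (μ := (volume : Measure ℝ)) (ν := (volume : Measure ℝ)) _
    hm.ennreal_ofReal.aemeasurable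
  rw [← this, ← ofReal_integral_eq_lintegral_ofReal hint (ae_of_all _ fun p =>
    mul_nonneg (mul_nonneg (hf0 _) (cothKernel_nonneg hr _)) (hf0 _))]
  rfl

/-- If `Φ` is the power spectrum of `f`, that of `f(·/τ)` is `τ² Φ(τ v)`. The substitution `u = τ v`
leaves the factor `τ` and moves the weight `exp(-r ξ coth ξ)` from frequency `u` to the lower
frequency `u/τ`, where it is larger. -/
theorem lform_cothKernel_dilate {r : ℝ} (hr : 0 < r) {f : ℝ → ℝ} (hf : Integrable f)
    (hfm : Measurable f) (hf0 : ∀ x, 0 ≤ f x) {τ : ℝ} (hτ : 1 ≤ τ) :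
    ENNReal.ofReal τ * lform (cothKernel r) f ≤ lform (cothKernel r) fun x => f (x / τ) := by
  have hτ0 : 0 < τ := one_pos.trans_le hτ
  have hfd : Integrable fun x => f (x / τ) := hf.comp_div hτ0.ne'
  rw [lform_cothKernel hr hf hfm hf0,
    lform_cothKernel hr hfd (hfm.comp (by fun_prop)) (fun x => hf0 _),
    ← ENNReal.ofReal_mul hτ0.le]
  refine ENNReal.ofReal_le_ofReal ?_
  set Φ : ℝ → ℝ := fun v => (∫ x, f x * Real.cos (2 * Real.pi * v * x)) ^ 2 +
        (∫ x, f x * Real.sin (2 * Real.pi * v * x)) ^ 2 with hΦ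
  have hΦ0 : ∀ v, 0 ≤ Φ v := fun v => by positivity
  have hd : ∀ v, (∫ x, f (x / τ) * Real.cos (2 * Real.pi * v * x)) ^ 2 +
        (∫ x, f (x / τ) * Real.sin (2 * Real.pi * v * x)) ^ 2 = τ ^ 2 * Φ (τ * v) := by
    intro v
    have e1 : ∀ x, f (x / τ) * Real.cos (2 * Real.pi * v * x) =
        (fun y => f y * Real.cos (2 * Real.pi * (τ * v) * y)) (x / τ) := fun x => by
      simp only []; congr 2; field_simp
    have e2 : ∀ x, f (x / τ) * Real.sin (2 * Real.pi * v * x) =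
        (fun y => f y * Real.sin (2 * Real.pi * (τ * v) * y)) (x / τ) := fun x => by
      simp only []; congr 2; field_simp
    rw [integral_congr_ae (ae_of_all _ e1), integral_congr_ae (ae_of_all _ e2),
      Measure.integral_comp_div (fun y => f y * Real.cos (2 * Real.pi * (τ * v) * y)),
      Measure.integral_comp_div (fun y => f y * Real.sin (2 * Real.pi * (τ * v) * y)),
      abs_of_pos hτ0, smul_eq_mul, smul_eq_mul, hΦ]
    ring
  simp_rw [hd]
  have hΦm : AEStronglyMeasurable Φ := by
    apply StronglyMeasurable.aestronglyMeasurable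
    have m1 : StronglyMeasurable (Function.uncurry fun v x : ℝ =>
        f x * Real.cos (2 * Real.pi * v * x)) :=
      ((hfm.comp measurable_snd).mul (by fun_prop)).stronglyMeasurable
    have m2 : StronglyMeasurable (Function.uncurry fun v x : ℝ =>
        f x * Real.sin (2 * Real.pi * v * x)) :=
      ((hfm.comp measurable_snd).mul (by fun_prop)).stronglyMeasurable
    exact (m1.integral_prod_right.pow 2).add (m2.integral_prod_right.pow 2)
  have hΦb : ∀ v, ‖Φ v‖ ≤ 2 * (∫ x, f x) ^ 2 := by
    intro v
    have hA : ∀ g : ℝ → ℝ, (∀ x, |g x| ≤ 1) → (∫ x, f x * g x) ^ 2 ≤ (∫ x, f x) ^ 2 := by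
      intro g hg
      rw [sq_le_sq]
      refine (abs_integral_le_integral_abs).trans ((integral_mono_of_nonneg
        (ae_of_all _ fun x => abs_nonneg _) hf (ae_of_all _ fun x => ?_)).trans (le_abs_self _))
      simp only []
      rw [abs_mul, abs_of_nonneg (hf0 x)]
      exact mul_le_of_le_one_right (hf0 x) (hg x)
    rw [Real.norm_eq_abs, abs_of_nonneg (hΦ0 v)]
    have h1 := hA (fun x => Real.cos (2 * Real.pi * v * x)) fun x => Real.abs_cos_le_one _
    have h2 := hA (fun x => Real.sin (2 * Real.pi * v * x)) fun x => Real.abs_sin_le_one _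
    simp only [hΦ]
    linarith
  have hE := integrable_exp_neg_mul_cothSymbol_two_pi hr
  have e3 : ∀ v, Real.exp (-(r * cothSymbol (2 * Real.pi * v))) * (τ ^ 2 * Φ (τ * v)) =
      (fun u => τ ^ 2 * (Real.exp (-(r * cothSymbol (2 * Real.pi * (u / τ)))) * Φ u)) (τ * v) :=
    fun v => by
      simp only []
      rw [mul_div_cancel_left₀ _ hτ0.ne']
      ring
  rw [integral_congr_ae (ae_of_all _ e3), Measure.integral_comp_mul_left
    (fun u => τ ^ 2 * (Real.exp (-(r * cothSymbol (2 * Real.pi * (u / τ)))) * Φ u)),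
    integral_const_mul, smul_eq_mul, abs_of_pos (inv_pos.2 hτ0)]
  have e4 : ∀ z : ℝ, τ⁻¹ * (τ ^ 2 * z) = τ * z := fun z => by field_simp
  rw [e4]
  refine mul_le_mul_of_nonneg_left ?_ hτ0.le
  refine integral_mono (hE.mul_bdd hΦm (ae_of_all _ hΦb))
    ((hE.comp_div hτ0.ne').mul_bdd hΦm (ae_of_all _ hΦb)) fun v => ?_
  refine mul_le_mul_of_nonneg_right (Real.exp_le_exp.2 (neg_le_neg
    (mul_le_mul_of_nonneg_left (cothSymbol_mono ?_) hr.le))) (hΦ0 v)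
  rw [abs_mul, abs_mul (2 * Real.pi) v, abs_div, abs_of_pos hτ0]
  exact mul_le_mul_of_nonneg_left (div_le_self (abs_nonneg _) hτ) (abs_nonneg _)

theorem lform_whithamDensity_dilate {s : ℝ} (hs : 0 < s) {f : ℝ → ℝ} (hf : Integrable f)
    (hfm : Measurable f) (hf0 : ∀ x, 0 ≤ f x) {τ : ℝ} (hτ : 1 ≤ τ) :
    ENNReal.ofReal τ * lform (whithamDensity s) f ≤
      lform (whithamDensity s) fun x => f (x / τ) := by
  rw [lform_whithamDensity hs hfm hf0,
    lform_whithamDensity hs (f := fun x => f (x / τ)) (hfm.comp (by fun_prop)) (fun x => hf0 _),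
    mul_left_comm, ← lintegral_const_mul' _ _ ENNReal.ofReal_ne_top]
  refine mul_le_mul_right (setLIntegral_mono' measurableSet_Ioi fun r hr => ?_) _
  rw [mul_left_comm]
  refine mul_le_mul_right ?_ _
  exact lform_cothKernel_dilate hr hf hfm hf0 hτ

/-! ### The bilinear form of `K_{1/2}` on `L²` -/

/-- The bilinear form `∬ f(x) K(x - y) g(y)` with `K = K_{1/2}`. -/
noncomputable def bform (f g : ℝ → ℝ) : ℝ :=
  ∫ p : ℝ × ℝ, f p.1 * whithamDensity (1 / 2) (p.1 - p.2) * g p.2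

theorem half_pos' : (0 : ℝ) < 1 / 2 := by norm_num

section Bform

variable {f g h : ℝ → ℝ}

theorem integrable_kernel_mul_right (hg : Integrable g) :
    Integrable (fun p : ℝ × ℝ => g p.2 * whithamDensity (1 / 2) (p.1 - p.2))
      (volume.prod volume) :=
  hg.convolution_integrand (ContinuousLinearMap.mul ℝ ℝ) (integrable_whithamDensity half_pos')

theorem integrable_kernel_mul_left (hg : Integrable g) :
    Integrable (fun p : ℝ × ℝ => g p.1 * whithamDensity (1 / 2) (p.1 - p.2))
      (volume.prod volume) := by
  refine (integrable_kernel_mul_right hg).swap.congr (ae_of_all _ fun p => ?_)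
  simp only [Function.comp_apply, Prod.fst_swap, Prod.snd_swap]
  rw [← whithamDensity_neg, neg_sub]

theorem integral_kernel_mul_right (hg : Integrable g) :
    ∫ p : ℝ × ℝ, g p.2 * whithamDensity (1 / 2) (p.1 - p.2) = ∫ x, g x := by
  rw [Measure.volume_eq_prod, integral_prod_symm _ (integrable_kernel_mul_right hg)]
  simp_rw [integral_const_mul]
  simp_rw [fun y : ℝ => integral_sub_right_eq_self (μ := volume) (whithamDensity (1 / 2)) y,
    integral_whithamDensity half_pos', mul_one]

theorem integral_kernel_mul_left (hg : Integrable g) :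
    ∫ p : ℝ × ℝ, g p.1 * whithamDensity (1 / 2) (p.1 - p.2) = ∫ x, g x := by
  rw [Measure.volume_eq_prod, integral_prod _ (integrable_kernel_mul_left hg)]
  simp_rw [integral_const_mul]
  simp_rw [fun y : ℝ => integral_sub_left_eq_self (whithamDensity (1 / 2)) volume y,
    integral_whithamDensity half_pos', mul_one]

theorem aestronglyMeasurable_bform (hf : AEStronglyMeasurable f) (hg : AEStronglyMeasurable g) :
    AEStronglyMeasurable (fun p : ℝ × ℝ => f p.1 * whithamDensity (1 / 2) (p.1 - p.2) * g p.2)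
      (volume.prod volume) :=
  (hf.comp_fst.mul ((measurable_whithamDensity _).comp (by fun_prop)).aestronglyMeasurable).mul
    hg.comp_snd

theorem abs_bform_integrand_le (p : ℝ × ℝ) :
    ‖f p.1 * whithamDensity (1 / 2) (p.1 - p.2) * g p.2‖ ≤
      (1 / 2) * (f p.1 ^ 2 * whithamDensity (1 / 2) (p.1 - p.2) +
        g p.2 ^ 2 * whithamDensity (1 / 2) (p.1 - p.2)) := by
  have h0 := whithamDensity_nonneg half_pos' (p.1 - p.2)
  rw [norm_mul, norm_mul, Real.norm_of_nonneg h0, Real.norm_eq_abs, Real.norm_eq_abs,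
    ← sq_abs (f p.1), ← sq_abs (g p.2)]
  nlinarith [mul_nonneg h0 (sq_nonneg (|f p.1| - |g p.2|))]

theorem integrable_bform (hf : MemLp f 2) (hg : MemLp g 2) :
    Integrable (fun p : ℝ × ℝ => f p.1 * whithamDensity (1 / 2) (p.1 - p.2) * g p.2)
      (volume.prod volume) :=
  (((integrable_kernel_mul_left hf.integrable_sq).add
    (integrable_kernel_mul_right hg.integrable_sq)).const_mul (1 / 2)).mono'
    (aestronglyMeasurable_bform hf.1 hg.1) (ae_of_all _ abs_bform_integrand_le)

/-- Pointwise `2|f(x) g(y)| ≤ f(x)² + g(y)²`. Because `K` has mass one, integrating one variable out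
of each term leaves a squared `L²` norm. The sharp constant one in `B(f,f) ≤ ‖f‖₂²` is essential for
the comparison with `1/α`. -/
theorem abs_bform_le (hf : MemLp f 2) (hg : MemLp g 2) :
    |bform f g| ≤ (1 / 2) * ((∫ x, f x ^ 2) + ∫ x, g x ^ 2) := by
  have h1 := integrable_kernel_mul_left hf.integrable_sq
  have h2 := integrable_kernel_mul_right hg.integrable_sq
  rw [← integral_kernel_mul_left hf.integrable_sq, ← integral_kernel_mul_right hg.integrable_sq,
    Measure.volume_eq_prod, ← integral_add h1 h2, ← integral_const_mul]
  exact norm_integral_le_of_norm_le ((h1.add h2).const_mul _) (ae_of_all _ abs_bform_integrand_le)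

theorem bform_self_le (hf : MemLp f 2) : bform f f ≤ ∫ x, f x ^ 2 := by
  have := (le_abs_self _).trans (abs_bform_le hf hf)
  linarith

theorem bform_comm (f g : ℝ → ℝ) : bform f g = bform g f := by
  rw [bform, bform, Measure.volume_eq_prod, ← integral_prod_swap]
  congr 1
  ext p
  simp only [Prod.fst_swap, Prod.snd_swap]
  rw [← whithamDensity_neg, neg_sub]
  ring

theorem bform_add_right (hf : MemLp f 2) (hg : MemLp g 2) (hh : MemLp h 2) :
    bform f (g + h) = bform f g + bform f h := by
  rw [bform, bform, bform, Measure.volume_eq_prod,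
    ← integral_add (integrable_bform hf hg) (integrable_bform hf hh)]
  congr 1
  ext p
  simp only [Pi.add_apply]; ring

theorem bform_add_left (hf : MemLp f 2) (hg : MemLp g 2) (hh : MemLp h 2) :
    bform (f + g) h = bform f h + bform g h := by
  rw [bform_comm, bform_add_right hh hf hg, bform_comm h f, bform_comm h g]

theorem bform_smul_right (c : ℝ) (f g : ℝ → ℝ) : bform f (c • g) = c * bform f g := by
  rw [bform, bform, ← integral_const_mul]
  congr 1
  ext p
  simp only [Pi.smul_apply, smul_eq_mul]; ring

theorem bform_smul_left (c : ℝ) (f g : ℝ → ℝ) : bform (c • f) g = c * bform f g := by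
  rw [bform_comm, bform_smul_right, bform_comm]

theorem bform_congr {f' g' : ℝ → ℝ} (hf : f =ᵐ[volume] f') (hg : g =ᵐ[volume] g') :
    bform f g = bform f' g' := by
  refine integral_congr_ae ?_
  rw [Measure.volume_eq_prod]
  filter_upwards [Measure.quasiMeasurePreserving_fst.ae_eq_comp hf,
    Measure.quasiMeasurePreserving_snd.ae_eq_comp hg] with p h1 h2
  simp only [Function.comp_apply] at h1 h2
  rw [h1, h2]

theorem bform_eq_integral (hf : MemLp f 2) (hg : MemLp g 2) :
    bform f g = ∫ x, f x * whithamConv (1 / 2) g x := by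
  rw [bform, Measure.volume_eq_prod, integral_prod _ (integrable_bform hf hg)]
  simp_rw [whithamConv_eq half_pos', ← integral_const_mul, mul_assoc]

theorem integrable_mul_whithamConv (hf : MemLp f 2) (hg : MemLp g 2) :
    Integrable fun x => f x * whithamConv (1 / 2) g x := by
  have := (integrable_bform hf hg).integral_prod_left
  simp_rw [whithamConv_eq half_pos', ← integral_const_mul, ← mul_assoc]
  exact this

theorem ofReal_bform (hf : MemLp f 2) (hf0 : ∀ x, 0 ≤ f x) :
    ENNReal.ofReal (bform f f) = lform (whithamDensity (1 / 2)) f := by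
  rw [bform, Measure.volume_eq_prod, ofReal_integral_eq_lintegral_ofReal (integrable_bform hf hf)
    (ae_of_all _ fun p => mul_nonneg (mul_nonneg (hf0 _) (whithamDensity_nonneg half_pos' _))
      (hf0 _)), lform, lintegral_prod _ (aestronglyMeasurable_bform hf.1 hf.1).aemeasurable.ennreal_ofReal]

end Bform

/-! ### The energy as a quadratic form -/

theorem whithamDensity_quarter_inner :
    ∀ᵐ p : ℝ × ℝ ∂(volume.prod volume),
      Integrable (fun x => whithamDensity (1 / 4) (x - p.1) * whithamDensity (1 / 4) (x - p.2)) ∧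
      ∫ x, whithamDensity (1 / 4) (x - p.1) * whithamDensity (1 / 4) (x - p.2) =
        whithamDensity (1 / 2) (p.1 - p.2) := by
  have h4 : (0 : ℝ) < 1 / 4 := by norm_num
  have hki := integrable_whithamDensity h4
  have h1 : ∀ᵐ u, Integrable (fun t => whithamDensity (1 / 4) t * whithamDensity (1 / 4) (u - t)) :=
    hki.ae_convolution_exists (ContinuousLinearMap.mul ℝ ℝ) hki
  have hq : Measure.QuasiMeasurePreserving (fun p : ℝ × ℝ => p.1 - p.2)
      (volume.prod volume) volume := quasiMeasurePreserving_sub _ _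
  filter_upwards [hq.ae h1, hq.ae whithamDensity_semigroup] with p hp1 hp2
  have e : ∀ x, whithamDensity (1 / 4) (x - p.1) * whithamDensity (1 / 4) (x - p.2) =
      (fun t => whithamDensity (1 / 4) t * whithamDensity (1 / 4) (p.1 - p.2 - t)) (x - p.2) :=
    fun x => by
      simp only []
      rw [mul_comm, ← whithamDensity_neg _ (x - p.1)]
      congr 2; ring
  simp_rw [e]
  refine ⟨hp1.comp_sub_right p.2, ?_⟩
  rw [hp2, integral_sub_right_eq_self
    (fun t => whithamDensity (1 / 4) t * whithamDensity (1 / 4) (p.1 - p.2 - t))]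

/-- The square of `K_{1/4} ∗ f` is a double integral. Integrating in `x` first collapses the two
quarter kernels to `K_{1/2}`, and since these kernels are nonnegative the same collapse with
absolute values justifies Fubini. -/
theorem integrable_sq_and_integral_sq_whithamConv {f : ℝ → ℝ} (hf : MemLp f 2) :
    Integrable (fun x => whithamConv (1 / 4) f x ^ 2) ∧
      ∫ x, whithamConv (1 / 4) f x ^ 2 = bform f f := by
  have h4 : (0 : ℝ) < 1 / 4 := by norm_num
  have hk0 := whithamDensity_nonneg h4
  set G : (ℝ × ℝ) × ℝ → ℝ := fun q => f q.1.1 * f q.1.2 *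
    (whithamDensity (1 / 4) (q.2 - q.1.1) * whithamDensity (1 / 4) (q.2 - q.1.2)) with hG
  have hm : AEStronglyMeasurable G ((volume.prod volume).prod volume) := by
    have m1 : AEStronglyMeasurable (fun q : ℝ × ℝ => f q.1 * f q.2) (volume.prod volume) :=
      hf.1.comp_fst.mul hf.1.comp_snd
    refine m1.comp_fst.mul (Measurable.aestronglyMeasurable ?_)
    exact ((measurable_whithamDensity _).comp (by fun_prop)).mul
      ((measurable_whithamDensity _).comp (by fun_prop))
  have hGi : Integrable G ((volume.prod volume).prod volume) := by
    rw [integrable_prod_iff hm]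
    constructor
    · filter_upwards [whithamDensity_quarter_inner] with p hp
      exact hp.1.const_mul (f p.1 * f p.2)
    · refine (integrable_bform hf hf).norm.congr ?_
      filter_upwards [whithamDensity_quarter_inner] with p hp
      have e : ∀ x, ‖G (p, x)‖ = |f p.1 * f p.2| *
          (whithamDensity (1 / 4) (x - p.1) * whithamDensity (1 / 4) (x - p.2)) := fun x => by
        rw [hG, Real.norm_eq_abs, abs_mul, abs_of_nonneg (mul_nonneg (hk0 _) (hk0 _))]
      simp_rw [e]
      rw [integral_const_mul, hp.2, Real.norm_eq_abs, mul_right_comm, abs_mul (f p.1 * f p.2),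
        abs_of_nonneg (whithamDensity_nonneg half_pos' _)]
  have hinner : ∀ x, ∫ p : ℝ × ℝ, G (p, x) ∂(volume.prod volume) =
      whithamConv (1 / 4) f x ^ 2 := by
    intro x
    have e : ∀ p : ℝ × ℝ, G (p, x) = (fun y => whithamDensity (1 / 4) (x - y) * f y) p.1 *
        (fun y => whithamDensity (1 / 4) (x - y) * f y) p.2 := fun p => by
      simp only [hG]; ring
    rw [integral_congr_ae (ae_of_all _ e), integral_prod_mul
      (fun y => whithamDensity (1 / 4) (x - y) * f y) fun y => whithamDensity (1 / 4) (x - y) * f y,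
      whithamConv_eq h4, sq]
  constructor
  · exact hGi.integral_prod_right.congr (ae_of_all _ hinner)
  · rw [← integral_congr_ae (ae_of_all _ hinner), ← integral_prod_symm _ hGi, integral_prod _ hGi,
      bform, Measure.volume_eq_prod]
    refine integral_congr_ae ?_
    filter_upwards [whithamDensity_quarter_inner] with p hp
    simp only [hG]
    rw [integral_const_mul, hp.2]
    ring

theorem bform_self_nonneg {f : ℝ → ℝ} (hf : MemLp f 2) : 0 ≤ bform f f := by
  rw [← (integrable_sq_and_integral_sq_whithamConv hf).2]
  exact integral_nonneg fun x => sq_nonneg _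

theorem energyJ_sq {f : ℝ → ℝ} (hf : MemLp f 2) :
    energyJ f ^ 2 = ENNReal.ofReal (bform f f) := by
  obtain ⟨h1, h2⟩ := integrable_sq_and_integral_sq_whithamConv hf
  rw [energyJ, eLpNorm_eq_lintegral_rpow_enorm_toReal (by norm_num) (by norm_num), ← h2,
    ofReal_integral_eq_lintegral_ofReal h1 (ae_of_all _ fun x => sq_nonneg _),
    ← ENNReal.rpow_natCast, ← ENNReal.rpow_mul]
  simp only [ENNReal.toReal_ofNat, Nat.cast_ofNat]
  norm_num
  congr 1
  ext x
  rw [Real.enorm_eq_ofReal_abs, ← ENNReal.ofReal_pow (abs_nonneg _), sq_abs]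

theorem energyJ_eq {f : ℝ → ℝ} (hf : MemLp f 2) :
    energyJ f = ENNReal.ofReal (Real.sqrt (bform f f)) := by
  have h := energyJ_sq hf
  rw [← Real.sq_sqrt (bform_self_nonneg hf), ENNReal.ofReal_pow (Real.sqrt_nonneg _)] at h
  exact (ENNReal.pow_right_strictMono two_ne_zero).injective h

theorem integral_whithamConv {s : ℝ} (hs : 0 < s) {f : ℝ → ℝ} (hf : Integrable f) :
    Integrable (whithamConv s f) ∧ ∫ x, whithamConv s f x = ∫ x, f x := by
  have h1 : whithamConv s f =
      convolution (whithamDensity s) f (ContinuousLinearMap.mul ℝ ℝ) volume := by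
    ext x
    rw [whithamConv_eq hs, convolution_mul_swap]
  rw [h1]
  refine ⟨(integrable_whithamDensity hs).integrable_convolution _ hf, ?_⟩
  rw [integral_convolution _ (integrable_whithamDensity hs) hf, integral_whithamDensity hs]
  simp

/-- The form is positive on integrable functions whose integral does not vanish. -/
theorem bform_self_pos {f : ℝ → ℝ} (hf : MemLp f 2) (hf1 : Integrable f)
    (h : ∫ x, f x ≠ 0) : 0 < bform f f := by
  refine (bform_self_nonneg hf).lt_of_ne fun h0 => h ?_
  obtain ⟨h1, h2⟩ := integrable_sq_and_integral_sq_whithamConv hf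
  rw [← h0, integral_eq_zero_iff_of_nonneg (fun x => sq_nonneg _) h1] at h2
  -- Convolution with a kernel of mass one preserves the integral, and zero energy forces `K_{1/4} ∗
  -- f` to vanish almost everywhere.
  rw [← (integral_whithamConv (by norm_num : (0 : ℝ) < 1 / 4) hf1).2]
  refine integral_eq_zero_of_ae ?_
  filter_upwards [h2] with x hx
  exact pow_eq_zero_iff two_ne_zero |>.1 hx

/-! ### Convolution with `K_{1/2}` on `L³` -/

instance holderTriple_threeHalves_three : ENNReal.HolderTriple (3 / 2) 3 1 where
  inv_add_inv_eq_inv := by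
    rw [ENNReal.inv_div (by simp) (by simp), inv_one]
    have h1 : (2 / 3 : ℝ≥0∞) = ENNReal.ofReal (2 / 3) := by
      rw [ENNReal.ofReal_div_of_pos (by norm_num)]; simp
    have h2 : (3⁻¹ : ℝ≥0∞) = ENNReal.ofReal (1 / 3) := by
      rw [ENNReal.ofReal_div_of_pos (by norm_num)]; simp
    rw [h1, h2, ← ENNReal.ofReal_add (by norm_num) (by norm_num)]
    norm_num

theorem abs_integral_mul_le_eLpNorm {k f : ℝ → ℝ} (hk : MemLp k (3 / 2)) (hf : MemLp f 3) :
    |∫ y, k y * f y| ≤ (eLpNorm k (3 / 2) volume).toReal * (eLpNorm f 3 volume).toReal := by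
  have h := eLpNorm_smul_le_mul_eLpNorm (p := 3 / 2) (q := 3) (r := 1) hf.1 hk.1
  rw [← ENNReal.toReal_mul]
  have h2 : ‖∫ y, k y * f y‖ₑ ≤ eLpNorm k (3 / 2) volume * eLpNorm f 3 volume := by
    refine (enorm_integral_le_lintegral_enorm _).trans ?_
    rw [← eLpNorm_one_eq_lintegral_enorm]
    exact h
  have h3 := ENNReal.toReal_mono (ENNReal.mul_ne_top hk.2.ne hf.2.ne) h2
  simpa using h3

theorem measurePreserving_const_sub (x : ℝ) : MeasurePreserving (fun y : ℝ => x - y) volume volume :=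
  Measure.measurePreserving_sub_left volume x

theorem memLp_kernel_sub (x : ℝ) : MemLp (fun y => whithamDensity (1 / 2) (x - y)) (3 / 2) :=
  memLp_whithamDensity_half.comp_measurePreserving (measurePreserving_const_sub x)

theorem integrable_kernel_mul {f : ℝ → ℝ} (hf : MemLp f 3) (x : ℝ) :
    Integrable fun y => whithamDensity (1 / 2) (x - y) * f y :=
  (memLp_kernel_sub x).integrable_mul hf

theorem abs_whithamConv_le {f : ℝ → ℝ} (hf : MemLp f 3) (x : ℝ) :
    |whithamConv (1 / 2) f x| ≤
      (eLpNorm (whithamDensity (1 / 2)) (3 / 2) volume).toReal * (eLpNorm f 3 volume).toReal := by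
  rw [whithamConv_eq half_pos']
  have h := abs_integral_mul_le_eLpNorm (memLp_kernel_sub x) hf
  have e : eLpNorm (fun y => whithamDensity (1 / 2) (x - y)) (3 / 2) volume =
      eLpNorm (whithamDensity (1 / 2)) (3 / 2) volume :=
    eLpNorm_comp_measurePreserving memLp_whithamDensity_half.1 (measurePreserving_const_sub x)
  rwa [e] at h

theorem whithamConv_sub {f g : ℝ → ℝ} (hf : MemLp f 3) (hg : MemLp g 3) (x : ℝ) :
    whithamConv (1 / 2) (f - g) x = whithamConv (1 / 2) f x - whithamConv (1 / 2) g x := by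
  rw [whithamConv_eq half_pos', whithamConv_eq half_pos', whithamConv_eq half_pos',
    ← integral_sub (integrable_kernel_mul hf x) (integrable_kernel_mul hg x)]
  simp [mul_sub]

theorem tendsto_eLpNorm_translate {k : ℝ → ℝ} {p : ℝ≥0∞} (hp1 : 1 ≤ p) (hp : p ≠ ∞)
    (hk : MemLp k p) :
    Tendsto (fun h : ℝ => eLpNorm (fun u => k (u + h) - k u) p volume) (𝓝 0) (𝓝 0) := by
  have : Fact (1 ≤ p) := ⟨hp1⟩
  set g : C(ℝ, C(ℝ, ℝ)) :=
    (ContinuousMap.mk (fun q : ℝ × ℝ => q.2 + q.1) (by fun_prop)).curry with hg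
  have hgm : ∀ h, MeasurePreserving (g h) volume volume := fun h =>
    measurePreserving_add_right volume h
  have h1 : Continuous fun h => Lp.compMeasurePreserving (g h) (hgm h) (hk.toLp k) :=
    continuous_const.compMeasurePreservingLp g.continuous hgm hp
  have h2 := (h1.tendsto 0)
  rw [tendsto_iff_edist_tendsto_0] at h2
  refine h2.congr fun h => ?_
  rw [Lp.edist_def]
  refine eLpNorm_congr_ae ?_
  have e : ∀ h, (Lp.compMeasurePreserving (g h) (hgm h) (hk.toLp k) : ℝ → ℝ) =ᵐ[volume]
      fun u => k (u + h) := fun h => by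
    refine (Lp.coeFn_compMeasurePreserving _ (hgm h)).trans ?_
    exact (hgm h).quasiMeasurePreserving.ae_eq_comp hk.coeFn_toLp
  filter_upwards [e h, e 0] with u h3 h4
  rw [Pi.sub_apply, h3, h4, add_zero]

/-- Hölder reduces the difference to the `L^{3/2}` distance between two translates of `K`, and
translation is continuous in `L^{3/2}`. The modulus does not depend on `f`, which yields
equicontinuity along `L³`-bounded sequences. -/
theorem whithamConv_equicontinuous {ε : ℝ} (hε : 0 < ε) :
    ∃ δ > 0, ∀ x x' : ℝ, |x - x'| < δ → ∀ f : ℝ → ℝ, MemLp f 3 →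
      |whithamConv (1 / 2) f x - whithamConv (1 / 2) f x'| ≤
        ε * (eLpNorm f 3 volume).toReal := by
  have h32 : (1 : ℝ≥0∞) ≤ 3 / 2 := by
    rw [ENNReal.le_div_iff_mul_le (by simp) (by simp)]; norm_num
  have ht := tendsto_eLpNorm_translate h32 (ENNReal.div_ne_top (by simp) (by simp))
    memLp_whithamDensity_half
  have hev := ht.eventually (gt_mem_nhds (ENNReal.ofReal_pos.2 hε))
  obtain ⟨δ, hδ, hball⟩ := Metric.eventually_nhds_iff.1 hev
  refine ⟨δ, hδ, fun x x' hx f hf => ?_⟩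
  have h1 := hball (y := x - x') (by simpa using hx)
  have hm : MemLp (fun y => whithamDensity (1 / 2) (x - y) - whithamDensity (1 / 2) (x' - y))
      (3 / 2) := (memLp_kernel_sub x).sub (memLp_kernel_sub x')
  have e1 : whithamConv (1 / 2) f x - whithamConv (1 / 2) f x' =
      ∫ y, (whithamDensity (1 / 2) (x - y) - whithamDensity (1 / 2) (x' - y)) * f y := by
    rw [whithamConv_eq half_pos', whithamConv_eq half_pos',
      ← integral_sub (integrable_kernel_mul hf x) (integrable_kernel_mul hf x')]
    simp [sub_mul]
  have e2 : eLpNorm (fun y => whithamDensity (1 / 2) (x - y) - whithamDensity (1 / 2) (x' - y))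
      (3 / 2) volume = eLpNorm (fun u => whithamDensity (1 / 2) (u + (x - x')) -
        whithamDensity (1 / 2) u) (3 / 2) volume := by
    have hm' : Measurable fun u => whithamDensity (1 / 2) (u + (x - x')) -
        whithamDensity (1 / 2) u :=
      ((measurable_whithamDensity _).comp (by fun_prop)).sub (measurable_whithamDensity _)
    rw [← eLpNorm_comp_measurePreserving hm'.aestronglyMeasurable (measurePreserving_const_sub x')]
    congr 1
    ext y
    simp only [Function.comp_apply]
    congr 2
    ring
  rw [e1]
  refine (abs_integral_mul_le_eLpNorm hm hf).trans ?_
  rw [e2]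
  gcongr
  exact ENNReal.toReal_le_of_le_ofReal hε.le h1.le

theorem continuous_whithamConv {f : ℝ → ℝ} (hf : MemLp f 3) : Continuous (whithamConv (1 / 2) f) := by
  rw [Metric.continuous_iff]
  intro x ε hε
  set N := (eLpNorm f 3 volume).toReal with hN
  have hN0 : 0 ≤ N := ENNReal.toReal_nonneg
  obtain ⟨δ, hδ, h⟩ := whithamConv_equicontinuous (ε := ε / (N + 1)) (by positivity)
  refine ⟨δ, hδ, fun y hy => ?_⟩
  rw [Real.dist_eq] at hy ⊢
  refine (h y x hy f hf).trans_lt ?_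
  rw [← hN, div_mul_eq_mul_div, div_lt_iff₀ (by positivity)]
  nlinarith

theorem whithamConv_nonneg {f : ℝ → ℝ} (hf : 0 ≤ᵐ[volume] f) (x : ℝ) :
    0 ≤ whithamConv (1 / 2) f x := by
  rw [whithamConv_eq half_pos']
  refine integral_nonneg_of_ae ?_
  filter_upwards [hf] with y hy
  exact mul_nonneg (whithamDensity_nonneg half_pos' _) hy

/-! ### The Young function -/

theorem hasDerivAt_max_cube (x : ℝ) : HasDerivAt (fun y : ℝ => max y 0 ^ 3) (3 * max x 0 ^ 2) x := by
  rcases lt_trichotomy x 0 with h | h | h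
  · have : (fun y : ℝ => max y 0 ^ 3) =ᶠ[𝓝 x] fun _ => 0 := by
      filter_upwards [gt_mem_nhds h] with y hy
      rw [max_eq_right hy.le]; norm_num
    rw [max_eq_right h.le]
    simpa using (hasDerivAt_const x (0 : ℝ)).congr_of_eventuallyEq this
  · subst h
    rw [hasDerivAt_iff_isLittleO_nhds_zero]
    simp only [zero_add, max_self]
    have h1 : (fun h : ℝ => h ^ 2) =o[𝓝 0] fun h => h := by
      simpa using Asymptotics.isLittleO_pow_pow (𝕜 := ℝ) one_lt_two
    have h2 : (fun h : ℝ => max h 0 ^ 3 - 0 ^ 3 - h • (3 * (0 : ℝ) ^ 2)) =O[𝓝 0] fun h => h ^ 2 := by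
      refine Asymptotics.IsBigO.of_bound 1 ?_
      filter_upwards [Metric.ball_mem_nhds (0 : ℝ) one_pos] with h hh
      rw [Metric.mem_ball, dist_zero_right, Real.norm_eq_abs] at hh
      have h3 : max h 0 ≤ |h| := max_le (le_abs_self h) (abs_nonneg h)
      have h4 : 0 ≤ max h 0 := le_max_right _ _
      have h5 : max h 0 ^ 3 ≤ |h| ^ 3 := by gcongr
      simp only [Real.norm_eq_abs]
      norm_num
      rw [abs_of_nonneg h4]
      nlinarith [sq_nonneg |h|, sq_abs h]
    exact h2.trans_isLittleO h1
  · have : (fun y : ℝ => max y 0 ^ 3) =ᶠ[𝓝 x] fun y => y ^ 3 := by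
      filter_upwards [lt_mem_nhds h] with y hy
      rw [max_eq_left hy.le]
    rw [max_eq_left h.le]
    simpa using (hasDerivAt_pow 3 x).congr_of_eventuallyEq this

section YoungPsi

variable {α : ℝ}

/-- One formula for both branches: the second differs from the continuation of the first by `4/3
(|x| - α)³`. Cubes of positive parts are differentiable, so the derivative needs no gluing at `α`.
-/
theorem youngPsi_eq (α x : ℝ) :
    youngPsi α x = α * x ^ 2 - |x| ^ 3 / 3 + 4 / 3 * max (|x| - α) 0 ^ 3 := by
  rw [youngPsi]
  split_ifs with h
  · rw [max_eq_right (by linarith), sq_abs]; ring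
  · rw [max_eq_left (by linarith), ← sq_abs x]; ring

theorem youngPsi_eq_sum (hα : 0 < α) (x : ℝ) :
    youngPsi α x = α * x ^ 2 - (max x 0 ^ 3 + max (-x) 0 ^ 3) / 3 +
      4 / 3 * (max (x - α) 0 ^ 3 + max (-x - α) 0 ^ 3) := by
  rw [youngPsi_eq]
  rcases le_total 0 x with h | h
  · rw [abs_of_nonneg h, max_eq_left h, max_eq_right (by linarith : -x ≤ 0),
      max_eq_right (by linarith : -x - α ≤ 0)]
    ring
  · rw [abs_of_nonpos h, max_eq_right h, max_eq_left (by linarith : 0 ≤ -x),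
      max_eq_right (by linarith : x - α ≤ 0)]
    ring

theorem hasDerivAt_youngPsi (hα : 0 < α) (x : ℝ) :
    HasDerivAt (youngPsi α) (2 * α * x - (max x 0 ^ 2 - max (-x) 0 ^ 2) +
      4 * (max (x - α) 0 ^ 2 - max (-x - α) 0 ^ 2)) x := by
  have h1 := hasDerivAt_max_cube x
  have h2 : HasDerivAt (fun y : ℝ => max (-y) 0 ^ 3) (3 * max (-x) 0 ^ 2 * -1) x :=
    (hasDerivAt_max_cube (-x)).comp x (hasDerivAt_neg x)
  have h3 : HasDerivAt (fun y : ℝ => max (y - α) 0 ^ 3) (3 * max (x - α) 0 ^ 2 * 1) x :=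
    HasDerivAt.comp (h₂ := fun y : ℝ => max y 0 ^ 3) (h := fun y => y - α) x
      (hasDerivAt_max_cube (x - α)) ((hasDerivAt_id x).sub_const α)
  have h4 : HasDerivAt (fun y : ℝ => max (-y - α) 0 ^ 3) (3 * max (-x - α) 0 ^ 2 * -1) x :=
    HasDerivAt.comp (h₂ := fun y : ℝ => max y 0 ^ 3) (h := fun y => -y - α) x
      (hasDerivAt_max_cube (-x - α)) ((hasDerivAt_neg x).sub_const α)
  have h := (((hasDerivAt_pow 2 x).const_mul α).sub ((h1.add h2).div_const 3)).add
    ((h3.add h4).const_mul (4 / 3))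
  rw [funext (youngPsi_eq_sum hα)]
  refine h.congr_deriv ?_
  push_cast
  ring

theorem deriv_youngPsi (hα : 0 < α) (x : ℝ) :
    deriv (youngPsi α) x = 2 * α * x - (max x 0 ^ 2 - max (-x) 0 ^ 2) +
      4 * (max (x - α) 0 ^ 2 - max (-x - α) 0 ^ 2) := (hasDerivAt_youngPsi hα x).deriv

theorem deriv_youngPsi_of_nonneg (hα : 0 < α) {x : ℝ} (hx : 0 ≤ x) :
    deriv (youngPsi α) x = 2 * α * x - x ^ 2 + 4 * max (x - α) 0 ^ 2 := by
  rw [deriv_youngPsi hα, max_eq_left hx, max_eq_right (by linarith : -x ≤ 0),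
    max_eq_right (by linarith : -x - α ≤ 0)]
  ring

theorem deriv_youngPsi_neg (hα : 0 < α) (x : ℝ) :
    deriv (youngPsi α) (-x) = -deriv (youngPsi α) x := by
  rw [deriv_youngPsi hα, deriv_youngPsi hα, neg_neg]; ring

theorem deriv_youngPsi_zero (hα : 0 < α) : deriv (youngPsi α) 0 = 0 := by
  rw [deriv_youngPsi_of_nonneg hα le_rfl, max_eq_right (by linarith)]; ring

theorem continuous_youngPsi (hα : 0 < α) : Continuous (youngPsi α) :=
  continuous_iff_continuousAt.2 fun x => (hasDerivAt_youngPsi hα x).continuousAt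

theorem continuous_deriv_youngPsi (hα : 0 < α) : Continuous (deriv (youngPsi α)) := by
  rw [funext (deriv_youngPsi hα)]
  fun_prop

/-- On the positive axis `Ψ''` is `2(α - x)` below `α` and `6(x - α)` above, vanishing only at `α`.
The inequalities are checked by hand because of this degenerate point. -/
theorem strictMono_deriv_youngPsi (hα : 0 < α) : StrictMono (deriv (youngPsi α)) := by
  refine strictMono_of_odd_strictMonoOn_nonneg (deriv_youngPsi_neg hα) ?_
  intro x hx y hy hxy
  have hx : 0 ≤ x := hx
  rw [deriv_youngPsi_of_nonneg hα hx, deriv_youngPsi_of_nonneg hα (hx.trans hxy.le)]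
  rcases le_total y α with h1 | h1
  · rw [max_eq_right (by linarith), max_eq_right (by linarith)]
    nlinarith
  · rw [max_eq_left (by linarith : 0 ≤ y - α)]
    rcases le_total x α with h2 | h2
    · rw [max_eq_right (by linarith)]
      rcases h1.lt_or_eq with h3 | h3
      · nlinarith [sq_nonneg (x - α), mul_pos (sub_pos.2 h3) (sub_pos.2 h3)]
      · nlinarith [mul_pos (sub_pos.2 hxy) (sub_pos.2 hxy)]
    · rw [max_eq_left (by linarith)]
      nlinarith

theorem tendsto_deriv_youngPsi_atTop (hα : 0 < α) : Tendsto (deriv (youngPsi α)) atTop atTop := by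
  have h : Tendsto (fun x : ℝ => x) atTop atTop := tendsto_id
  refine tendsto_atTop_mono' _ ?_ h
  filter_upwards [eventually_ge_atTop (2 * α + 1), eventually_ge_atTop 0] with x hx h0
  rw [deriv_youngPsi_of_nonneg hα h0, max_eq_left (by linarith)]
  nlinarith

theorem surjective_deriv_youngPsi (hα : 0 < α) : Function.Surjective (deriv (youngPsi α)) := by
  refine (continuous_deriv_youngPsi hα).surjective (tendsto_deriv_youngPsi_atTop hα) ?_
  have h := (tendsto_neg_atTop_atBot.comp (tendsto_deriv_youngPsi_atTop hα)).comp
    tendsto_neg_atBot_atTop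
  refine h.congr fun x => ?_
  simp [deriv_youngPsi_neg hα]

/-- The continuous inverse of the strictly increasing function `Ψ'`. -/
theorem exists_continuous_inverse_deriv_youngPsi (hα : 0 < α) :
    ∃ G : ℝ → ℝ, Continuous G ∧ (∀ y, G (deriv (youngPsi α) y) = y) ∧
      ∀ z, deriv (youngPsi α) (G z) = z := by
  set e := (strictMono_deriv_youngPsi hα).orderIsoOfSurjective _ (surjective_deriv_youngPsi hα)
  exact ⟨e.symm, e.symm.continuous, fun y => e.symm_apply_apply y, fun z => e.apply_symm_apply z⟩

/-- With the cubic lower bound below, this makes a bound on `∫ Ψ(f)` control both the `L²` and the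
`L³` norm. -/
theorem mul_sq_le_youngPsi (hα : 0 < α) (x : ℝ) : α / 3 * x ^ 2 ≤ youngPsi α x := by
  rw [youngPsi_eq, ← sq_abs]
  have h0 := abs_nonneg x
  generalize |x| = y at h0 ⊢
  rcases le_total y α with h | h
  · rw [max_eq_right (by linarith)]
    nlinarith [mul_nonneg h0 h0, mul_nonneg (mul_nonneg h0 h0) (sub_nonneg.2 h),
      mul_nonneg (mul_nonneg h0 h0) hα.le]
  · rw [max_eq_left (by linarith)]
    obtain ⟨w, rfl⟩ : ∃ w, y = w + α := ⟨y - α, by ring⟩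
    have hw : 0 ≤ w := by linarith
    rw [add_sub_cancel_right]
    nlinarith [pow_pos hα 3, mul_nonneg hw (sq_nonneg (w - α)), mul_nonneg hw (sq_nonneg (w + α)),
      mul_nonneg hw (sq_nonneg α), pow_nonneg hw 3, mul_nonneg hα.le (sq_nonneg (w - α))]

theorem cube_le_youngPsi (hα : 0 < α) (x : ℝ) : |x| ^ 3 / 8 ≤ youngPsi α x := by
  rw [youngPsi_eq, ← sq_abs]
  have h0 := abs_nonneg x
  generalize |x| = y at h0 ⊢
  rcases le_total y α with h | h
  · rw [max_eq_right (by linarith)]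
    nlinarith [mul_nonneg h0 h0, mul_nonneg (mul_nonneg h0 h0) (sub_nonneg.2 h),
      mul_nonneg (mul_nonneg h0 h0) hα.le, pow_nonneg h0 3]
  · rw [max_eq_left (by linarith)]
    obtain ⟨w, rfl⟩ : ∃ w, y = w + α := ⟨y - α, by ring⟩
    have hw : 0 ≤ w := by linarith
    rw [add_sub_cancel_right]
    nlinarith [pow_pos hα 3, mul_nonneg hw (sq_nonneg (w - α)), mul_nonneg hw (sq_nonneg (w + α)),
      mul_nonneg hw (sq_nonneg α), pow_nonneg hw 3, mul_nonneg hα.le (sq_nonneg (w - α)),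
      mul_nonneg (add_nonneg hw hα.le) (sq_nonneg (w - α))]

theorem max_abs_sub_le (hα : 0 < α) (x : ℝ) : max (|x| - α) 0 ≤ |x| :=
  max_le (by linarith) (abs_nonneg x)

/-- The part of `Ψ` beyond its leading term `α x²` is cubic, hence continuous along the convergent
sequences below. The coefficient `α` fixes the threshold `1/α` that the maximum must exceed. -/
theorem abs_youngPsi_sub_le (hα : 0 < α) (x : ℝ) :
    |youngPsi α x - α * x ^ 2| ≤ 2 * |x| ^ 3 := by
  rw [youngPsi_eq, abs_le]
  have h1 : max (|x| - α) 0 ^ 3 ≤ |x| ^ 3 := pow_le_pow_left₀ (le_max_right _ _) (max_abs_sub_le hα x) 3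
  have h2 : 0 ≤ max (|x| - α) 0 ^ 3 := pow_nonneg (le_max_right _ _) 3
  have h3 : 0 ≤ |x| ^ 3 := by positivity
  constructor <;> linarith

theorem youngPsi_nonneg (hα : 0 < α) (x : ℝ) : 0 ≤ youngPsi α x :=
  le_trans (by positivity) (mul_sq_le_youngPsi hα x)

theorem youngPsi_le (hα : 0 < α) (x : ℝ) : youngPsi α x ≤ α * x ^ 2 + 2 * |x| ^ 3 := by
  have := (abs_le.1 (abs_youngPsi_sub_le hα x)).2
  linarith

theorem youngPsi_zero (hα : 0 < α) : youngPsi α 0 = 0 := by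
  rw [youngPsi, if_pos (by simpa using hα)]; simp

theorem youngPsi_abs (α x : ℝ) : youngPsi α |x| = youngPsi α x := by simp [youngPsi]

theorem deriv_youngPsi_nonneg (hα : 0 < α) {x : ℝ} (hx : 0 ≤ x) : 0 ≤ deriv (youngPsi α) x := by
  have := (strictMono_deriv_youngPsi hα).monotone hx
  rwa [deriv_youngPsi_zero hα] at this

theorem abs_deriv_youngPsi (hα : 0 < α) (x : ℝ) :
    |deriv (youngPsi α) x| = deriv (youngPsi α) |x| := by
  rcases le_total 0 x with h | h
  · rw [abs_of_nonneg h, abs_of_nonneg (deriv_youngPsi_nonneg hα h)]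
  · rw [abs_of_nonpos h, deriv_youngPsi_neg hα, abs_of_nonpos]
    have := deriv_youngPsi_nonneg hα (neg_nonneg.2 h)
    rw [deriv_youngPsi_neg hα] at this
    linarith

theorem abs_deriv_youngPsi_le (hα : 0 < α) (x : ℝ) :
    |deriv (youngPsi α) x| ≤ 2 * α * |x| + 4 * |x| ^ 2 := by
  rw [abs_deriv_youngPsi hα, deriv_youngPsi_of_nonneg hα (abs_nonneg x)]
  have h1 : max (|x| - α) 0 ^ 2 ≤ |x| ^ 2 := pow_le_pow_left₀ (le_max_right _ _) (max_abs_sub_le hα x) 2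
  nlinarith [sq_nonneg |x|]

theorem mul_deriv_youngPsi_eq_abs (hα : 0 < α) (x : ℝ) :
    x * deriv (youngPsi α) x = |x| * deriv (youngPsi α) |x| := by
  rcases le_total 0 x with h | h
  · rw [abs_of_nonneg h]
  · rw [abs_of_nonpos h, deriv_youngPsi_neg hα]; ring

theorem abs_mul_deriv_youngPsi_sub_le (hα : 0 < α) (x : ℝ) :
    |x * deriv (youngPsi α) x - 2 * α * x ^ 2| ≤ 4 * |x| ^ 3 := by
  rw [mul_deriv_youngPsi_eq_abs hα, deriv_youngPsi_of_nonneg hα (abs_nonneg x), ← sq_abs x, abs_le]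
  have h0 := abs_nonneg x
  have h1 : max (|x| - α) 0 ^ 2 ≤ |x| ^ 2 := pow_le_pow_left₀ (le_max_right _ _) (max_abs_sub_le hα x) 2
  have h2 : 0 ≤ max (|x| - α) 0 ^ 2 := sq_nonneg _
  have h3 : 0 ≤ |x| ^ 3 := by positivity
  have h4 := mul_le_mul_of_nonneg_left h1 h0
  have h5 := mul_nonneg h0 h2
  constructor <;> nlinarith

theorem mul_deriv_youngPsi_nonneg (hα : 0 < α) (x : ℝ) : 0 ≤ x * deriv (youngPsi α) x := by
  rw [mul_deriv_youngPsi_eq_abs hα]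
  exact mul_nonneg (abs_nonneg x) (deriv_youngPsi_nonneg hα (abs_nonneg x))

theorem mul_deriv_youngPsi_pos (hα : 0 < α) {x : ℝ} (hx : x ≠ 0) :
    0 < x * deriv (youngPsi α) x := by
  rw [mul_deriv_youngPsi_eq_abs hα]
  have h := strictMono_deriv_youngPsi hα (abs_pos.2 hx)
  rw [deriv_youngPsi_zero hα] at h
  exact mul_pos (abs_pos.2 hx) h

theorem mul_deriv_youngPsi_le (hα : 0 < α) (x : ℝ) :
    x * deriv (youngPsi α) x ≤ 38 * youngPsi α x := by
  have h1 := (abs_le.1 (abs_mul_deriv_youngPsi_sub_le hα x)).2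
  have h2 := mul_sq_le_youngPsi hα x
  have h3 := cube_le_youngPsi hα x
  linarith

/-- For small values `Ψ'` is almost linear with slope `2α`; this turns the Euler–Lagrange equation
into a linear inequality in the tails. -/
theorem mul_le_deriv_youngPsi (hα : 0 < α) {x δ : ℝ} (hx : 0 ≤ x) (hxδ : x ≤ δ) :
    (2 * α - δ) * x ≤ deriv (youngPsi α) x := by
  rw [deriv_youngPsi_of_nonneg hα hx]
  nlinarith [sq_nonneg (max (x - α) 0)]

theorem convexOn_youngPsi (hα : 0 < α) : ConvexOn ℝ univ (youngPsi α) :=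
  (strictMono_deriv_youngPsi hα).monotone.convexOn_univ_of_deriv
    fun x => (hasDerivAt_youngPsi hα x).differentiableAt

theorem youngPsi_mono (hα : 0 < α) {x y : ℝ} (h : |x| ≤ |y|) : youngPsi α x ≤ youngPsi α y := by
  rw [← youngPsi_abs α x, ← youngPsi_abs α y]
  have hm : MonotoneOn (youngPsi α) (Ici 0) := by
    refine monotoneOn_of_deriv_nonneg (convex_Ici 0) (continuous_youngPsi hα).continuousOn
      (fun x _ => (hasDerivAt_youngPsi hα x).differentiableAt.differentiableWithinAt) fun x hx => ?_
    rw [interior_Ici] at hx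
    exact deriv_youngPsi_nonneg hα (le_of_lt hx)
  exact hm (abs_nonneg x) (abs_nonneg y) h

theorem mul_youngPsi_le (hα : 0 < α) {c : ℝ} (hc : 1 ≤ c) (x : ℝ) :
    c * youngPsi α x ≤ youngPsi α (c * x) := by
  have hc0 : 0 < c := one_pos.trans_le hc
  have h := (convexOn_youngPsi hα).2 (mem_univ (c * x)) (mem_univ 0) (inv_nonneg.2 hc0.le) (sub_nonneg.2 (inv_le_one_of_one_le₀ hc))
    (by ring : c⁻¹ + (1 - c⁻¹) = 1)
  simp only [smul_eq_mul, mul_zero, add_zero, youngPsi_zero hα] at h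
  rw [inv_mul_cancel_left₀ hc0.ne'] at h
  calc c * youngPsi α x ≤ c * (c⁻¹ * youngPsi α (c * x)) := by gcongr
    _ = _ := mul_inv_cancel_left₀ hc0.ne' _

end YoungPsi

/-! ### The Orlicz constraint as an integral constraint -/

section Orlicz

variable {α : ℝ} {f v : ℝ → ℝ}

theorem MemLp.integrable_abs_cube (hf : MemLp f 3) : Integrable fun x => |f x| ^ 3 :=
  hf.integrable_norm_pow (p := 3) (by norm_num)

theorem memLp_three_of_integrable_abs_cube (hf : AEStronglyMeasurable f)
    (h : Integrable fun x => |f x| ^ 3) : MemLp f 3 := by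
  rw [← integrable_norm_rpow_iff hf (by norm_num) (by norm_num)]
  refine h.congr (ae_of_all _ fun x => ?_)
  simp only [ENNReal.toReal_ofNat, Real.norm_eq_abs]
  exact_mod_cast rfl

theorem integrable_youngPsi (hα : 0 < α) (h2 : MemLp f 2) (h3 : MemLp f 3) :
    Integrable fun x => youngPsi α (f x) := by
  refine ((h2.integrable_sq.const_mul α).add
    ((MemLp.integrable_abs_cube h3).const_mul 2)).mono'
    ((continuous_youngPsi hα).comp_aestronglyMeasurable h2.1) (ae_of_all _ fun x => ?_)
  rw [Real.norm_of_nonneg (youngPsi_nonneg hα _)]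
  exact youngPsi_le hα _

theorem memLp_of_lintegral_youngPsi (hα : 0 < α) (hf : AEStronglyMeasurable f)
    (h : ∫⁻ x, ENNReal.ofReal (youngPsi α (f x)) < ∞) : MemLp f 2 ∧ MemLp f 3 := by
  have hi : Integrable fun x => youngPsi α (f x) :=
    ⟨(continuous_youngPsi hα).comp_aestronglyMeasurable hf, by
      rwa [hasFiniteIntegral_iff_ofReal (ae_of_all _ fun x => youngPsi_nonneg hα _)]⟩
  constructor
  · rw [memLp_two_iff_integrable_sq hf]
    refine (hi.const_mul (3 / α)).mono' (hf.pow 2) (ae_of_all _ fun x => ?_)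
    rw [Real.norm_of_nonneg (sq_nonneg _)]
    have := mul_sq_le_youngPsi hα (f x)
    calc f x ^ 2 = 3 / α * (α / 3 * f x ^ 2) := by field_simp
      _ ≤ _ := by gcongr
  · refine memLp_three_of_integrable_abs_cube hf ?_
    refine (hi.const_mul 8).mono' (hf.norm.pow 3) (ae_of_all _ fun x => ?_)
    rw [Real.norm_of_nonneg (by positivity)]
    have := cube_le_youngPsi hα (f x)
    linarith

theorem memOrlicz_youngPsi_iff (hα : 0 < α) :
    MemOrlicz (youngPsi α) f ↔ MemLp f 2 ∧ MemLp f 3 := by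
  constructor
  · rintro ⟨hf, a, ha, h⟩
    have h1 := memLp_of_lintegral_youngPsi hα (hf.const_mul a) h
    have e : f = fun x => a⁻¹ * (a * f x) := by
      ext x; field_simp
    rw [e]
    exact ⟨h1.1.const_mul _, h1.2.const_mul _⟩
  · rintro ⟨h2, h3⟩
    refine ⟨h2.1, 1, one_pos, ?_⟩
    simp_rw [one_mul]
    exact (integrable_youngPsi hα h2 h3).lintegral_lt_top

theorem lintegral_youngPsi (hα : 0 < α) (h2 : MemLp f 2) (h3 : MemLp f 3) :
    ∫⁻ x, ENNReal.ofReal (youngPsi α (f x)) = ENNReal.ofReal (∫ x, youngPsi α (f x)) :=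
  (ofReal_integral_eq_lintegral_ofReal (integrable_youngPsi hα h2 h3)
    (ae_of_all _ fun _ => youngPsi_nonneg hα _)).symm

theorem abs_deriv_youngPsi_mul_le (hα : 0 < α) (t a b : ℝ) (ht : |t| ≤ 1) :
    |deriv (youngPsi α) (a + t * b) * b| ≤ 2 * α * (|a| + |b|) ^ 2 + 4 * (|a| + |b|) ^ 3 := by
  have h1 : |a + t * b| ≤ |a| + |b| := by
    refine (abs_add_le _ _).trans ?_
    rw [abs_mul]
    nlinarith [abs_nonneg b]
  have hb : |b| ≤ |a| + |b| := by linarith [abs_nonneg a]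
  have hw : 0 ≤ |a| + |b| := by positivity
  rw [abs_mul]
  calc _ ≤ (2 * α * |a + t * b| + 4 * |a + t * b| ^ 2) * |b| := by
        gcongr; exact abs_deriv_youngPsi_le hα _
    _ ≤ (2 * α * (|a| + |b|) + 4 * (|a| + |b|) ^ 2) * (|a| + |b|) := by gcongr
    _ = _ := by ring

theorem integrable_deriv_youngPsi_bound (f2 : MemLp f 2) (f3 : MemLp f 3) (v2 : MemLp v 2)
    (v3 : MemLp v 3) :
    Integrable fun x => 2 * α * (|f x| + |v x|) ^ 2 + 4 * (|f x| + |v x|) ^ 3 := by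
  have w2 : MemLp (fun x => |f x| + |v x|) 2 := f2.abs.add v2.abs
  have w3 : MemLp (fun x => |f x| + |v x|) 3 := f3.abs.add v3.abs
  refine (w2.integrable_sq.const_mul _).add (Integrable.const_mul ?_ _)
  refine (MemLp.integrable_abs_cube w3).congr (ae_of_all _ fun x => ?_)
  simp only []
  rw [abs_of_nonneg (by positivity)]

theorem integrable_deriv_youngPsi_mul (hα : 0 < α) (f2 : MemLp f 2) (f3 : MemLp f 3)
    (v2 : MemLp v 2) (v3 : MemLp v 3) : Integrable fun x => deriv (youngPsi α) (f x) * v x := by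
  refine (integrable_deriv_youngPsi_bound (α := α) f2 f3 v2 v3).mono'
    (((continuous_deriv_youngPsi hα).comp_aestronglyMeasurable f2.1).mul v2.1)
    (ae_of_all _ fun x => ?_)
  have := abs_deriv_youngPsi_mul_le hα 0 (f x) (v x) (by simp)
  simpa using this

theorem hasDerivAt_integral_youngPsi (hα : 0 < α) (f2 : MemLp f 2) (f3 : MemLp f 3)
    (v2 : MemLp v 2) (v3 : MemLp v 3) :
    HasDerivAt (fun t : ℝ => ∫ x, youngPsi α (f x + t * v x))
      (∫ x, deriv (youngPsi α) (f x) * v x) 0 := by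
  have hm : ∀ t : ℝ, AEStronglyMeasurable (fun x => f x + t * v x) :=
    fun t => f2.1.add (v2.1.const_mul t)
  have h := hasDerivAt_integral_of_dominated_loc_of_deriv_le (μ := (volume : Measure ℝ)) (𝕜 := ℝ)
    (F := fun t x => youngPsi α (f x + t * v x))
    (F' := fun t x => deriv (youngPsi α) (f x + t * v x) * v x) (x₀ := 0)
    (bound := fun x => 2 * α * (|f x| + |v x|) ^ 2 + 4 * (|f x| + |v x|) ^ 3)
    (Metric.ball_mem_nhds (0 : ℝ) one_pos)
    (Eventually.of_forall fun t => (continuous_youngPsi hα).comp_aestronglyMeasurable (hm t))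
    (by simpa using integrable_youngPsi hα f2 f3)
    (((continuous_deriv_youngPsi hα).comp_aestronglyMeasurable (hm 0)).mul v2.1)
    (ae_of_all _ fun x t ht => abs_deriv_youngPsi_mul_le hα t _ _ (by
      rw [Metric.mem_ball, dist_zero_right, Real.norm_eq_abs] at ht; exact ht.le))
    (integrable_deriv_youngPsi_bound f2 f3 v2 v3)
    (ae_of_all _ fun x t _ => by
      have h1 : HasDerivAt (fun t : ℝ => f x + t * v x) (v x) t := by
        simpa using ((hasDerivAt_id t).mul_const (v x)).const_add (f x)
      have h2 := ((hasDerivAt_youngPsi hα (f x + t * v x)).differentiableAt.hasDerivAt)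
      exact h2.comp t h1)
  simpa using h.2

theorem continuous_integral_youngPsi_mul (hα : 0 < α) (f2 : MemLp f 2) (f3 : MemLp f 3) :
    Continuous fun c : ℝ => ∫ x, youngPsi α (c * f x) := by
  rw [continuous_iff_continuousAt]
  intro c
  have h := (hasDerivAt_integral_youngPsi hα (f2.const_mul c) (f3.const_mul c) f2 f3).continuousAt
  have h1 : ContinuousAt (fun c' : ℝ => c' - c) c := by fun_prop
  have h2 : ContinuousAt (fun t : ℝ => ∫ x, youngPsi α (c * f x + t * f x)) ((fun c' => c' - c) c) := by
    simpa using h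
  refine (ContinuousAt.comp (f := fun c' : ℝ => c' - c) h2 h1).congr
    (Eventually.of_forall fun c' => ?_)
  simp only [Function.comp_apply]
  congr 1
  ext x
  congr 1
  ring

theorem integral_youngPsi_mono (hα : 0 < α) (f2 : MemLp f 2) (f3 : MemLp f 3) {g : ℝ → ℝ}
    (h : ∀ᵐ x, |g x| ≤ |f x|) :
    ∫ x, youngPsi α (g x) ≤ ∫ x, youngPsi α (f x) := by
  refine integral_mono_of_nonneg (ae_of_all _ fun x => youngPsi_nonneg hα _)
    (integrable_youngPsi hα f2 f3) ?_
  filter_upwards [h] with x hx using youngPsi_mono hα hx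

theorem mul_integral_youngPsi_le (hα : 0 < α) (f2 : MemLp f 2) (f3 : MemLp f 3) {c : ℝ}
    (hc : 1 ≤ c) : c * ∫ x, youngPsi α (f x) ≤ ∫ x, youngPsi α (c * f x) := by
  rw [← integral_const_mul]
  exact integral_mono ((integrable_youngPsi hα f2 f3).const_mul c)
    (integrable_youngPsi hα (f2.const_mul c) (f3.const_mul c)) fun x => mul_youngPsi_le hα hc _

/-- The map `c ↦ ∫ Ψ(c f)` is continuous, monotone in `|c|`, and by convexity grows at least
linearly for `c ≥ 1`. So the infimum equals one exactly when the integral does. -/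
theorem gaugeNorm_youngPsi_eq_one_iff (hα : 0 < α) (f2 : MemLp f 2) (f3 : MemLp f 3) :
    gaugeNorm (youngPsi α) f = 1 ↔ ∫ x, youngPsi α (f x) = 1 := by
  have hset : {c : ℝ | 0 < c ∧ ∫⁻ x, ENNReal.ofReal (youngPsi α (f x / c)) ≤ 1} =
      {c : ℝ | 0 < c ∧ ∫ x, youngPsi α (c⁻¹ * f x) ≤ 1} := by
    ext c
    simp only [mem_ofPred_eq, div_eq_inv_mul]
    rw [lintegral_youngPsi hα (f2.const_mul _) (f3.const_mul _), ENNReal.ofReal_le_one]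
  have hcont := continuous_integral_youngPsi_mul hα f2 f3
  have hbdd : BddBelow {c : ℝ | 0 < c ∧ ∫ x, youngPsi α (c⁻¹ * f x) ≤ 1} := ⟨0, fun c hc => hc.1.le⟩
  -- Scaling `f` down sends the integral to `0`, so the infimum is taken over a nonempty set.
  have hne : {c : ℝ | 0 < c ∧ ∫ x, youngPsi α (c⁻¹ * f x) ≤ 1}.Nonempty := by
    have h0 : Tendsto (fun c : ℝ => ∫ x, youngPsi α (c * f x)) (𝓝[>] 0) (𝓝 0) := by
      have := hcont.tendsto 0
      simp only [zero_mul, youngPsi_zero hα, integral_zero] at this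
      exact this.mono_left nhdsWithin_le_nhds
    obtain ⟨c, hc1, hc0⟩ := ((h0.eventually (gt_mem_nhds one_pos)).and
      (eventually_mem_nhdsWithin)).exists
    exact ⟨c⁻¹, inv_pos.2 hc0, by rw [inv_inv]; exact hc1.le⟩
  rw [gaugeNorm, hset]
  constructor
  · intro h
    have hle : ∫ x, youngPsi α (f x) ≤ 1 := by
      have h1 : Tendsto (fun c : ℝ => ∫ x, youngPsi α (c * f x)) (𝓝[<] 1)
          (𝓝 (∫ x, youngPsi α (f x))) := by
        have := hcont.tendsto 1
        simp only [one_mul] at this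
        exact this.mono_left nhdsWithin_le_nhds
      refine le_of_tendsto h1 ?_
      filter_upwards [Ioo_mem_nhdsLT (show (0 : ℝ) < 1 by norm_num)] with c hc
      have hc' : sInf {c : ℝ | 0 < c ∧ ∫ x, youngPsi α (c⁻¹ * f x) ≤ 1} < c⁻¹ := by
        rw [h]; exact (one_lt_inv₀ hc.1).2 hc.2
      obtain ⟨d, ⟨hd0, hd1⟩, hdc⟩ := exists_lt_of_csInf_lt hne hc'
      refine (integral_youngPsi_mono hα (f2.const_mul d⁻¹) (f3.const_mul d⁻¹)
        (ae_of_all _ fun x => ?_)).trans hd1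
      rw [abs_mul, abs_mul, abs_of_pos hc.1, abs_of_pos (inv_pos.2 hd0)]
      gcongr
      rw [le_inv_comm₀ hc.1 hd0]
      exact hdc.le
    refine le_antisymm hle (le_of_not_gt fun hlt => ?_)
    have h1 : Tendsto (fun c : ℝ => ∫ x, youngPsi α (c * f x)) (𝓝[>] 1)
        (𝓝 (∫ x, youngPsi α (f x))) := by
      have := hcont.tendsto 1
      simp only [one_mul] at this
      exact this.mono_left nhdsWithin_le_nhds
    obtain ⟨c, hc1, hc0⟩ := ((h1.eventually (gt_mem_nhds hlt)).and
      (eventually_mem_nhdsWithin)).exists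
    have hc0 : 1 < c := hc0
    have hmem : c⁻¹ ∈ {c : ℝ | 0 < c ∧ ∫ x, youngPsi α (c⁻¹ * f x) ≤ 1} :=
      ⟨inv_pos.2 (one_pos.trans hc0), by rw [inv_inv]; exact hc1.le⟩
    have := csInf_le hbdd hmem
    rw [h] at this
    exact absurd (inv_lt_one_of_one_lt₀ hc0) (not_lt.2 this)
  · intro h
    refine le_antisymm (csInf_le hbdd ⟨one_pos, by simp [h]⟩) (le_csInf hne ?_)
    rintro c ⟨hc0, hc⟩
    by_contra hlt
    push Not at hlt
    have h1 := mul_integral_youngPsi_le hα f2 f3 (one_le_inv_iff₀.2 ⟨hc0, hlt.le⟩)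
    rw [h, mul_one] at h1
    have := (one_lt_inv₀ hc0).2 hlt
    linarith

theorem mem_admissible_iff (hα : 0 < α) :
    f ∈ admissible α ↔ MemLp f 2 ∧ MemLp f 3 ∧ ∫ x, youngPsi α (f x) = 1 := by
  rw [admissible, mem_ofPred_eq, memOrlicz_youngPsi_iff hα]
  constructor
  · rintro ⟨⟨h2, h3⟩, h⟩
    exact ⟨h2, h3, (gaugeNorm_youngPsi_eq_one_iff hα h2 h3).1 h⟩
  · rintro ⟨h2, h3, h⟩
    exact ⟨⟨h2, h3⟩, (gaugeNorm_youngPsi_eq_one_iff hα h2 h3).2 h⟩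

theorem exists_scale_integral_youngPsi_eq_one (hα : 0 < α) (f2 : MemLp f 2) (f3 : MemLp f 3)
    (h0 : 0 < ∫ x, youngPsi α (f x)) (h1 : ∫ x, youngPsi α (f x) ≤ 1) :
    ∃ c : ℝ, 1 ≤ c ∧ ∫ x, youngPsi α (c * f x) = 1 := by
  set I := ∫ x, youngPsi α (f x) with hI
  have hc := continuous_integral_youngPsi_mul hα f2 f3
  have hI1 : 1 ≤ I⁻¹ := (one_le_inv₀ h0).2 h1
  have h2 := mul_integral_youngPsi_le hα f2 f3 hI1
  rw [← hI, inv_mul_cancel₀ h0.ne'] at h2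
  obtain ⟨c, hc1, hc2⟩ := intermediate_value_Icc hI1 hc.continuousOn
    (show (1 : ℝ) ∈ Icc _ _ from ⟨by simpa using h1, h2⟩)
  exact ⟨c, hc1.1, hc2⟩

theorem integral_youngPsi_eq_zero_iff (hα : 0 < α) (f2 : MemLp f 2) (f3 : MemLp f 3) :
    ∫ x, youngPsi α (f x) = 0 ↔ f =ᵐ[volume] 0 := by
  rw [integral_eq_zero_iff_of_nonneg (fun x => youngPsi_nonneg hα _) (integrable_youngPsi hα f2 f3)]
  constructor
  · intro h
    filter_upwards [h] with x hx
    have h1 := mul_sq_le_youngPsi hα (f x)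
    simp only [Pi.zero_apply] at hx ⊢
    rw [hx] at h1
    have h2 : f x ^ 2 ≤ 0 := by
      by_contra h3
      push Not at h3
      have : 0 < α / 3 * f x ^ 2 := by positivity
      linarith
    exact pow_eq_zero_iff two_ne_zero |>.1 (le_antisymm h2 (sq_nonneg _))
  · intro h
    filter_upwards [h] with x hx
    simp only [Pi.zero_apply] at hx ⊢
    rw [hx, youngPsi_zero hα]

end Orlicz

/-! ### The constrained maximum and its Euler–Lagrange equation -/

/-- The constraint set of functions with `N_Ψ(f) = 1` vanishing almost everywhere outside `I`. -/
def admissibleOn (α : ℝ) (I : Set ℝ) : Set (ℝ → ℝ) :=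
  {f | f ∈ admissible α ∧ ∀ᵐ x : ℝ, x ∉ I → f x = 0}

theorem admissibleOn_univ (α : ℝ) : admissibleOn α univ = admissible α := by
  ext f
  simp [admissibleOn]

theorem admissibleOn_mono {α : ℝ} {I I' : Set ℝ} (h : I ⊆ I') :
    admissibleOn α I ⊆ admissibleOn α I' := fun _ hf =>
  ⟨hf.1, hf.2.mono fun _ hx hxI => hx fun hxI' => hxI (h hxI')⟩

/-- The squared supremum of the functional over `admissibleOn α I`. -/
noncomputable def maxSq (α : ℝ) (I : Set ℝ) : ℝ := (supJ (admissibleOn α I)).toReal ^ 2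

theorem supJ_mono {C D : Set (ℝ → ℝ)} (h : C ⊆ D) : supJ C ≤ supJ D := biSup_mono h

section Maximisers

variable {α : ℝ} {f v : ℝ → ℝ} {I : Set ℝ}

theorem integral_sq_le (hα : 0 < α) (f2 : MemLp f 2) (f3 : MemLp f 3) :
    ∫ x, f x ^ 2 ≤ 3 / α * ∫ x, youngPsi α (f x) := by
  rw [← integral_const_mul]
  refine integral_mono f2.integrable_sq ((integrable_youngPsi hα f2 f3).const_mul _) fun x => ?_
  have := mul_sq_le_youngPsi hα (f x)
  calc f x ^ 2 = 3 / α * (α / 3 * f x ^ 2) := by field_simp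
    _ ≤ _ := by gcongr

theorem supJ_admissibleOn_ne_top (hα : 0 < α) : supJ (admissibleOn α I) ≠ ∞ := by
  refine ne_top_of_le_ne_top (ENNReal.ofReal_ne_top (r := Real.sqrt (3 / α))) ?_
  refine iSup₂_le fun f hf => ?_
  obtain ⟨f2, f3, f1⟩ := (mem_admissible_iff hα).1 hf.1
  rw [energyJ_eq f2]
  refine ENNReal.ofReal_le_ofReal (Real.sqrt_le_sqrt ?_)
  have := integral_sq_le hα f2 f3
  rw [f1, mul_one] at this
  exact (bform_self_le f2).trans this

theorem maxSq_mono (hα : 0 < α) {I' : Set ℝ} (h : I ⊆ I') : maxSq α I ≤ maxSq α I' := by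
  unfold maxSq
  gcongr
  · exact supJ_admissibleOn_ne_top hα
  · exact supJ_mono (admissibleOn_mono h)

theorem bform_le_maxSq_of_mem (hα : 0 < α) (hf : f ∈ admissibleOn α I) :
    bform f f ≤ maxSq α I := by
  obtain ⟨f2, f3, f1⟩ := (mem_admissible_iff hα).1 hf.1
  have h : energyJ f ≤ supJ (admissibleOn α I) := le_biSup _ hf
  rw [energyJ_eq f2, ENNReal.ofReal_le_iff_le_toReal (supJ_admissibleOn_ne_top hα)] at h
  rw [maxSq, ← Real.sq_sqrt (bform_self_nonneg f2)]
  gcongr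

/-- The constraint may be relaxed to `≤ 1`: scaling a nonzero function up to equality does not
decrease a nonnegative quadratic form. The relaxed form lets competitors be built without
renormalisation. -/
theorem bform_le_maxSq (hα : 0 < α) (f2 : MemLp f 2) (f3 : MemLp f 3)
    (hI : ∀ᵐ x : ℝ, x ∉ I → f x = 0) (h1 : ∫ x, youngPsi α (f x) ≤ 1) :
    bform f f ≤ maxSq α I := by
  have hI0 : 0 ≤ ∫ x, youngPsi α (f x) := integral_nonneg fun x => youngPsi_nonneg hα _
  rcases hI0.eq_or_lt with h0 | h0
  · have := (integral_youngPsi_eq_zero_iff hα f2 f3).1 h0.symm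
    have hz : bform f f = 0 := by
      rw [bform_congr this this]; simp [bform]
    rw [hz]
    exact sq_nonneg _
  · obtain ⟨c, hc1, hc⟩ := exists_scale_integral_youngPsi_eq_one hα f2 f3 h0 h1
    have hmem : c • f ∈ admissibleOn α I := by
      refine ⟨(mem_admissible_iff hα).2 ⟨f2.const_smul c, f3.const_smul c, hc⟩, ?_⟩
      filter_upwards [hI] with x hx hxI
      simp [hx hxI]
    have h2 := bform_le_maxSq_of_mem hα hmem
    rw [bform_smul_left, bform_smul_right] at h2
    have h3 := bform_self_nonneg f2
    nlinarith [mul_le_mul hc1 hc1 zero_le_one (zero_le_one.trans hc1)]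

theorem IsMaximiser.bform_eq (hα : 0 < α) (hf : IsMaximiser (admissibleOn α I) f) :
    bform f f = maxSq α I := by
  obtain ⟨f2, f3, f1⟩ := (mem_admissible_iff hα).1 hf.1.1
  rw [maxSq, ← hf.2, energyJ_eq f2, ENNReal.toReal_ofReal (Real.sqrt_nonneg _),
    Real.sq_sqrt (bform_self_nonneg f2)]

theorem isMaximiser_of_bform_eq (hα : 0 < α) (hf : f ∈ admissibleOn α I)
    (h : maxSq α I ≤ bform f f) : IsMaximiser (admissibleOn α I) f := by
  obtain ⟨f2, f3, f1⟩ := (mem_admissible_iff hα).1 hf.1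
  refine ⟨hf, le_antisymm (le_biSup _ hf) ?_⟩
  rw [energyJ_eq f2, ← ENNReal.ofReal_toReal (supJ_admissibleOn_ne_top (I := I) hα)]
  exact ENNReal.ofReal_le_ofReal (Real.le_sqrt_of_sq_le h)

theorem pairingPsi_pos (hα : 0 < α) (hf : f ∈ admissible α) : 0 < pairingPsi α f := by
  obtain ⟨f2, f3, f1⟩ := (mem_admissible_iff hα).1 hf
  have hi := integrable_deriv_youngPsi_mul hα f2 f3 f2 f3
  simp_rw [mul_comm (deriv (youngPsi α) _)] at hi
  refine (integral_nonneg fun x => mul_deriv_youngPsi_nonneg hα _).lt_of_ne fun h0 => ?_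
  have h2 := (integral_eq_zero_iff_of_nonneg (fun x => mul_deriv_youngPsi_nonneg hα _) hi).1 h0.symm
  have h3 : f =ᵐ[volume] 0 := by
    filter_upwards [h2] with x hx
    by_contra hne
    exact (mul_deriv_youngPsi_pos hα hne).ne' hx
  rw [← integral_youngPsi_eq_zero_iff hα f2 f3, f1] at h3
  exact one_ne_zero h3

/-- A direction that strictly lowers the constraint stays inside the relaxed constraint for small `t
> 0`, so the energy cannot increase along it to first order. -/
theorem IsMaximiser.bform_nonpos (hα : 0 < α) (hf : IsMaximiser (admissibleOn α I) f)
    (v2 : MemLp v 2) (v3 : MemLp v 3) (hv : ∀ᵐ x : ℝ, x ∉ I → v x = 0)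
    (hneg : ∫ x, deriv (youngPsi α) (f x) * v x < 0) : bform f v ≤ 0 := by
  obtain ⟨f2, f3, f1⟩ := (mem_admissible_iff hα).1 hf.1.1
  have hd := hasDerivAt_integral_youngPsi hα f2 f3 v2 v3
  have hev : ∀ᶠ t in 𝓝[>] (0 : ℝ), ∫ x, youngPsi α (f x + t * v x) < 1 := by
    have hlt := hd.hasDerivWithinAt (s := Ioi 0)
    rw [hasDerivWithinAt_iff_tendsto_slope' (by simp)] at hlt
    filter_upwards [hlt.eventually (gt_mem_nhds hneg), self_mem_nhdsWithin] with t ht ht0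
    have ht0 : 0 < t := ht0
    rw [slope_def_field, sub_zero, div_lt_iff₀ ht0, zero_mul] at ht
    simp only [zero_mul, add_zero, f1] at ht
    linarith
  have hle : ∀ᶠ t in 𝓝[>] (0 : ℝ), bform f v ≤ -(t / 2) * bform v v := by
    filter_upwards [hev, self_mem_nhdsWithin] with t ht ht0
    have ht0 : 0 < t := ht0
    have h1 := bform_le_maxSq (I := I) hα (f2.add (v2.const_smul t)) (f3.add (v3.const_smul t)) (by
      filter_upwards [hf.1.2, hv] with x hx1 hx2 hxI
      simp [hx1 hxI, hx2 hxI]) ht.le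
    rw [← IsMaximiser.bform_eq hα hf, bform_add_left f2 (v2.const_smul t) (f2.add (v2.const_smul t)),
      bform_add_right f2 f2 (v2.const_smul t),
      bform_add_right (v2.const_smul t) f2 (v2.const_smul t), bform_smul_right, bform_smul_left,
      bform_smul_left, bform_smul_right, bform_comm v f] at h1
    have h2 : t * (2 * bform f v + t * bform v v) ≤ 0 := by linarith
    have h3 : 2 * bform f v + t * bform v v ≤ 0 := by
      by_contra hc
      push Not at hc
      exact absurd h2 (not_le.2 (mul_pos ht0 hc))
    linarith
  have hlim : Tendsto (fun t : ℝ => -(t / 2) * bform v v) (𝓝[>] 0) (𝓝 0) := by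
    have : Continuous fun t : ℝ => -(t / 2) * bform v v := by fun_prop
    simpa using (this.tendsto 0).mono_left nhdsWithin_le_nhds
  exact ge_of_tendsto hlim hle

/-- Let `D` and `P` be the derivatives of the constraint along `v` and along `f`. For every `β >
D/P` the direction `v - β f` strictly lowers the constraint; the previous inequality is applied to
it and `β` decreases to `D/P`. -/
theorem IsMaximiser.bform_mul_pairing_le (hα : 0 < α) (hf : IsMaximiser (admissibleOn α I) f)
    (v2 : MemLp v 2) (v3 : MemLp v 3) (hv : ∀ᵐ x : ℝ, x ∉ I → v x = 0) :
    bform f v * pairingPsi α f ≤ maxSq α I * ∫ x, deriv (youngPsi α) (f x) * v x := by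
  obtain ⟨f2, f3, f1⟩ := (mem_admissible_iff hα).1 hf.1.1
  set P := pairingPsi α f with hP
  have hP0 : 0 < P := pairingPsi_pos hα hf.1.1
  set D := ∫ x, deriv (youngPsi α) (f x) * v x with hD
  have hPD : ∫ x, deriv (youngPsi α) (f x) * f x = P := by
    rw [hP, pairingPsi]; simp_rw [mul_comm]
  have key : ∀ β : ℝ, D / P < β → bform f v ≤ β * maxSq α I := by
    intro β hβ
    have h1 := IsMaximiser.bform_nonpos hα hf (v2.add (f2.const_smul (-β)))
      (v3.add (f3.const_smul (-β))) (by
        filter_upwards [hf.1.2, hv] with x hx1 hx2 hxI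
        simp [hx1 hxI, hx2 hxI]) (by
        have e : ∀ x, deriv (youngPsi α) (f x) * (v + (-β) • f) x =
            deriv (youngPsi α) (f x) * v x + (-β) * (deriv (youngPsi α) (f x) * f x) := fun x => by
          simp only [Pi.add_apply, Pi.smul_apply, smul_eq_mul]; ring
        simp_rw [e]
        rw [integral_add (integrable_deriv_youngPsi_mul hα f2 f3 v2 v3)
          ((integrable_deriv_youngPsi_mul hα f2 f3 f2 f3).const_mul _), integral_const_mul, hPD]
        rw [div_lt_iff₀ hP0] at hβ
        linarith)
    rw [bform_add_right f2 v2 (f2.const_smul _), bform_smul_right,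
      IsMaximiser.bform_eq hα hf] at h1
    linarith
  have h2 : bform f v ≤ D / P * maxSq α I := by
    have hlim : Tendsto (fun β : ℝ => β * maxSq α I) (𝓝[>] (D / P)) (𝓝 (D / P * maxSq α I)) := by
      have : Continuous fun β : ℝ => β * maxSq α I := by fun_prop
      exact (this.tendsto _).mono_left nhdsWithin_le_nhds
    refine ge_of_tendsto hlim ?_
    filter_upwards [self_mem_nhdsWithin] with β hβ using key β hβ
  calc bform f v * P ≤ D / P * maxSq α I * P := by gcongr
    _ = _ := by field_simp

theorem IsMaximiser.bform_mul_pairing_eq (hα : 0 < α) (hf : IsMaximiser (admissibleOn α I) f)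
    (v2 : MemLp v 2) (v3 : MemLp v 3) (hv : ∀ᵐ x : ℝ, x ∉ I → v x = 0) :
    bform f v * pairingPsi α f = maxSq α I * ∫ x, deriv (youngPsi α) (f x) * v x := by
  refine le_antisymm (IsMaximiser.bform_mul_pairing_le hα hf v2 v3 hv) ?_
  have h := IsMaximiser.bform_mul_pairing_le hα hf (v2.const_smul (-1 : ℝ)) (v3.const_smul (-1 : ℝ)) (by
    filter_upwards [hv] with x hx hxI
    simp [hx hxI])
  rw [bform_smul_right] at h
  have e : ∀ x, deriv (youngPsi α) (f x) * ((-1 : ℝ) • v) x =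
      -(deriv (youngPsi α) (f x) * v x) := fun x => by simp
  simp_rw [e, integral_neg] at h
  linarith

theorem memLp_indicator_one {S : Set ℝ} (hS : MeasurableSet S) (hfin : volume S ≠ ∞) (p : ℝ≥0∞) :
    MemLp (S.indicator fun _ => (1 : ℝ)) p :=
  memLp_indicator_const p hS 1 (Or.inr hfin)

/-- The Euler–Lagrange equation of the constrained problem. -/
theorem IsMaximiser.euler_lagrange (hα : 0 < α) (hf : IsMaximiser (admissibleOn α I) f)
    (hI : MeasurableSet I) (hfin : volume I ≠ ∞) :
    ∀ᵐ x, x ∈ I → pairingPsi α f * whithamConv (1 / 2) f x =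
      maxSq α I * deriv (youngPsi α) (f x) := by
  obtain ⟨f2, f3, f1⟩ := (mem_admissible_iff hα).1 hf.1.1
  rw [← ae_restrict_iff' hI]
  have hI2 := memLp_indicator_one hI hfin 2
  have hI3 := memLp_indicator_one hI hfin 3
  have i1 : IntegrableOn (fun x => whithamConv (1 / 2) f x) I := by
    rw [← integrable_indicator_iff hI]
    refine (integrable_mul_whithamConv hI2 f2).congr (ae_of_all _ fun x => ?_)
    by_cases hx : x ∈ I <;> simp [hx]
  have i2 : IntegrableOn (fun x => deriv (youngPsi α) (f x)) I := by
    rw [← integrable_indicator_iff hI]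
    refine (integrable_deriv_youngPsi_mul hα f2 f3 hI2 hI3).congr (ae_of_all _ fun x => ?_)
    by_cases hx : x ∈ I <;> simp [hx]
  -- The weak equation is tested against indicators of subsets of `I`, which lie in `L²` and `L³`
  -- because `I` has finite volume.
  refine Integrable.ae_eq_of_forall_setIntegral_eq _ _ (i1.const_mul _) (i2.const_mul _) ?_
  intro S hS _
  rw [Measure.restrict_restrict hS, integral_const_mul, integral_const_mul]
  set T := S ∩ I with hT
  have hTm : MeasurableSet T := hS.inter hI
  have hTf : volume T ≠ ∞ := ne_top_of_le_ne_top hfin (measure_mono inter_subset_right)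
  have h := IsMaximiser.bform_mul_pairing_eq hα hf (memLp_indicator_one hTm hTf 2)
    (memLp_indicator_one hTm hTf 3) (ae_of_all _ fun x hx => by
      rw [indicator_of_notMem]; exact fun h => hx h.2)
  rw [bform_comm, bform_eq_integral (memLp_indicator_one hTm hTf 2) f2] at h
  have e1 : ∀ x, T.indicator (fun _ => (1 : ℝ)) x * whithamConv (1 / 2) f x =
      T.indicator (fun x => whithamConv (1 / 2) f x) x := fun x => by
    by_cases hx : x ∈ T <;> simp [hx]
  have e2 : ∀ x, deriv (youngPsi α) (f x) * T.indicator (fun _ => (1 : ℝ)) x =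
      T.indicator (fun x => deriv (youngPsi α) (f x)) x := fun x => by
    by_cases hx : x ∈ T <;> simp [hx]
  simp_rw [e1, e2] at h
  rw [integral_indicator hTm, integral_indicator hTm] at h
  linarith

end Maximisers

/-! ### Exhaustion of the line and the dilation bound -/

theorem tendsto_bform {f g : ℕ → ℝ → ℝ} {f' g' F G : ℝ → ℝ}
    (hf : ∀ n, AEStronglyMeasurable (f n)) (hg : ∀ n, AEStronglyMeasurable (g n))
    (hF : MemLp F 2) (hG : MemLp G 2)
    (hfF : ∀ n, ∀ᵐ x, |f n x| ≤ F x) (hgG : ∀ n, ∀ᵐ x, |g n x| ≤ G x)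
    (hf' : ∀ᵐ x, Tendsto (fun n => f n x) atTop (𝓝 (f' x)))
    (hg' : ∀ᵐ x, Tendsto (fun n => g n x) atTop (𝓝 (g' x))) :
    Tendsto (fun n => bform (f n) (g n)) atTop (𝓝 (bform f' g')) := by
  have q1 := Measure.quasiMeasurePreserving_fst (μ := (volume : Measure ℝ))
    (ν := (volume : Measure ℝ))
  have q2 := Measure.quasiMeasurePreserving_snd (μ := (volume : Measure ℝ))
    (ν := (volume : Measure ℝ))
  simp only [bform, Measure.volume_eq_prod]
  refine tendsto_integral_of_dominated_convergence _
    (fun n => aestronglyMeasurable_bform (hf n) (hg n)) (integrable_bform hF hG) (fun n => ?_) ?_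
  · filter_upwards [q1.ae (hfF n), q2.ae (hgG n)] with p h1 h2
    have h0 := whithamDensity_nonneg half_pos' (p.1 - p.2)
    rw [norm_mul, norm_mul, Real.norm_of_nonneg h0]
    have hF0 : 0 ≤ F p.1 := (abs_nonneg _).trans h1
    exact mul_le_mul (mul_le_mul_of_nonneg_right h1 h0) h2 (norm_nonneg _) (mul_nonneg hF0 h0)
  · filter_upwards [q1.ae hf', q2.ae hg'] with p h1 h2
    exact (h1.mul_const _).mul h2

/-- The interval `[-2^l, 2^l]`. -/
def dyadicIcc (l : ℕ) : Set ℝ := Icc (-(2 : ℝ) ^ l) ((2 : ℝ) ^ l)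

theorem measurableSet_dyadicIcc (l : ℕ) : MeasurableSet (dyadicIcc l) := measurableSet_Icc

theorem volume_dyadicIcc_ne_top (l : ℕ) : volume (dyadicIcc l) ≠ ∞ := by
  simp [dyadicIcc]

theorem dyadicIcc_mono : Monotone dyadicIcc := fun l m h => by
  have : (2 : ℝ) ^ l ≤ 2 ^ m := pow_le_pow_right₀ (by norm_num) h
  exact Icc_subset_Icc (by linarith) this

theorem eventually_lt_two_pow (x : ℝ) : ∀ᶠ l : ℕ in atTop, x < (2 : ℝ) ^ l :=
  (tendsto_pow_atTop_atTop_of_one_lt (by norm_num : (1 : ℝ) < 2)).eventually_gt_atTop x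

theorem eventually_mem_Ioo_two_pow (x : ℝ) :
    ∀ᶠ l : ℕ in atTop, x ∈ Ioo (-(2 : ℝ) ^ l) ((2 : ℝ) ^ l) := by
  filter_upwards [eventually_lt_two_pow |x|] with l hl
  exact abs_lt.1 hl

theorem abs_indicator_le_self_real (S : Set ℝ) (f : ℝ → ℝ) (x : ℝ) :
    |S.indicator f x| ≤ |f x| := by
  by_cases h : x ∈ S <;> simp [h]

theorem tendsto_indicator_dyadicIcc (f : ℝ → ℝ) (x : ℝ) :
    Tendsto (fun l => (dyadicIcc l).indicator f x) atTop (𝓝 (f x)) := by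
  refine tendsto_const_nhds.congr' ?_
  filter_upwards [eventually_mem_Ioo_two_pow x] with l hl
  exact (indicator_of_mem (show x ∈ dyadicIcc l from Ioo_subset_Icc_self hl) f).symm

theorem tendsto_bform_indicator {f : ℝ → ℝ} (hf : MemLp f 2) :
    Tendsto (fun l => bform ((dyadicIcc l).indicator f) ((dyadicIcc l).indicator f)) atTop
      (𝓝 (bform f f)) :=
  tendsto_bform (fun l => hf.1.indicator (measurableSet_dyadicIcc l))
    (fun l => hf.1.indicator (measurableSet_dyadicIcc l)) hf.abs hf.abs
    (fun _ => ae_of_all _ fun x => abs_indicator_le_self_real _ f x)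
    (fun _ => ae_of_all _ fun x => abs_indicator_le_self_real _ f x)
    (ae_of_all _ fun x => tendsto_indicator_dyadicIcc f x)
    (ae_of_all _ fun x => tendsto_indicator_dyadicIcc f x)

section GlobalMaximum

variable {α : ℝ} {f : ℝ → ℝ} {I : Set ℝ}

theorem maxSq_le (hα : 0 < α) {L : ℝ} (hL : 0 ≤ L)
    (h : ∀ f ∈ admissibleOn α I, bform f f ≤ L) : maxSq α I ≤ L := by
  have h1 : supJ (admissibleOn α I) ≤ ENNReal.ofReal (Real.sqrt L) := by
    refine iSup₂_le fun f hf => ?_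
    rw [energyJ_eq ((mem_admissible_iff hα).1 hf.1).1]
    exact ENNReal.ofReal_le_ofReal (Real.sqrt_le_sqrt (h f hf))
  have h2 := ENNReal.toReal_le_of_le_ofReal (Real.sqrt_nonneg _) h1
  rw [maxSq, ← Real.sq_sqrt hL]
  gcongr

theorem bform_indicator_le_maxSq (hα : 0 < α) (hf : f ∈ admissible α) (l : ℕ) :
    bform ((dyadicIcc l).indicator f) ((dyadicIcc l).indicator f) ≤ maxSq α (dyadicIcc l) := by
  obtain ⟨f2, f3, f1⟩ := (mem_admissible_iff hα).1 hf
  refine bform_le_maxSq hα (f2.indicator (measurableSet_dyadicIcc l))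
    (f3.indicator (measurableSet_dyadicIcc l)) (ae_of_all _ fun x hx => by simp [hx]) ?_
  rw [← f1]
  exact integral_youngPsi_mono hα f2 f3 (ae_of_all _ fun x => abs_indicator_le_self_real _ f x)

/-- Truncation to an interval does not raise the constraint, and the energies of the truncations
converge to the energy of the function. Every global competitor is thus approached by local ones. -/
theorem tendsto_maxSq (hα : 0 < α) :
    Tendsto (fun l => maxSq α (dyadicIcc l)) atTop (𝓝 (maxSq α univ)) := by
  have hmono : Monotone fun l => maxSq α (dyadicIcc l) := fun l m h =>
    maxSq_mono hα (dyadicIcc_mono h)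
  have hle : ∀ l, maxSq α (dyadicIcc l) ≤ maxSq α univ := fun l => maxSq_mono hα (subset_univ _)
  have hbdd : BddAbove (range fun l => maxSq α (dyadicIcc l)) :=
    ⟨maxSq α univ, by rintro _ ⟨l, rfl⟩; exact hle l⟩
  have ht := tendsto_atTop_ciSup hmono hbdd
  have heq : maxSq α univ = ⨆ l, maxSq α (dyadicIcc l) := by
    refine le_antisymm (maxSq_le hα ?_ fun f hf => ?_) (ciSup_le hle)
    · exact (sq_nonneg _).trans (le_ciSup hbdd 0)
    · exact le_of_tendsto (tendsto_bform_indicator ((mem_admissible_iff hα).1 hf.1).1)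
        (Eventually.of_forall fun l =>
          (bform_indicator_le_maxSq hα hf.1 l).trans (le_ciSup hbdd l))
  rwa [heq]

theorem MemLp.integrable_of_ae_eq_zero {S : Set ℝ} (hf : MemLp f 2) (hS : MeasurableSet S)
    (hfin : volume S ≠ ∞) (h : ∀ᵐ x, x ∉ S → f x = 0) : Integrable f := by
  have h1 : IntegrableOn f S := by
    have : IsFiniteMeasure (volume.restrict S) := ⟨by simpa using hfin.lt_top⟩
    exact (hf.restrict S).integrable (by norm_num)
  refine (integrable_indicator_iff hS |>.2 h1).congr ?_
  filter_upwards [h] with x hx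
  by_cases hxS : x ∈ S
  · simp [hxS]
  · simp [hxS, hx hxS]

theorem IsMaximiser.maxSq_pos (hα : 0 < α) (hI : MeasurableSet I) (hfin : volume I ≠ ∞)
    (hf : IsMaximiser (admissibleOn α I) f) (hf0 : 0 ≤ᵐ[volume] f) : 0 < maxSq α I := by
  obtain ⟨f2, f3, f1⟩ := (mem_admissible_iff hα).1 hf.1.1
  have hi := MemLp.integrable_of_ae_eq_zero f2 hI hfin hf.1.2
  rw [← IsMaximiser.bform_eq hα hf]
  refine bform_self_pos f2 hi fun h0 => ?_
  rw [integral_eq_zero_iff_of_nonneg_ae hf0 hi, ← integral_youngPsi_eq_zero_iff hα f2 f3, f1] at h0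
  exact one_ne_zero h0

/-- For `m = ∫ Ψ(f) > 0`, dilation by `1/m` brings the constraint to exactly one and multiplies the
form by at least `1/m`. -/
theorem bform_le_maxSq_mul_of_integrable (hα : 0 < α) (hfm : Measurable f) (hf0 : ∀ x, 0 ≤ f x)
    (f2 : MemLp f 2) (f3 : MemLp f 3) (hfi : Integrable f) (h1 : ∫ x, youngPsi α (f x) ≤ 1) :
    bform f f ≤ maxSq α univ * ∫ x, youngPsi α (f x) := by
  set m := ∫ x, youngPsi α (f x) with hm
  have hm0 : 0 ≤ m := integral_nonneg fun x => youngPsi_nonneg hα _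
  rcases hm0.eq_or_lt with h0 | h0
  · have hz := (integral_youngPsi_eq_zero_iff hα f2 f3).1 h0.symm
    rw [bform_congr hz hz, ← h0]
    simp [bform]
  · have hτ : 1 ≤ m⁻¹ := (one_le_inv₀ h0).2 h1
    have hτ0 : m⁻¹ ≠ 0 := (inv_pos.2 h0).ne'
    have hd := lform_whithamDensity_dilate half_pos' hfi hfm hf0 hτ
    have hcomp : ∀ {p : ℝ≥0∞}, MemLp f p → MemLp (fun x => f (x / m⁻¹)) p := fun {p} hp => by
      have hmap := Real.map_volume_mul_left (a := m) h0.ne'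
      have hp' : MemLp f p (Measure.map (m * ·) volume) := by
        rw [hmap]; exact hp.smul_measure (by simp)
      have := hp'.comp_of_map (by fun_prop)
      refine this.ae_eq (ae_of_all _ fun x => ?_)
      simp [div_inv_eq_mul, mul_comm]
    rw [← ofReal_bform f2 hf0, ← ofReal_bform (hcomp f2) fun x => hf0 _,
      ← ENNReal.ofReal_mul (by positivity),
      ENNReal.ofReal_le_ofReal_iff (bform_self_nonneg (hcomp f2))] at hd
    have h2 := bform_le_maxSq (I := univ) hα (hcomp f2) (hcomp f3)
      (ae_of_all _ fun x hx => absurd (mem_univ x) hx) (by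
        rw [Measure.integral_comp_div (fun x => youngPsi α (f x)) m⁻¹, ← hm, smul_eq_mul,
          abs_of_pos (inv_pos.2 h0), inv_mul_cancel₀ h0.ne'])
    have h3 := hd.trans h2
    rwa [inv_mul_le_iff₀ h0, mul_comm] at h3

/-- Under dilation the constraint functional grows linearly, the form at least linearly. -/
theorem bform_le_maxSq_mul (hα : 0 < α) (hfm : Measurable f) (hf0 : ∀ x, 0 ≤ f x)
    (f2 : MemLp f 2) (f3 : MemLp f 3) (h1 : ∫ x, youngPsi α (f x) ≤ 1) :
    bform f f ≤ maxSq α univ * ∫ x, youngPsi α (f x) := by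
  -- The dilation inequality rests on transforms of integrable functions; truncations to bounded
  -- intervals are integrable and approximate `f` in energy.
  refine le_of_tendsto (tendsto_bform_indicator f2) (Eventually.of_forall fun l => ?_)
  have hS := measurableSet_dyadicIcc l
  have hle := integral_youngPsi_mono hα f2 f3 (g := (dyadicIcc l).indicator f)
    (ae_of_all _ fun x => abs_indicator_le_self_real _ f x)
  refine (bform_le_maxSq_mul_of_integrable hα (hfm.indicator hS)
    (fun x => indicator_nonneg (fun x _ => hf0 x) x) (f2.indicator hS) (f3.indicator hS)
    (MemLp.integrable_of_ae_eq_zero (f2.indicator hS) hS (volume_dyadicIcc_ne_top l)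
      (ae_of_all _ fun x hx => by simp [hx])) (hle.trans h1)).trans ?_
  exact mul_le_mul_of_nonneg_left hle (sq_nonneg _)

end GlobalMaximum

/-! ### The strict inequality `J² > 1/α` -/

theorem two_mul_sub_abs_le_integral_indicator {L : ℝ} (u : ℝ) :
    2 * L - |u| ≤ ∫ x, (Icc (-L) L).indicator (fun _ => (1 : ℝ)) x *
      (Icc (-L) L).indicator (fun _ => (1 : ℝ)) (x - u) := by
  have e : ∀ x, (Icc (-L) L).indicator (fun _ => (1 : ℝ)) x *
      (Icc (-L) L).indicator (fun _ => (1 : ℝ)) (x - u) =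
      (Icc (max (-L) (-L + u)) (min L (L + u))).indicator (fun _ => (1 : ℝ)) x := fun x => by
    simp only [indicator_apply, mem_Icc, max_le_iff, le_min_iff]
    by_cases h1 : -L ≤ x ∧ x ≤ L <;> by_cases h2 : -L ≤ x - u ∧ x - u ≤ L
    · rw [if_pos h1, if_pos h2, if_pos ⟨⟨h1.1, by linarith [h2.1]⟩, h1.2, by linarith [h2.2]⟩,
        one_mul]
    · rw [if_neg h2, mul_zero, if_neg]
      exact fun h => h2 ⟨by linarith [h.1.2], by linarith [h.2.2]⟩
    · rw [if_neg h1, zero_mul, if_neg]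
      exact fun h => h1 ⟨h.1.1, h.2.1⟩
    · rw [if_neg h1, zero_mul, if_neg]
      exact fun h => h1 ⟨h.1.1, h.2.1⟩
  simp_rw [e]
  rw [integral_indicator measurableSet_Icc, setIntegral_const, smul_eq_mul, mul_one,
    Measure.real, Real.volume_Icc]
  refine le_trans ?_ (Real.le_coe_toNNReal _)
  rcases le_total 0 u with hu | hu
  · rw [abs_of_nonneg hu, min_eq_left (by linarith), max_eq_right (by linarith)]; linarith
  · rw [abs_of_nonpos hu, min_eq_right (by linarith), max_eq_left (by linarith)]; linarith

/-- The first absolute moment of the kernel `K_{1/2}`. -/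
noncomputable def whithamMoment : ℝ := ∫ u, |u| * whithamDensity (1 / 2) u

theorem whithamMoment_nonneg : 0 ≤ whithamMoment :=
  integral_nonneg fun _ => mul_nonneg (abs_nonneg _) (whithamDensity_nonneg half_pos' _)

/-- The form is the mean under `K(u) du` of the overlap of the interval with its translate by `u`.
The loss compared with the full length is at most the first moment, uniformly in `L`. -/
theorem two_mul_sub_le_bform_indicator (L : ℝ) :
    2 * L - whithamMoment ≤ bform ((Icc (-L) L).indicator fun _ => 1)
      ((Icc (-L) L).indicator fun _ => 1) := by
  set χ : ℝ → ℝ := (Icc (-L) L).indicator fun _ => 1 with hχ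
  have χ2 : MemLp χ 2 := memLp_indicator_one measurableSet_Icc (by simp) 2
  have χi : Integrable χ := memLp_one_iff_integrable.1
    (memLp_indicator_one measurableSet_Icc (by simp) 1)
  have χm : Measurable χ := measurable_const.indicator measurableSet_Icc
  have χ1 : ∀ x, |χ x| ≤ 1 := fun x => by
    rw [hχ, indicator_apply]; split_ifs <;> simp
  have hk := integrable_whithamDensity half_pos'
  have hprod : Integrable (fun p : ℝ × ℝ => χ p.1 * (whithamDensity (1 / 2) p.2 * χ (p.1 - p.2)))
      (volume.prod volume) := by
    refine (χi.norm.mul_prod hk).mono' ?_ (ae_of_all _ fun p => ?_)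
    · exact ((χm.comp measurable_fst).mul (((measurable_whithamDensity _).comp measurable_snd).mul
        (χm.comp (by fun_prop)))).aestronglyMeasurable
    · rw [norm_mul, norm_mul, Real.norm_of_nonneg (whithamDensity_nonneg half_pos' _)]
      refine mul_le_mul_of_nonneg_left ?_ (norm_nonneg _)
      exact mul_le_of_le_one_right (whithamDensity_nonneg half_pos' _) (χ1 _)
  rw [bform_eq_integral χ2 χ2]
  have e : ∀ x, χ x * whithamConv (1 / 2) χ x =
      ∫ u, χ x * (whithamDensity (1 / 2) u * χ (x - u)) := fun x => by
    rw [integral_const_mul, whithamConv_eq half_pos',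
      ← integral_sub_left_eq_self (fun u => whithamDensity (1 / 2) u * χ (x - u)) volume x]
    simp
  simp_rw [e]
  rw [integral_integral_swap hprod]
  have h2 : 2 * L - whithamMoment =
      ∫ u, (2 * L * whithamDensity (1 / 2) u - |u| * whithamDensity (1 / 2) u) := by
    rw [integral_sub (hk.const_mul _) integrable_abs_mul_whithamDensity_half, integral_const_mul,
      integral_whithamDensity half_pos', mul_one, whithamMoment]
  rw [h2]
  refine integral_mono ((hk.const_mul _).sub integrable_abs_mul_whithamDensity_half)
    hprod.integral_prod_right fun u => ?_
  have e2 : ∀ x, χ x * (whithamDensity (1 / 2) u * χ (x - u)) =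
      whithamDensity (1 / 2) u * (χ x * χ (x - u)) := fun x => by ring
  simp_rw [e2]
  rw [integral_const_mul]
  have h3 := mul_le_mul_of_nonneg_left (two_mul_sub_abs_le_integral_indicator (L := L) u)
    (whithamDensity_nonneg half_pos' u)
  calc _ = whithamDensity (1 / 2) u * (2 * L - |u|) := by ring
    _ ≤ _ := h3

/-- The competitor is a plateau of small height `A` and length `2L`. The negative cubic term of `Ψ`
makes its squared `L²` norm `1/(α - A/3)`, a gain of order `A`, while the two ends cost at most `A²
κ`. -/
theorem one_div_lt_maxSq {α : ℝ} (hα : 0 < α) : 1 / α < maxSq α univ := by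
  set κ := whithamMoment with hκ
  have hκ0 : 0 ≤ κ := whithamMoment_nonneg
  -- The summand `2` keeps `A = α/D` below `α`, on the first branch of `Ψ`. The other summand gives
  -- `6α²Aκ < 1`, so the loss `A²κ` stays below the gain, which is at least `A/(3α²)`.
  set D := 2 + 6 * α ^ 3 * κ with hD
  have hD2 : 2 ≤ D := by have : 0 ≤ 6 * α ^ 3 * κ := by positivity
                         linarith
  set A := α / D with hA
  have hA0 : 0 < A := by positivity
  have hAα : A < α := by
    rw [hA, div_lt_iff₀ (by positivity)]; nlinarith
  have hAκ : 6 * α ^ 2 * (A * κ) < 1 := by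
    have : 6 * α ^ 2 * (A * κ) = 6 * α ^ 3 * κ / D := by rw [hA]; ring
    rw [this, div_lt_one (by positivity)]
    linarith
  have hden : 0 < α - A / 3 := by linarith
  -- The length `2L` is the reciprocal of `Ψ(A)`, so that the constraint integral equals one.
  set L := 1 / (A ^ 2 * (α - A / 3)) / 2 with hL
  have hL0 : 0 < L := by positivity
  set χ : ℝ → ℝ := (Icc (-L) L).indicator fun _ => 1 with hχ
  have χ2 : MemLp χ 2 := memLp_indicator_one measurableSet_Icc (by simp) 2
  have χ3 : MemLp χ 3 := memLp_indicator_one measurableSet_Icc (by simp) 3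
  have hΨ : ∫ x, youngPsi α ((A • χ) x) = 1 := by
    have e : ∀ x, youngPsi α ((A • χ) x) =
        (Icc (-L) L).indicator (fun _ => A ^ 2 * (α - A / 3)) x := fun x => by
      by_cases hx : x ∈ Icc (-L) L
      · simp only [Pi.smul_apply, hχ, indicator_of_mem hx, smul_eq_mul, mul_one]
        rw [youngPsi, abs_of_pos hA0, if_pos hAα]; ring
      · simp only [Pi.smul_apply, hχ, indicator_of_notMem hx, smul_eq_mul, mul_zero]
        exact youngPsi_zero hα
    simp_rw [e]
    rw [integral_indicator measurableSet_Icc, setIntegral_const, smul_eq_mul, Measure.real,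
      Real.volume_Icc, ENNReal.toReal_ofReal (by linarith), hL]
    have := hden.ne'
    generalize α - A / 3 = E at this ⊢
    field_simp
    ring
  have h1 := bform_le_maxSq (I := univ) hα (χ2.const_smul A) (χ3.const_smul A)
    (ae_of_all _ fun x hx => absurd (mem_univ x) hx) hΨ.le
  rw [bform_smul_left, bform_smul_right] at h1
  refine lt_of_lt_of_le ?_ h1
  have h2 := two_mul_sub_le_bform_indicator L
  have h3 : A * (A * (2 * L - κ)) ≤ A * (A * bform χ χ) := by gcongr
  refine lt_of_lt_of_le ?_ h3
  have h4 : A * (A * (2 * L - κ)) = 1 / (α - A / 3) - A * (A * κ) := by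
    rw [hL]; field_simp
  have h5 : 1 / (α - A / 3) - 1 / α = A / 3 / (α * (α - A / 3)) := by
    rw [div_sub_div _ _ hden.ne' hα.ne', mul_comm (α - A / 3) α]
    congr 1
    ring
  have h6 : A / 3 / (α * α) ≤ A / 3 / (α * (α - A / 3)) := by
    gcongr; linarith
  have h7 : A * (A * κ) < A / 3 / (α * α) := by
    rw [lt_div_iff₀ (by positivity)]
    nlinarith
  rw [h4]
  linarith

/-! ### Bell-shaped functions, compactness and uniform bounds -/

section Bell

variable {f : ℝ → ℝ}

theorem BellShaped.nonneg (hf : BellShaped f) : 0 ≤ᵐ[volume] f := by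
  obtain ⟨g, hg, -, h0, -⟩ := hf
  filter_upwards [hg] with x hx
  rw [hx]
  exact h0 x

/-- For `x > 0` the value at `x` is the smallest on `(0, x]`, so it is at most the mean over that
interval. This converts integral bounds into decay. -/
theorem BellShaped.abs_mul_pow_le (hf : BellShaped f) {p : ℕ} (hi : Integrable fun x => f x ^ p) :
    ∀ᵐ x : ℝ, |x| * f x ^ p ≤ ∫ x, f x ^ p := by
  obtain ⟨g, hg, heven, h0, hanti⟩ := hf
  have hgi : Integrable fun x => g x ^ p := hi.congr (by
    filter_upwards [hg] with x hx
    rw [hx])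
  have hint : ∫ x, f x ^ p = ∫ x, g x ^ p := integral_congr_ae (by
    filter_upwards [hg] with x hx
    rw [hx])
  have key : ∀ x : ℝ, 0 < x → x * g x ^ p ≤ ∫ x, g x ^ p := fun x hx => by
    calc x * g x ^ p = ∫ _ in Ioc 0 x, g x ^ p := by
          rw [setIntegral_const, Measure.real, Real.volume_Ioc, sub_zero,
            ENNReal.toReal_ofReal hx.le, smul_eq_mul]
      _ ≤ ∫ y in Ioc 0 x, g y ^ p := by
          refine setIntegral_mono_on (by simp) hgi.integrableOn measurableSet_Ioc
            fun y hy => ?_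
          exact pow_le_pow_left₀ (h0 x) (hanti hy.1 hx hy.2) p
      _ ≤ ∫ y, g y ^ p := setIntegral_le_integral hgi (ae_of_all _ fun y => pow_nonneg (h0 y) p)
  filter_upwards [hg] with x hx
  rw [hx, hint]
  rcases lt_trichotomy x 0 with h | h | h
  · rw [abs_of_neg h, ← heven]
    exact key _ (neg_pos.2 h)
  · rw [h, abs_zero, zero_mul]
    exact integral_nonneg fun y => pow_nonneg (h0 y) p
  · rw [abs_of_pos h]
    exact key x h

/-- Monotonicity and symmetry must hold at every point, whereas convergence and the bound hold only
almost everywhere. The representative is therefore an upper limit of truncations at `M`, which is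
finite everywhere. -/
theorem bellShaped_of_tendsto {f : ℕ → ℝ → ℝ} {f' : ℝ → ℝ} {M : ℝ} (hM0 : 0 ≤ M)
    (hb : ∀ k, BellShaped (f k)) (hM : ∀ k, ∀ᵐ x, f k x ≤ M)
    (ht : ∀ᵐ x, Tendsto (fun k => f k x) atTop (𝓝 (f' x))) : BellShaped f' := by
  choose g hg heven h0 hanti using hb
  have hbd : ∀ x, (∀ k, 0 ≤ min (g k x) M) ∧ ∀ k, min (g k x) M ≤ M := fun x =>
    ⟨fun k => le_min (h0 k x) hM0, fun k => min_le_right _ _⟩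
  have hB : ∀ x, IsBoundedUnder (· ≤ ·) atTop fun k => min (g k x) M := fun x =>
    isBoundedUnder_of ⟨M, (hbd x).2⟩
  have hC : ∀ x, IsBoundedUnder (· ≥ ·) atTop fun k => min (g k x) M := fun x =>
    isBoundedUnder_of ⟨0, (hbd x).1⟩
  refine ⟨fun x => limsup (fun k => min (g k x) M) atTop, ?_, fun x => ?_, fun x => ?_, ?_⟩
  · filter_upwards [ht, ae_all_iff.2 hg, ae_all_iff.2 hM] with x h1 h2 h3
    have : (fun k => min (g k x) M) = fun k => f k x := by
      ext k
      rw [← h2 k, min_eq_left (h3 k)]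
    rw [this]
    exact h1.limsup_eq.symm
  · simp only [heven]
  · exact le_limsup_of_le (hB x) fun b hb => by
      obtain ⟨k, hk⟩ := hb.exists
      exact ((hbd x).1 k).trans hk
  · intro x hx y hy hxy
    refine limsup_le_limsup (Eventually.of_forall fun k => ?_) (hC y).isCoboundedUnder_le (hB x)
    exact min_le_min_right M (hanti k hx hy hxy)

end Bell

/-- A countable product of compact intervals yields convergence at all rationals and of the scalars
at once. Equicontinuity extends the convergence to every real point. -/
theorem exists_subseq_tendsto_of_equicontinuous {u : ℕ → ℝ → ℝ} {B : ℝ}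
    (hB : ∀ l x, |u l x| ≤ B)
    (heq : ∀ ε > 0, ∃ δ > 0, ∀ x x' : ℝ, |x - x'| < δ → ∀ l, |u l x - u l x'| ≤ ε)
    {c : ℕ → ℝ} {C : ℝ} (hc : ∀ l, c l ∈ Icc 0 C) :
    ∃ φ : ℕ → ℕ, StrictMono φ ∧ ∃ (u' : ℝ → ℝ) (c' : ℝ),
      (∀ x, Tendsto (fun k => u (φ k) x) atTop (𝓝 (u' x))) ∧
      Tendsto (fun k => c (φ k)) atTop (𝓝 c') := by
  have hcomp : IsCompact ((Set.pi univ fun _ : ℚ => Icc (-B) B) ×ˢ Icc (0 : ℝ) C) :=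
    (isCompact_univ_pi fun _ => isCompact_Icc).prod isCompact_Icc
  obtain ⟨z, -, φ, hφ, hz⟩ := hcomp.tendsto_subseq
    (x := fun l => ((fun q : ℚ => u l q), c l)) fun l =>
      ⟨fun q _ => abs_le.1 (hB l q), hc l⟩
  have hz1 : ∀ q : ℚ, Tendsto (fun k => u (φ k) q) atTop (𝓝 (z.1 q)) := fun q =>
    ((continuous_apply q).tendsto _).comp ((continuous_fst.tendsto z).comp hz)
  have hcau : ∀ x, ∃ a, Tendsto (fun k => u (φ k) x) atTop (𝓝 a) := fun x => by
    refine cauchySeq_tendsto_of_complete (Metric.cauchySeq_iff.2 fun ε hε => ?_)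
    obtain ⟨δ, hδ, hu⟩ := heq (ε / 4) (by positivity)
    obtain ⟨q, hq1, hq2⟩ := exists_rat_btwn (show x < x + δ by linarith)
    have hxq : |x - q| < δ := by rw [abs_lt]; constructor <;> linarith
    obtain ⟨N, hN⟩ := Metric.cauchySeq_iff.1 (hz1 q).cauchySeq (ε / 4) (by positivity)
    refine ⟨N, fun m hm n hn => ?_⟩
    have h1 := hu x q hxq (φ m)
    have h2 := hu x q hxq (φ n)
    have h3 := hN m hm n hn
    rw [Real.dist_eq] at h3 ⊢
    rw [abs_le] at h1 h2
    rw [abs_lt] at h3 ⊢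
    constructor <;> linarith
  choose u' hu' using hcau
  exact ⟨φ, hφ, u', z.2, hu', (continuous_snd.tendsto z).comp hz⟩

section UniformBounds

variable {α : ℝ} {f : ℝ → ℝ}

theorem integral_abs_cube_le (hα : 0 < α) (f2 : MemLp f 2) (f3 : MemLp f 3) :
    ∫ x, |f x| ^ 3 ≤ 8 * ∫ x, youngPsi α (f x) := by
  rw [← integral_const_mul]
  refine integral_mono (MemLp.integrable_abs_cube f3)
    ((integrable_youngPsi hα f2 f3).const_mul _) fun x => ?_
  have := cube_le_youngPsi hα (f x)
  simp only
  linarith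

theorem toReal_eLpNorm_three_pow (f3 : MemLp f 3) :
    (eLpNorm f 3 volume).toReal ^ 3 = ∫ x, |f x| ^ 3 := by
  have h := f3.eLpNorm_eq_integral_rpow_norm (by norm_num) (by norm_num)
  have h0 : 0 ≤ ∫ x, |f x| ^ 3 := integral_nonneg fun x => by positivity
  have e : ∫ x, ‖f x‖ ^ (3 : ℝ≥0∞).toReal = ∫ x, |f x| ^ 3 := by
    simp only [ENNReal.toReal_ofNat, Real.norm_eq_abs]
    exact_mod_cast rfl
  rw [e] at h
  rw [h, ENNReal.toReal_ofReal (by positivity), ← Real.rpow_natCast, ← Real.rpow_mul h0]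
  simp

theorem toReal_eLpNorm_three_le (hα : 0 < α) (hf : f ∈ admissible α) :
    (eLpNorm f 3 volume).toReal ≤ 2 := by
  obtain ⟨f2, f3, f1⟩ := (mem_admissible_iff hα).1 hf
  have h := integral_abs_cube_le hα f2 f3
  rw [← toReal_eLpNorm_three_pow f3, f1] at h
  exact le_of_pow_le_pow_left₀ (n := 3) (by norm_num) (by norm_num) (by linarith)

theorem pairingPsi_le (hα : 0 < α) (hf : f ∈ admissible α) : pairingPsi α f ≤ 38 := by
  obtain ⟨f2, f3, f1⟩ := (mem_admissible_iff hα).1 hf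
  have hi := integrable_deriv_youngPsi_mul hα f2 f3 f2 f3
  simp_rw [mul_comm (deriv (youngPsi α) _)] at hi
  calc pairingPsi α f ≤ ∫ x, 38 * youngPsi α (f x) :=
        integral_mono hi ((integrable_youngPsi hα f2 f3).const_mul _)
          fun x => mul_deriv_youngPsi_le hα _
    _ = 38 := by rw [integral_const_mul, f1, mul_one]

end UniformBounds

/-! ### Extraction of a convergent sequence of maximisers -/

/-- A sequence of bell-shaped maximisers on growing dyadic intervals, convergent together with
its Lagrange multipliers and its convolutions with `K_{1/2}`. -/
structure ConvergentMaximisers (α : ℝ) (n : ℕ → ℕ) (f : ℕ → ℝ → ℝ) (fα u : ℝ → ℝ) (c M : ℝ) :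
    Prop where
  strictMono : StrictMono n
  bell : ∀ k, BellShaped (f k)
  isMaximiser : ∀ k, IsMaximiser (admissibleOn α (dyadicIcc (n k))) (f k)
  euler_lagrange : ∀ k, ∀ᵐ x, x ∈ dyadicIcc (n k) →
    deriv (youngPsi α) (f k x) =
      pairingPsi α (f k) / maxSq α (dyadicIcc (n k)) * whithamConv (1 / 2) (f k) x
  tendsto_multiplier :
    Tendsto (fun k => pairingPsi α (f k) / maxSq α (dyadicIcc (n k))) atTop (𝓝 c)
  tendsto_conv : ∀ x, Tendsto (fun k => whithamConv (1 / 2) (f k) x) atTop (𝓝 (u x))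
  deriv_eq : ∀ x, deriv (youngPsi α) (fα x) = c * u x
  tendsto_ae : ∀ᵐ x, Tendsto (fun k => f k x) atTop (𝓝 (fα x))
  nonneg : ∀ x, 0 ≤ fα x
  le_bound : ∀ x, fα x ≤ M
  abs_le : ∀ k, ∀ᵐ x, |f k x| ≤ M

/-- Inverting `Ψ'` in the Euler–Lagrange equation expresses `f_l` through `c_l K ∗ f_l`. The `L³`
bound makes the convolutions bounded and equicontinuous. The maxima are bounded below by that of the
first interval, which bounds the multipliers `c_l`. -/
theorem exists_convergentMaximisers {α : ℝ} (hα : 0 < α) {f : ℕ → ℝ → ℝ}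
    (hbell : ∀ l, BellShaped (f l))
    (hmax : ∀ l, IsMaximiser (admissibleOn α (dyadicIcc l)) (f l)) :
    ∃ (φ : ℕ → ℕ) (fα u : ℝ → ℝ) (c M : ℝ),
      ConvergentMaximisers α φ (fun k => f (φ k)) fα u c M ∧
      ∃ g : ℕ → ℝ → ℝ,
        (∀ l, g l =ᵐ[volume] f l ∧
          ContinuousOn (g l) (Ioo (-(2 : ℝ) ^ l) ((2 : ℝ) ^ l))) ∧
        ∀ x : ℝ, Tendsto (fun k => g (φ k) x) atTop (𝓝 (fα x)) := by
  have hadm : ∀ l, f l ∈ admissible α := fun l => (hmax l).1.1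
  have f3 : ∀ l, MemLp (f l) 3 := fun l => ((mem_admissible_iff hα).1 (hadm l)).2.1
  have hf0 : ∀ l, 0 ≤ᵐ[volume] f l := fun l => (hbell l).nonneg
  set κ := (eLpNorm (whithamDensity (1 / 2)) (3 / 2) volume).toReal with hκ
  have hκ0 : 0 ≤ κ := ENNReal.toReal_nonneg
  set U : ℕ → ℝ → ℝ := fun l => whithamConv (1 / 2) (f l) with hU
  have hU0 : ∀ l x, 0 ≤ U l x := fun l x => whithamConv_nonneg (hf0 l) x
  have hUB : ∀ l x, |U l x| ≤ κ * 2 := fun l x =>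
    (abs_whithamConv_le (f3 l) x).trans
      (mul_le_mul_of_nonneg_left (toReal_eLpNorm_three_le hα (hadm l)) hκ0)
  have hUeq : ∀ ε > 0, ∃ δ > 0, ∀ x x' : ℝ, |x - x'| < δ → ∀ l, |U l x - U l x'| ≤ ε := by
    intro ε hε
    obtain ⟨δ, hδ, h⟩ := whithamConv_equicontinuous (ε := ε / 2) (by positivity)
    refine ⟨δ, hδ, fun x x' hx l => (h x x' hx (f l) (f3 l)).trans ?_⟩
    have := toReal_eLpNorm_three_le hα (hadm l)
    nlinarith
  have hJ0 : 0 < maxSq α (dyadicIcc 0) := IsMaximiser.maxSq_pos hα (measurableSet_dyadicIcc 0)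
    (volume_dyadicIcc_ne_top 0) (hmax 0) (hf0 0)
  have hJ : ∀ l, maxSq α (dyadicIcc 0) ≤ maxSq α (dyadicIcc l) := fun l =>
    maxSq_mono hα (dyadicIcc_mono (Nat.zero_le l))
  have hJp : ∀ l, 0 < maxSq α (dyadicIcc l) := fun l => hJ0.trans_le (hJ l)
  set C := 38 / maxSq α (dyadicIcc 0) with hC
  set c : ℕ → ℝ := fun l => pairingPsi α (f l) / maxSq α (dyadicIcc l) with hc
  have hcC : ∀ l, c l ∈ Icc 0 C := fun l =>
    ⟨div_nonneg (pairingPsi_pos hα (hadm l)).le (hJp l).le,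
      div_le_div₀ (by norm_num) (pairingPsi_le hα (hadm l)) hJ0 (hJ l)⟩
  obtain ⟨G, hGc, hG1, hG2⟩ := exists_continuous_inverse_deriv_youngPsi hα
  have hG0 : ∀ z, 0 ≤ z → 0 ≤ G z := fun z hz => by
    rw [← (strictMono_deriv_youngPsi hα).le_iff_le, hG2, deriv_youngPsi_zero hα]
    exact hz
  obtain ⟨φ, hφ, u, c', hu, hc'⟩ := exists_subseq_tendsto_of_equicontinuous hUB hUeq hcC
  set K := C * (κ * 2) with hK
  obtain ⟨M, hM⟩ := (isCompact_Icc (a := (0 : ℝ)) (b := K)).exists_bound_of_continuousOn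
    hGc.continuousOn
  have hcU : ∀ l x, c l * U l x ∈ Icc 0 K := fun l x =>
    ⟨mul_nonneg (hcC l).1 (hU0 l x),
      mul_le_mul (hcC l).2 ((le_abs_self _).trans (hUB l x)) (hU0 l x) ((hcC l).1.trans (hcC l).2)⟩
  have htU : ∀ x, Tendsto (fun k => c (φ k) * U (φ k) x) atTop (𝓝 (c' * u x)) := fun x =>
    hc'.mul (hu x)
  have hcu : ∀ x, c' * u x ∈ Icc 0 K := fun x =>
    isClosed_Icc.mem_of_tendsto (htU x) (Eventually.of_forall fun k => hcU _ x)
  have hEL : ∀ l, ∀ᵐ x, x ∈ dyadicIcc l → deriv (youngPsi α) (f l x) = c l * U l x := fun l => by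
    filter_upwards [IsMaximiser.euler_lagrange hα (hmax l) (measurableSet_dyadicIcc l)
      (volume_dyadicIcc_ne_top l)] with x hx hxI
    have := hx hxI
    have hne := (hJp l).ne'
    simp only [hc, hU]
    field_simp
    linarith
  -- These are the continuous representatives. The cut-off is invisible at any fixed point once `l`
  -- is large, so pointwise convergence follows from that of `c_l K ∗ f_l`.
  set g : ℕ → ℝ → ℝ := fun l => (dyadicIcc l).indicator fun x => G (c l * U l x) with hg
  have hM0 : 0 ≤ M := (norm_nonneg _).trans (hM 0 ⟨le_rfl, (hcu 0).1.trans (hcu 0).2⟩)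
  have hgM : ∀ l x, |g l x| ≤ M := fun l x =>
    (abs_indicator_le_self_real _ _ x).trans (hM _ (hcU l x))
  have hgf : ∀ l, g l =ᵐ[volume] f l := fun l => by
    filter_upwards [hEL l, (hmax l).1.2] with x h1 h2
    by_cases hx : x ∈ dyadicIcc l
    · simp only [hg, indicator_of_mem hx]
      rw [← h1 hx, hG1]
    · simp only [hg, indicator_of_notMem hx]
      exact (h2 hx).symm
  have hgt : ∀ x, Tendsto (fun k => g (φ k) x) atTop (𝓝 (G (c' * u x))) := fun x => by
    refine ((hGc.tendsto _).comp (htU x)).congr' ?_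
    filter_upwards [hφ.tendsto_atTop.eventually (eventually_mem_Ioo_two_pow x)] with k hk
    exact (indicator_of_mem (show x ∈ dyadicIcc (φ k) from Ioo_subset_Icc_self hk)
      fun x => G (c (φ k) * U (φ k) x)).symm
  refine ⟨φ, fun x => G (c' * u x), u, c', M,
    { strictMono := hφ
      bell := fun k => hbell _
      isMaximiser := fun k => hmax _
      euler_lagrange := fun k => hEL _
      tendsto_multiplier := hc'
      tendsto_conv := hu
      deriv_eq := fun x => hG2 _
      tendsto_ae := ?_
      nonneg := fun x => hG0 _ (hcu x).1
      le_bound := fun x => (le_abs_self _).trans (hM _ (hcu x))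
      abs_le := fun k => ?_ }, g, fun l => ⟨hgf l, ?_⟩, hgt⟩
  · filter_upwards [ae_all_iff.2 hgf] with x hx
    refine (hgt x).congr fun k => hx _
  · filter_upwards [hgf (φ k)] with x hx
    rw [← hx]
    exact hgM _ x
  · have : Continuous fun x => G (c l * U l x) :=
      hGc.comp (continuous_const.mul (continuous_whithamConv (f3 l)))
    refine this.continuousOn.congr fun x hx => ?_
    exact indicator_of_mem (show x ∈ dyadicIcc l from Ioo_subset_Icc_self hx) _

/-! ### Auxiliary convergence in `L^p` and weak convergence -/

theorem tendsto_eLpNorm_of_dominated {r : ℕ → ℝ → ℝ} {F : ℝ → ℝ} {p : ℝ≥0∞} (hp0 : p ≠ 0)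
    (hp : p ≠ ∞) (hr : ∀ k, AEStronglyMeasurable (r k)) (hF : MemLp F p)
    (hrF : ∀ k, ∀ᵐ x, |r k x| ≤ F x) (h : ∀ᵐ x, Tendsto (fun k => r k x) atTop (𝓝 0)) :
    Tendsto (fun k => eLpNorm (r k) p volume) atTop (𝓝 0) := by
  have hp1 : 0 < p.toReal := ENNReal.toReal_pos hp0 hp
  have h1 : Tendsto (fun k => ∫⁻ x, ‖r k x‖ₑ ^ p.toReal) atTop (𝓝 (∫⁻ _ : ℝ, 0)) := by
    refine tendsto_lintegral_of_dominated_convergence' (fun x => ‖F x‖ₑ ^ p.toReal)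
      (fun k => (hr k).enorm.pow_const _) (fun k => ?_)
      (lintegral_rpow_enorm_lt_top_of_eLpNorm_lt_top hp0 hp hF.2).ne ?_
    · filter_upwards [hrF k] with x hx
      gcongr
      rw [enorm_le_iff_norm_le]
      exact hx.trans (le_abs_self _)
    · filter_upwards [h] with x hx
      have h2 : Tendsto (fun k => ‖r k x‖ₑ) atTop (𝓝 0) := by simpa using hx.enorm
      have h3 := h2.ennrpow_const p.toReal
      rwa [ENNReal.zero_rpow_of_pos hp1] at h3
  rw [lintegral_zero] at h1
  have h4 := h1.ennrpow_const (1 / p.toReal)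
  rw [ENNReal.zero_rpow_of_pos (by positivity)] at h4
  refine h4.congr fun k => ?_
  rw [eLpNorm_eq_lintegral_rpow_enorm_toReal hp0 hp]

theorem memLp_one_add_abs_rpow {p : ℝ≥0∞} (hp0 : p ≠ 0) (hp : p ≠ ∞) {q : ℝ}
    (hpq : 1 < q * p.toReal) (E : ℝ) : MemLp (fun x : ℝ => E * (1 + |x|) ^ (-q)) p := by
  refine MemLp.const_mul ?_ E
  have hm : AEStronglyMeasurable (fun x : ℝ => (1 + |x|) ^ (-q)) :=
    Measurable.aestronglyMeasurable (by fun_prop)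
  rw [← integrable_norm_rpow_iff hm hp0 hp]
  refine (integrable_one_add_norm (E := ℝ) (μ := volume) (r := q * p.toReal) (by simpa)).congr
    (ae_of_all _ fun x => ?_)
  have : 0 ≤ 1 + |x| := by positivity
  simp only [Real.norm_eq_abs]
  rw [abs_of_nonneg (Real.rpow_nonneg this _), ← Real.rpow_mul this, neg_mul]

/-- Bounded sequences in `L²` that tend to zero almost everywhere tend to zero weakly. -/
theorem tendsto_integral_mul_of_bounded {h : ℝ → ℝ} {r : ℕ → ℝ → ℝ} {C : ℝ} (hh : MemLp h 2)
    (hr : ∀ k, MemLp (r k) 2) (hC : ∀ k, ∫ x, r k x ^ 2 ≤ C)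
    (ht : ∀ᵐ x, Tendsto (fun k => r k x) atTop (𝓝 0)) :
    Tendsto (fun k => ∫ x, h x * r k x) atTop (𝓝 0) := by
  have hint : ∀ k, Integrable fun x => h x * r k x := fun k => hh.integrable_mul (hr k)
  have hC0 : 0 ≤ C := (integral_nonneg fun x => sq_nonneg _).trans (hC 0)
  refine Metric.tendsto_atTop.2 fun ε hε => ?_
  set η := ε / (2 * (C + 1)) with hη
  have hη0 : 0 < η := by positivity
  -- The product `|h r|` is at most this positive part plus `η r²`. By completing the square the
  -- positive part is at most `h²/(4η)`, so dominated convergence removes it; the rest integrates to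
  -- at most `η C ≤ ε/2`.
  set p : ℕ → ℝ → ℝ := fun k x => max (|h x * r k x| - η * r k x ^ 2) 0 with hp
  have hpm : ∀ k, AEStronglyMeasurable (p k) := fun k =>
    (((hh.1.mul (hr k).1).norm.sub (((hr k).1.pow 2).const_mul η)).sup aestronglyMeasurable_const)
  have hpb : ∀ k x, ‖p k x‖ ≤ 1 / (4 * η) * h x ^ 2 := fun k x => by
    rw [Real.norm_of_nonneg (le_max_right _ _)]
    refine max_le ?_ (by positivity)
    rw [abs_mul, ← sq_abs (h x), ← sq_abs (r k x), ← sub_nonneg]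
    have : 1 / (4 * η) * |h x| ^ 2 - (|h x| * |r k x| - η * |r k x| ^ 2) =
        1 / (4 * η) * (|h x| - 2 * η * |r k x|) ^ 2 := by field_simp; ring
    rw [this]
    positivity
  have hpl : Tendsto (fun k => ∫ x, p k x) atTop (𝓝 (∫ _ : ℝ, (0 : ℝ))) := by
    refine tendsto_integral_of_dominated_convergence _ hpm (hh.integrable_sq.const_mul _)
      (fun k => ae_of_all _ (hpb k)) ?_
    filter_upwards [ht] with x hx
    have h1 := (((hx.const_mul (h x)).abs.sub ((hx.pow 2).const_mul η)).max
      (tendsto_const_nhds (x := (0 : ℝ))))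
    simpa [hp] using h1
  rw [integral_zero] at hpl
  obtain ⟨N, hN⟩ := Metric.tendsto_atTop.1 hpl (ε / 2) (by positivity)
  refine ⟨N, fun k hk => ?_⟩
  have h1 := hN k hk
  rw [dist_zero_right, Real.norm_eq_abs] at h1 ⊢
  have hpi : Integrable (p k) := (hh.integrable_sq.const_mul _).mono' (hpm k) (ae_of_all _ (hpb k))
  calc |∫ x, h x * r k x| ≤ ∫ x, |h x * r k x| := abs_integral_le_integral_abs
    _ ≤ ∫ x, (p k x + η * r k x ^ 2) := by
        refine integral_mono (hint k).abs (hpi.add ((hr k).integrable_sq.const_mul η)) fun x => ?_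
        have := le_max_left (|h x * r k x| - η * r k x ^ 2) 0
        simp only [hp]
        linarith
    _ = (∫ x, p k x) + η * ∫ x, r k x ^ 2 := by
        rw [integral_add hpi ((hr k).integrable_sq.const_mul η), integral_const_mul]
    _ ≤ |∫ x, p k x| + η * C := by gcongr; exacts [le_abs_self _, hC k]
    _ < ε / 2 + ε / 2 := by
        refine add_lt_add_of_lt_of_le h1 ?_
        rw [hη, div_mul_eq_mul_div, div_le_div_iff₀ (by positivity) (by positivity)]
        nlinarith
    _ = ε := by ring

/-- Jensen's inequality `(K ∗ f)² ≤ K ∗ f²` for the probability density `K`, proved as nonnegativity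
of a variance. -/
theorem memLp_two_whithamConv_half {f : ℝ → ℝ} (f2 : MemLp f 2) (f3 : MemLp f 3) :
    MemLp (whithamConv (1 / 2) f) 2 := by
  have hk := integrable_whithamDensity half_pos'
  have hsq := f2.integrable_sq
  obtain ⟨h1, -⟩ := integral_whithamConv half_pos' hsq
  have hex : ∀ᵐ x, Integrable fun t => whithamDensity (1 / 2) t * f (x - t) ^ 2 :=
    hk.ae_convolution_exists (ContinuousLinearMap.mul ℝ ℝ) hsq
  have hcm : AEStronglyMeasurable (whithamConv (1 / 2) f) :=
    (continuous_whithamConv f3).aestronglyMeasurable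
  rw [memLp_two_iff_integrable_sq hcm]
  refine h1.mono' (hcm.pow 2) ?_
  filter_upwards [hex] with x hx
  have i2 : Integrable fun y => whithamDensity (1 / 2) (x - y) * f y ^ 2 := by
    simpa using hx.comp_sub_left x
  have i1 := integrable_kernel_mul f3 x
  have i0 : Integrable fun y => whithamDensity (1 / 2) (x - y) := hk.comp_sub_left x
  have e0 : ∫ y, whithamDensity (1 / 2) (x - y) = 1 := by
    rw [integral_sub_left_eq_self (whithamDensity (1 / 2)) volume x, integral_whithamDensity half_pos']
  rw [whithamConv_eq half_pos', whithamConv_eq half_pos', Real.norm_of_nonneg (sq_nonneg _)]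
  set a := ∫ y, whithamDensity (1 / 2) (x - y) * f y with ha
  have h0 : 0 ≤ ∫ y, whithamDensity (1 / 2) (x - y) * (f y - a) ^ 2 :=
    integral_nonneg fun y => mul_nonneg (whithamDensity_nonneg half_pos' _) (sq_nonneg _)
  have e : ∀ y, whithamDensity (1 / 2) (x - y) * (f y - a) ^ 2 =
      whithamDensity (1 / 2) (x - y) * f y ^ 2 - 2 * a * (whithamDensity (1 / 2) (x - y) * f y) +
        a ^ 2 * whithamDensity (1 / 2) (x - y) := fun y => by ring
  simp_rw [e] at h0
  have i3 : Integrable fun y => whithamDensity (1 / 2) (x - y) * f y ^ 2 -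
      2 * a * (whithamDensity (1 / 2) (x - y) * f y) := i2.sub (i1.const_mul _)
  rw [integral_add i3 (i0.const_mul _),
    integral_sub i2 (i1.const_mul _), integral_const_mul, integral_const_mul, e0, ← ha] at h0
  nlinarith

theorem one_add_abs_rpow_half_bound {a x E : ℝ} (h : (1 + |x|) * a ^ 2 ≤ E) :
    |a| ≤ Real.sqrt E * (1 + |x|) ^ (-(1 / 2) : ℝ) := by
  have hx : 0 < 1 + |x| := by positivity
  rw [Real.rpow_neg hx.le, ← Real.sqrt_eq_rpow, ← div_eq_mul_inv, ← Real.sqrt_div' _ hx.le]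
  refine Real.abs_le_sqrt ?_
  rw [le_div_iff₀ hx]
  linarith

/-! ### No mass is lost: the limit is a maximiser -/

namespace ConvergentMaximisers

variable {α : ℝ} {n : ℕ → ℕ} {f : ℕ → ℝ → ℝ} {fα u : ℝ → ℝ} {c M : ℝ}

theorem mem_admissible (H : ConvergentMaximisers α n f fα u c M) (k : ℕ) : f k ∈ admissible α :=
  (H.isMaximiser k).1.1

theorem measurable_limit (hα : 0 < α) (H : ConvergentMaximisers α n f fα u c M) :
    Measurable fα := by
  have hu : Measurable u := measurable_of_tendsto_metrizable
    (fun k => (continuous_whithamConv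
      ((mem_admissible_iff hα).1 (H.mem_admissible k)).2.1).measurable)
    (tendsto_pi_nhds.2 H.tendsto_conv)
  obtain ⟨G, hGc, hG1, -⟩ := exists_continuous_inverse_deriv_youngPsi hα
  have : fα = fun x => G (c * u x) := by
    ext x
    rw [← H.deriv_eq, hG1]
  rw [this]
  exact hGc.measurable.comp (hu.const_mul c)

/-- Fatou's lemma gives only `≤ 1`; excluding strict inequality is the heart of the argument. -/
theorem memLp_limit (hα : 0 < α) (H : ConvergentMaximisers α n f fα u c M) :
    MemLp fα 2 ∧ MemLp fα 3 ∧ ∫ x, youngPsi α (fα x) ≤ 1 := by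
  have hm := (H.measurable_limit hα).aestronglyMeasurable (μ := volume)
  have hle : ∫⁻ x, ENNReal.ofReal (youngPsi α (fα x)) ≤ 1 := by
    calc ∫⁻ x, ENNReal.ofReal (youngPsi α (fα x))
        = ∫⁻ x, liminf (fun k => ENNReal.ofReal (youngPsi α (f k x))) atTop := by
          refine lintegral_congr_ae ?_
          filter_upwards [H.tendsto_ae] with x hx
          exact ((ENNReal.continuous_ofReal.tendsto _).comp
            (((continuous_youngPsi hα).tendsto _).comp hx)).liminf_eq.symm
      _ ≤ liminf (fun k => ∫⁻ x, ENNReal.ofReal (youngPsi α (f k x))) atTop :=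
          lintegral_liminf_le' fun k => ((continuous_youngPsi hα).comp_aestronglyMeasurable
            ((mem_admissible_iff hα).1 (H.mem_admissible k)).1.1).aemeasurable.ennreal_ofReal
      _ = 1 := by
          have : ∀ k, ∫⁻ x, ENNReal.ofReal (youngPsi α (f k x)) = 1 := fun k => by
            obtain ⟨f2, f3, f1⟩ := (mem_admissible_iff hα).1 (H.mem_admissible k)
            rw [lintegral_youngPsi hα f2 f3, f1, ENNReal.ofReal_one]
          simp [this]
  obtain ⟨h2, h3⟩ := memLp_of_lintegral_youngPsi hα hm (hle.trans_lt ENNReal.one_lt_top)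
  refine ⟨h2, h3, ?_⟩
  rwa [lintegral_youngPsi hα h2 h3, ENNReal.ofReal_le_one] at hle

/-- The common algebraic decay of the maximisers. -/
theorem decay (hα : 0 < α) (H : ConvergentMaximisers α n f fα u c M) :
    (∀ k, ∀ᵐ x, |f k x| ≤ Real.sqrt (M ^ 2 + 3 / α) * (1 + |x|) ^ (-(1 / 2) : ℝ)) ∧
      ∀ᵐ x, |fα x| ≤ Real.sqrt (M ^ 2 + 3 / α) * (1 + |x|) ^ (-(1 / 2) : ℝ) := by
  have h1 : ∀ k, ∀ᵐ x, |f k x| ≤ Real.sqrt (M ^ 2 + 3 / α) * (1 + |x|) ^ (-(1 / 2) : ℝ) := by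
    intro k
    obtain ⟨f2, f3, f1⟩ := (mem_admissible_iff hα).1 (H.mem_admissible k)
    have hs := integral_sq_le hα f2 f3
    rw [f1, mul_one] at hs
    filter_upwards [H.abs_le k, (H.bell k).abs_mul_pow_le f2.integrable_sq] with x hx1 hx2
    -- The uniform bound `M` controls the region near the origin and the bound `3/α` on the squared
    -- `L²` norm controls the tail. The resulting majorant is in `L³` but not in `L²`.
    refine one_add_abs_rpow_half_bound ?_
    have : f k x ^ 2 ≤ M ^ 2 := sq_le_sq' (by linarith [(_root_.abs_le.1 hx1).1])
      (_root_.abs_le.1 hx1).2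
    linarith
  refine ⟨h1, ?_⟩
  filter_upwards [ae_all_iff.2 h1, H.tendsto_ae] with x hx1 hx2
  exact le_of_tendsto hx2.abs (Eventually.of_forall hx1)

theorem integral_sq_sub_le (hα : 0 < α) (H : ConvergentMaximisers α n f fα u c M) (k : ℕ) :
    ∫ x, (f k x - fα x) ^ 2 ≤ 6 / α := by
  obtain ⟨f2, f3, f1⟩ := (mem_admissible_iff hα).1 (H.mem_admissible k)
  obtain ⟨g2, g3, g1⟩ := H.memLp_limit hα
  have hs := integral_sq_le hα f2 f3
  have hs' := integral_sq_le hα g2 g3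
  rw [f1] at hs
  calc ∫ x, (f k x - fα x) ^ 2 ≤ ∫ x, (f k x ^ 2 + fα x ^ 2) := by
        refine integral_mono_ae (f2.sub g2).integrable_sq (f2.integrable_sq.add g2.integrable_sq) ?_
        filter_upwards [(H.bell k).nonneg] with x hx
        have := mul_nonneg hx (H.nonneg x)
        nlinarith
    _ = (∫ x, f k x ^ 2) + ∫ x, fα x ^ 2 := integral_add f2.integrable_sq g2.integrable_sq
    _ ≤ 3 / α * 1 + 3 / α * 1 := by gcongr; exact hs'.trans (by gcongr)
    _ = 6 / α := by ring

theorem tendsto_sub_ae (H : ConvergentMaximisers α n f fα u c M) :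
    ∀ᵐ x, Tendsto (fun k => f k x - fα x) atTop (𝓝 0) := by
  filter_upwards [H.tendsto_ae] with x hx
  simpa using hx.sub_const (fα x)

theorem tendsto_eLpNorm_three (hα : 0 < α) (H : ConvergentMaximisers α n f fα u c M) :
    Tendsto (fun k => eLpNorm (f k - fα) 3 volume) atTop (𝓝 0) := by
  have hF := memLp_one_add_abs_rpow (p := 3) (by norm_num) (by norm_num) (q := 1 / 2) (by norm_num)
    (2 * Real.sqrt (M ^ 2 + 3 / α))
  refine tendsto_eLpNorm_of_dominated (by norm_num) (by norm_num) (fun k => ?_) hF (fun k => ?_)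
    H.tendsto_sub_ae
  · exact ((mem_admissible_iff hα).1 (H.mem_admissible k)).1.1.sub
      (H.measurable_limit hα).aestronglyMeasurable
  · filter_upwards [(H.decay hα).1 k, (H.decay hα).2] with x h1 h2
    have := abs_sub (f k x) (fα x)
    simp only [Pi.sub_apply]
    linarith

/-- Nonlinearities that are cubic at the origin and at infinity pass to the limit. -/
theorem tendsto_integral_cubic (hα : 0 < α) (H : ConvergentMaximisers α n f fα u c M)
    {θ : ℝ → ℝ} (hθ : Continuous θ) {A : ℝ} (hA : ∀ x, |θ x| ≤ A * |x| ^ 3) :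
    Tendsto (fun k => ∫ x, θ (f k x)) atTop (𝓝 (∫ x, θ (fα x))) := by
  have hA0 : 0 ≤ A := by simpa using (abs_nonneg _).trans (hA 1)
  have hF := memLp_one_add_abs_rpow (p := 3) (by norm_num) (by norm_num) (q := 1 / 2) (by norm_num)
    (Real.sqrt (M ^ 2 + 3 / α))
  refine tendsto_integral_of_dominated_convergence _ (fun k => hθ.comp_aestronglyMeasurable
    ((mem_admissible_iff hα).1 (H.mem_admissible k)).1.1)
    ((MemLp.integrable_abs_cube hF).const_mul A) (fun k => ?_) ?_
  · filter_upwards [(H.decay hα).1 k] with x hx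
    refine (hA _).trans ?_
    exact mul_le_mul_of_nonneg_left
      (pow_le_pow_left₀ (abs_nonneg _) (hx.trans (le_abs_self _)) 3) hA0
  · filter_upwards [H.tendsto_ae] with x hx
    exact (hθ.tendsto _).comp hx

theorem tendsto_integral_mul_sub (hα : 0 < α) (H : ConvergentMaximisers α n f fα u c M)
    {h : ℝ → ℝ} (hh : MemLp h 2) :
    Tendsto (fun k => ∫ x, h x * (f k x - fα x)) atTop (𝓝 0) :=
  tendsto_integral_mul_of_bounded hh
    (fun k => ((mem_admissible_iff hα).1 (H.mem_admissible k)).1.sub (H.memLp_limit hα).1)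
    (H.integral_sq_sub_le hα) H.tendsto_sub_ae

theorem integral_sq_eq (hα : 0 < α) (H : ConvergentMaximisers α n f fα u c M) (k : ℕ) :
    ∫ x, f k x ^ 2 = (∫ x, fα x ^ 2) + 2 * (∫ x, fα x * (f k x - fα x)) +
      ∫ x, (f k x - fα x) ^ 2 := by
  obtain ⟨f2, -, -⟩ := (mem_admissible_iff hα).1 (H.mem_admissible k)
  obtain ⟨g2, -, -⟩ := H.memLp_limit hα
  have i1 : Integrable fun x => fα x * (f k x - fα x) := g2.integrable_mul (f2.sub g2)
  have i2 : Integrable fun x => (f k x - fα x) ^ 2 := (f2.sub g2).integrable_sq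
  have i3 : Integrable fun x => fα x ^ 2 + 2 * (fα x * (f k x - fα x)) :=
    g2.integrable_sq.add (i1.const_mul 2)
  rw [← integral_const_mul, ← integral_add g2.integrable_sq (i1.const_mul 2), ← integral_add i3 i2]
  congr 1
  ext x
  ring

/-- The loss of constraint in the limit is carried by the `L²` norm of the remainder. -/
theorem tendsto_integral_sq_sub (hα : 0 < α) (H : ConvergentMaximisers α n f fα u c M) :
    Tendsto (fun k => ∫ x, (f k x - fα x) ^ 2) atTop
      (𝓝 ((1 - ∫ x, youngPsi α (fα x)) / α)) := by
  obtain ⟨g2, g3, -⟩ := H.memLp_limit hα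
  -- After subtraction of `α x²` the nonlinearity is cubic and passes to the limit. Since `∫ Ψ(f_k)
  -- = 1`, the deficit `1 - m` must come from `α ‖f_k‖₂²`, and weak convergence removes the cross
  -- term in its expansion.
  have hθc : Continuous fun x => youngPsi α x - α * x ^ 2 :=
    (continuous_youngPsi hα).sub (by fun_prop)
  have hθ := H.tendsto_integral_cubic hα hθc (abs_youngPsi_sub_le hα)
  have hsplit : ∀ {g : ℝ → ℝ}, MemLp g 2 → MemLp g 3 →
      ∫ x, (youngPsi α (g x) - α * g x ^ 2) = (∫ x, youngPsi α (g x)) - α * ∫ x, g x ^ 2 :=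
    fun h2 h3 => by
      rw [integral_sub (integrable_youngPsi hα h2 h3) (h2.integrable_sq.const_mul α),
        integral_const_mul]
  rw [hsplit g2 g3] at hθ
  have hw := H.tendsto_integral_mul_sub hα g2
  have h1 := (((hθ.const_sub 1).div_const α).sub_const (∫ x, fα x ^ 2)).sub (hw.const_mul 2)
  refine Tendsto.congr' (Eventually.of_forall fun k => ?_)
    (h1.trans (le_of_eq (congrArg 𝓝 ?_)))
  · obtain ⟨f2, f3, f1⟩ := (mem_admissible_iff hα).1 (H.mem_admissible k)
    simp only
    rw [hsplit f2 f3, f1, H.integral_sq_eq hα k]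
    field_simp
    ring
  · field_simp
    ring

theorem tendsto_bform_sub (hα : 0 < α) (H : ConvergentMaximisers α n f fα u c M) :
    Tendsto (fun k => bform fα (f k - fα)) atTop (𝓝 0) := by
  obtain ⟨g2, g3, -⟩ := H.memLp_limit hα
  refine (H.tendsto_integral_mul_sub hα (memLp_two_whithamConv_half g2 g3)).congr fun k => ?_
  rw [bform_comm, bform_eq_integral
    (((mem_admissible_iff hα).1 (H.mem_admissible k)).1.sub g2) g2]
  congr 1
  ext x
  simp only [Pi.sub_apply]
  ring

/-- The energy splits into that of the limit and that of the remainder, the latter at most `‖f_k -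
f‖₂² → (1-m)/α`. With the dilation bound this gives `(1-m) J² ≤ (1-m)/α`, which contradicts `J² >
1/α` unless `m = 1`. -/
theorem integral_youngPsi_limit (hα : 0 < α) (H : ConvergentMaximisers α n f fα u c M) :
    ∫ x, youngPsi α (fα x) = 1 ∧ maxSq α univ ≤ bform fα fα := by
  obtain ⟨g2, g3, g1⟩ := H.memLp_limit hα
  set m := ∫ x, youngPsi α (fα x) with hm
  have hle : maxSq α univ ≤ bform fα fα + (1 - m) / α := by
    have h1 : Tendsto (fun k => maxSq α (dyadicIcc (n k))) atTop (𝓝 (maxSq α univ)) :=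
      (tendsto_maxSq hα).comp H.strictMono.tendsto_atTop
    have h2 := (((H.tendsto_bform_sub hα).const_mul 2).const_add (bform fα fα)).add
      (H.tendsto_integral_sq_sub hα)
    rw [mul_zero, add_zero] at h2
    refine le_of_tendsto_of_tendsto' h1 h2 fun k => ?_
    obtain ⟨f2, f3, f1⟩ := (mem_admissible_iff hα).1 (H.mem_admissible k)
    have r2 : MemLp (f k - fα) 2 := f2.sub g2
    have e : f k = fα + (f k - fα) := by simp
    have hb : bform (f k) (f k) = bform fα fα + 2 * bform fα (f k - fα) +
        bform (f k - fα) (f k - fα) := by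
      conv_lhs => rw [e]
      rw [bform_add_left g2 r2 (g2.add r2), bform_add_right g2 g2 r2,
        bform_add_right r2 g2 r2, bform_comm (f k - fα) fα]
      ring
    rw [← IsMaximiser.bform_eq hα (H.isMaximiser k), hb]
    have := bform_self_le r2
    simp only [Pi.sub_apply] at this
    linarith
  have hd := bform_le_maxSq_mul hα (H.measurable_limit hα) H.nonneg g2 g3 g1
  rw [← hm] at hd
  have hs := one_div_lt_maxSq hα
  have h1 : m = 1 := by
    refine le_antisymm g1 (not_lt.1 fun hlt => ?_)
    have h3 : (1 - m) * (1 / α) < (1 - m) * maxSq α univ :=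
      mul_lt_mul_of_pos_left hs (by linarith)
    have h4 : (1 - m) / α = (1 - m) * (1 / α) := by ring
    linarith [mul_comm m (maxSq α univ)]
  refine ⟨h1, ?_⟩
  rw [h1] at hle
  simpa using hle

theorem limit_mem_admissible (hα : 0 < α) (H : ConvergentMaximisers α n f fα u c M) :
    fα ∈ admissible α :=
  (mem_admissible_iff hα).2 ⟨(H.memLp_limit hα).1, (H.memLp_limit hα).2.1,
    (H.integral_youngPsi_limit hα).1⟩

theorem isMaximiser_limit (hα : 0 < α) (H : ConvergentMaximisers α n f fα u c M) :
    IsMaximiser (admissibleOn α univ) fα := by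
  refine isMaximiser_of_bform_eq hα ?_ (H.integral_youngPsi_limit hα).2
  rw [admissibleOn_univ]
  exact H.limit_mem_admissible hα

theorem tendsto_integral_sq_sub_zero (hα : 0 < α) (H : ConvergentMaximisers α n f fα u c M) :
    Tendsto (fun k => ∫ x, (f k x - fα x) ^ 2) atTop (𝓝 0) := by
  have := H.tendsto_integral_sq_sub hα
  rwa [(H.integral_youngPsi_limit hα).1, sub_self, zero_div] at this

/-- `x Ψ'(x)` is `2α x²` up to a cubic term. The cubic term passes to the limit by domination, the
quadratic one by the strong `L²` convergence now available. -/
theorem tendsto_pairingPsi (hα : 0 < α) (H : ConvergentMaximisers α n f fα u c M) :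
    Tendsto (fun k => pairingPsi α (f k)) atTop (𝓝 (pairingPsi α fα)) := by
  obtain ⟨g2, g3, -⟩ := H.memLp_limit hα
  have hθc : Continuous fun x => x * deriv (youngPsi α) x - 2 * α * x ^ 2 :=
    (continuous_id.mul (continuous_deriv_youngPsi hα)).sub (by fun_prop)
  have hθ := H.tendsto_integral_cubic hα hθc (abs_mul_deriv_youngPsi_sub_le hα)
  have hsplit : ∀ {g : ℝ → ℝ}, MemLp g 2 → MemLp g 3 →
      ∫ x, (g x * deriv (youngPsi α) (g x) - 2 * α * g x ^ 2) =
        pairingPsi α g - 2 * α * ∫ x, g x ^ 2 := fun {g} h2 h3 => by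
      have hi := integrable_deriv_youngPsi_mul hα h2 h3 h2 h3
      simp_rw [mul_comm (deriv (youngPsi α) _)] at hi
      rw [integral_sub hi (h2.integrable_sq.const_mul _), integral_const_mul, pairingPsi]
  rw [hsplit g2 g3] at hθ
  have hw := H.tendsto_integral_mul_sub hα g2
  have hsq : Tendsto (fun k => ∫ x, f k x ^ 2) atTop (𝓝 (∫ x, fα x ^ 2)) := by
    have := ((hw.const_mul 2).const_add (∫ x, fα x ^ 2)).add (H.tendsto_integral_sq_sub_zero hα)
    simp only [mul_zero, add_zero] at this
    exact this.congr fun k => (H.integral_sq_eq hα k).symm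
  have h1 := hθ.add (hsq.const_mul (2 * α))
  rw [sub_add_cancel] at h1
  refine h1.congr fun k => ?_
  obtain ⟨f2, f3, -⟩ := (mem_admissible_iff hα).1 (H.mem_admissible k)
  rw [hsplit f2 f3, sub_add_cancel]

theorem maxSq_pos (hα : 0 < α) : 0 < maxSq α univ :=
  (by positivity : 0 < 1 / α).trans (one_div_lt_maxSq hα)

theorem multiplier_eq (hα : 0 < α) (H : ConvergentMaximisers α n f fα u c M) :
    c = pairingPsi α fα / maxSq α univ :=
  tendsto_nhds_unique H.tendsto_multiplier ((H.tendsto_pairingPsi hα).div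
    ((tendsto_maxSq hα).comp H.strictMono.tendsto_atTop) (maxSq_pos hα).ne')

/-- The convolutions converge uniformly. -/
theorem exists_tendsto_abs_conv_sub_le (hα : 0 < α) (H : ConvergentMaximisers α n f fα u c M) :
    ∃ e : ℕ → ℝ, Tendsto e atTop (𝓝 0) ∧
      ∀ k x, |whithamConv (1 / 2) (f k) x - whithamConv (1 / 2) fα x| ≤ e k := by
  obtain ⟨g2, g3, -⟩ := H.memLp_limit hα
  refine ⟨fun k => (eLpNorm (whithamDensity (1 / 2)) (3 / 2) volume).toReal *
    (eLpNorm (f k - fα) 3 volume).toReal, ?_, fun k x => ?_⟩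
  · have := (ENNReal.tendsto_toReal ENNReal.zero_ne_top).comp (H.tendsto_eLpNorm_three hα)
    simpa using this.const_mul (eLpNorm (whithamDensity (1 / 2)) (3 / 2) volume).toReal
  · have f3 := ((mem_admissible_iff hα).1 (H.mem_admissible k)).2.1
    rw [← whithamConv_sub f3 g3]
    exact abs_whithamConv_le (f3.sub g3) x

theorem conv_limit (hα : 0 < α) (H : ConvergentMaximisers α n f fα u c M) (x : ℝ) :
    whithamConv (1 / 2) fα x = u x := by
  obtain ⟨e, he, hle⟩ := H.exists_tendsto_abs_conv_sub_le hα
  refine tendsto_nhds_unique ?_ (H.tendsto_conv x)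
  rw [tendsto_iff_dist_tendsto_zero]
  exact squeeze_zero (fun _ => dist_nonneg) (fun k => hle k x) he

/-- For `-1 < t < 0` the dilation bound applied to `(1+t) f` gives `(1+t)² J² ≤ J² h(t)`, with
equality at `t = 0` where `h = 1`. Comparing left derivatives at `0` yields `h'(0) ≤ 2`, and `h'(0)`
is the pairing. -/
theorem pairingPsi_limit_le (hα : 0 < α) (H : ConvergentMaximisers α n f fα u c M) :
    pairingPsi α fα ≤ 2 := by
  obtain ⟨g2, g3, -⟩ := H.memLp_limit hα
  have g1 := (H.integral_youngPsi_limit hα).1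
  have hJ := maxSq_pos hα
  set h : ℝ → ℝ := fun t => ∫ x, youngPsi α (fα x + t * fα x) with hh
  have hd : HasDerivAt h (pairingPsi α fα) 0 := by
    have := hasDerivAt_integral_youngPsi hα g2 g3 g2 g3
    simp only [mul_comm (deriv (youngPsi α) _)] at this
    exact this
  have h0 : h 0 = 1 := by simp [hh, g1]
  have hlow : ∀ t : ℝ, -1 < t → t < 0 → (1 + t) ^ 2 ≤ h t := by
    intro t ht1 ht0
    have e : ∀ x, fα x + t * fα x = ((1 + t) • fα) x := fun x => by
      simp only [Pi.smul_apply, smul_eq_mul]; ring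
    have hle : ∫ x, youngPsi α (((1 + t) • fα) x) ≤ 1 := by
      rw [← g1]
      refine integral_youngPsi_mono hα g2 g3 (ae_of_all _ fun x => ?_)
      simp only [Pi.smul_apply, smul_eq_mul, abs_mul]
      refine mul_le_of_le_one_left (abs_nonneg _) ?_
      rw [abs_of_pos (by linarith)]; linarith
    have hb := bform_le_maxSq_mul hα ((H.measurable_limit hα).const_smul (1 + t))
      (fun x => mul_nonneg (by linarith) (H.nonneg x)) (g2.const_smul (1 + t))
      (g3.const_smul (1 + t)) hle
    rw [bform_smul_left, bform_smul_right, IsMaximiser.bform_eq hα (H.isMaximiser_limit hα)] at hb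
    simp only [hh, e]
    refine le_of_mul_le_mul_left (a := maxSq α univ) ?_ hJ
    linarith
  have hs := (hd.hasDerivWithinAt (s := Iio 0))
  rw [hasDerivWithinAt_iff_tendsto_slope' (by simp)] at hs
  have hlim : Tendsto (fun t : ℝ => 2 + t) (𝓝[<] 0) (𝓝 2) := by
    have : Continuous fun t : ℝ => 2 + t := by fun_prop
    simpa using (this.tendsto 0).mono_left nhdsWithin_le_nhds
  refine le_of_tendsto_of_tendsto hs hlim ?_
  filter_upwards [self_mem_nhdsWithin,
    mem_nhdsWithin_of_mem_nhds (lt_mem_nhds (show (-1 : ℝ) < 0 by norm_num))] with t ht0 ht1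
  have ht0 : t < 0 := ht0
  rw [slope_def_field, sub_zero, h0, div_le_iff_of_neg ht0]
  have := hlow t ht1 ht0
  nlinarith

/-- Here `J² > 1/α` is used a second time: the limiting multiplier lies strictly below the slope
`2α` of `Ψ'` at the origin, which makes the tails subcritical. -/
theorem multiplier_lt (hα : 0 < α) (H : ConvergentMaximisers α n f fα u c M) : c < 2 * α := by
  rw [H.multiplier_eq hα, div_lt_iff₀ (maxSq_pos hα)]
  have h1 := one_div_lt_maxSq hα
  rw [div_lt_iff₀ hα] at h1
  linarith [H.pairingPsi_limit_le hα]

theorem deriv_limit_eq (hα : 0 < α) (H : ConvergentMaximisers α n f fα u c M) (x : ℝ) :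
    pairingPsi α fα / maxSq α univ * whithamConv (1 / 2) fα x = deriv (youngPsi α) (fα x) := by
  rw [H.conv_limit hα, ← H.multiplier_eq hα, H.deriv_eq]

theorem bellShaped_limit (H : ConvergentMaximisers α n f fα u c M) : BellShaped fα :=
  bellShaped_of_tendsto ((H.nonneg 0).trans (H.le_bound 0)) H.bell
    (fun k => (H.abs_le k).mono fun _ h => (le_abs_self _).trans h) H.tendsto_ae

end ConvergentMaximisers

/-! ### Decay of order `1/|x|` and convergence in `L^p` -/

theorem eventually_decay_lt (C : ℝ) {ε : ℝ} (hε : 0 < ε) :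
    ∃ R > 0, ∀ x : ℝ, R < |x| → C * (1 + |x|) ^ (-(1 / 2) : ℝ) < ε := by
  have h1 : Tendsto (fun t : ℝ => C * (1 + t) ^ (-(1 / 2) : ℝ)) atTop (𝓝 (C * 0)) :=
    ((tendsto_rpow_neg_atTop (by norm_num : (0 : ℝ) < 1 / 2)).comp
      (tendsto_atTop_add_const_left _ 1 tendsto_id)).const_mul C
  rw [mul_zero] at h1
  obtain ⟨R, hR⟩ := eventually_atTop.1 (h1.eventually (gt_mem_nhds hε))
  exact ⟨max R 1, by positivity, fun x hx => hR _ ((le_max_left _ _).trans hx.le)⟩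

namespace ConvergentMaximisers

variable {α : ℝ} {n : ℕ → ℕ} {f : ℕ → ℝ → ℝ} {fα u : ℝ → ℝ} {c M : ℝ}

theorem memLp_seq (hα : 0 < α) (H : ConvergentMaximisers α n f fα u c M) (k : ℕ) (p : ℝ≥0∞) :
    MemLp (f k) p := by
  have hS := measurableSet_dyadicIcc (n k)
  have : IsFiniteMeasure (volume.restrict (dyadicIcc (n k))) :=
    ⟨by simpa using (volume_dyadicIcc_ne_top (n k)).lt_top⟩
  have hm := ((mem_admissible_iff hα).1 (H.mem_admissible k)).1.1
  have h1 : MemLp (f k) p (volume.restrict (dyadicIcc (n k))) :=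
    MemLp.of_bound hm.restrict M (ae_restrict_of_ae (H.abs_le k))
  refine ((memLp_indicator_iff_restrict hS).2 h1).ae_eq ?_
  filter_upwards [(H.isMaximiser k).1.2] with x hx
  by_cases hxS : x ∈ dyadicIcc (n k)
  · simp [hxS]
  · simp [hxS, hx hxS]

/-- Away from the origin the maximisers are dominated by a fraction of their convolution. -/
theorem exists_le_mul_conv (hα : 0 < α) (H : ConvergentMaximisers α n f fα u c M) :
    ∃ R > 0, ∃ θ < 1, 0 ≤ θ ∧ ∀ᶠ k in atTop, ∀ᵐ x, R < |x| →
      f k x ≤ θ * whithamConv (1 / 2) (f k) x := by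
  have hc0 : 0 ≤ c := by
    rw [H.multiplier_eq hα]
    exact div_nonneg (pairingPsi_pos hα (H.limit_mem_admissible hα)).le (maxSq_pos hα).le
  have hc := H.multiplier_lt hα
  -- `c'` lies strictly between `c` and `2α` and bounds the multipliers for large `k`. `δ` is half
  -- the remaining gap, so `c' < 2α - δ` and the ratio `θ` is below one.
  set c' := (c + 2 * α) / 2 with hc'
  set δ := (2 * α - c') / 2 with hδ
  have hδ0 : 0 < δ := by rw [hδ, hc']; linarith
  have hden : 0 < 2 * α - δ := by rw [hδ, hc']; linarith
  obtain ⟨R, hR, hdec⟩ := eventually_decay_lt (Real.sqrt (M ^ 2 + 3 / α)) hδ0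
  refine ⟨R, hR, c' / (2 * α - δ), ?_, div_nonneg (by rw [hc']; linarith) hden.le, ?_⟩
  · rw [div_lt_one hden, hδ, hc']; linarith
  · have hev := H.tendsto_multiplier.eventually (gt_mem_nhds (show c < c' by rw [hc']; linarith))
    filter_upwards [hev] with k hk
    filter_upwards [(H.decay hα).1 k, H.euler_lagrange k, (H.isMaximiser k).1.2,
      (H.bell k).nonneg] with x h1 h2 h3 h4 hx
    have hU := whithamConv_nonneg (H.bell k).nonneg x
    by_cases hxI : x ∈ dyadicIcc (n k)
    · have h5 := mul_le_deriv_youngPsi hα h4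
        ((le_abs_self _).trans (h1.trans (hdec x hx).le))
      rw [h2 hxI] at h5
      rw [div_mul_eq_mul_div, le_div_iff₀ hden, mul_comm (f k x)]
      exact h5.trans (mul_le_mul_of_nonneg_right hk.le hU)
    · rw [h3 hxI]
      exact mul_nonneg (div_nonneg (by rw [hc']; linarith) hden.le) hU

/-- Integrating the tail inequality gives `∫ f_k ≤ 2RM + θ ∫ f_k`, as convolution preserves
integrals. The last term can be absorbed because each `f_k` is integrable and `θ < 1`. -/
theorem exists_integral_le (hα : 0 < α) (H : ConvergentMaximisers α n f fα u c M) :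
    ∃ C : ℝ, ∀ᶠ k in atTop, ∫ x, f k x ≤ C := by
  obtain ⟨R, hR, θ, hθ1, hθ0, hev⟩ := H.exists_le_mul_conv hα
  refine ⟨(2 * R * M) / (1 - θ), ?_⟩
  filter_upwards [hev] with k hk
  have hi : Integrable (f k) := memLp_one_iff_integrable.1 (H.memLp_seq hα k 1)
  obtain ⟨hci, hce⟩ := integral_whithamConv half_pos' hi
  have hχ : Integrable ((Icc (-R) R).indicator fun _ => M) :=
    (integrable_indicator_iff measurableSet_Icc).2 (integrableOn_const (by simp))
  have hle : ∫ x, f k x ≤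
      ∫ x, ((Icc (-R) R).indicator (fun _ => M) x + θ * whithamConv (1 / 2) (f k) x) := by
    refine integral_mono_ae hi (hχ.add (hci.const_mul θ)) ?_
    filter_upwards [hk, H.abs_le k] with x h1 h2
    have hU := mul_nonneg hθ0 (whithamConv_nonneg (H.bell k).nonneg x)
    by_cases hx : x ∈ Icc (-R) R
    · rw [indicator_of_mem hx]
      linarith [le_abs_self (f k x)]
    · rw [indicator_of_notMem hx, zero_add]
      exact h1 (not_le.1 fun h => hx (_root_.abs_le.1 h))
  rw [integral_add hχ (hci.const_mul θ), integral_const_mul, hce,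
    integral_indicator measurableSet_Icc, setIntegral_const, Measure.real, Real.volume_Icc,
    ENNReal.toReal_ofReal (by linarith), smul_eq_mul] at hle
  rw [le_div_iff₀ (by linarith)]
  linarith

/-- Bell shape turns the uniform `L¹` bound into decay of order `1/|x|`, a majorant in `L^p` for
every finite `p > 1`. -/
theorem exists_decay_inv (hα : 0 < α) (H : ConvergentMaximisers α n f fα u c M) :
    ∃ E : ℝ, (∀ᶠ k in atTop, ∀ᵐ x, |f k x| ≤ E * (1 + |x|) ^ (-1 : ℝ)) ∧
      ∀ᵐ x, |fα x| ≤ E * (1 + |x|) ^ (-1 : ℝ) := by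
  obtain ⟨C, hC⟩ := H.exists_integral_le hα
  have h1 : ∀ᶠ k in atTop, ∀ᵐ x, |f k x| ≤ (M + C) * (1 + |x|) ^ (-1 : ℝ) := by
    filter_upwards [hC] with k hk
    have hi : Integrable (f k) := memLp_one_iff_integrable.1 (H.memLp_seq hα k 1)
    have hb := (H.bell k).abs_mul_pow_le (p := 1) (by simpa using hi)
    simp only [pow_one] at hb
    filter_upwards [hb, H.abs_le k, (H.bell k).nonneg] with x h1 h2 h3
    have hx : 0 < 1 + |x| := by positivity
    rw [abs_of_nonneg h3] at h2 ⊢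
    rw [Real.rpow_neg_one, ← div_eq_mul_inv, le_div_iff₀ hx]
    linarith
  refine ⟨M + C, h1, ?_⟩
  obtain ⟨N, hN⟩ := eventually_atTop.1 h1
  have h2 : ∀ᵐ x, ∀ k, N ≤ k → |f k x| ≤ (M + C) * (1 + |x|) ^ (-1 : ℝ) := by
    rw [ae_all_iff]
    intro k
    by_cases hk : N ≤ k
    · filter_upwards [hN k hk] with x hx _ using hx
    · exact ae_of_all _ fun x h => absurd h hk
  filter_upwards [h2, H.tendsto_ae] with x hx1 hx2
  exact le_of_tendsto hx2.abs (eventually_atTop.2 ⟨N, hx1⟩)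

theorem memLp_limit_of_one_lt (hα : 0 < α) (H : ConvergentMaximisers α n f fα u c M)
    {p : ℝ≥0∞} (hp : 1 < p) : MemLp fα p := by
  have hm := (H.measurable_limit hα).aestronglyMeasurable (μ := volume)
  by_cases hp' : p = ∞
  · rw [hp']
    refine memLp_top_of_bound hm M (ae_of_all _ fun x => ?_)
    rw [Real.norm_of_nonneg (H.nonneg x)]
    exact H.le_bound x
  · obtain ⟨E, -, hE⟩ := H.exists_decay_inv hα
    have hpr : 1 < p.toReal := by
      rwa [← ENNReal.toReal_one, ENNReal.toReal_lt_toReal ENNReal.one_ne_top hp']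
    exact (memLp_one_add_abs_rpow (zero_lt_one.trans hp).ne' hp' (q := 1) (by linarith) E).mono'
      hm hE

theorem tendsto_eLpNorm_of_one_lt (hα : 0 < α) (H : ConvergentMaximisers α n f fα u c M)
    {p : ℝ≥0∞} (hp : 1 < p) (hp' : p ≠ ∞) :
    Tendsto (fun k => eLpNorm (f k - fα) p volume) atTop (𝓝 0) := by
  obtain ⟨E, hE1, hE2⟩ := H.exists_decay_inv hα
  obtain ⟨N, hN⟩ := eventually_atTop.1 hE1
  have hp0 : p ≠ 0 := (zero_lt_one.trans hp).ne'
  have hpr : 1 < p.toReal := by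
    rwa [← ENNReal.toReal_one, ENNReal.toReal_lt_toReal ENNReal.one_ne_top hp']
  -- The majorant is available only for large indices, so the sequence is shifted before domination
  -- is applied.
  rw [← tendsto_add_atTop_iff_nat N]
  refine tendsto_eLpNorm_of_dominated hp0 hp' (r := fun k => f (k + N) - fα) (fun k => ?_)
    (memLp_one_add_abs_rpow hp0 hp' (q := 1) (by linarith) (2 * E)) (fun k => ?_) ?_
  · exact (H.memLp_seq hα _ 1).1.sub (H.measurable_limit hα).aestronglyMeasurable
  · filter_upwards [hN (k + N) (Nat.le_add_left _ _), hE2] with x h1 h2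
    have := abs_sub (f (k + N) x) (fα x)
    simp only [Pi.sub_apply]
    linarith
  · filter_upwards [H.tendsto_sub_ae] with x hx
    exact (tendsto_add_atTop_iff_nat N).2 hx

/-- Outside a large ball both functions are below `ε/2`. Inside, both are images under `G` of the
right sides of their Euler–Lagrange equations, which converge uniformly, and `G` is uniformly
continuous on the compact interval `[0, Ψ'(M)]`. -/
theorem eventually_abs_sub_le (hα : 0 < α) (H : ConvergentMaximisers α n f fα u c M) {ε : ℝ}
    (hε : 0 < ε) : ∀ᶠ k in atTop, ∀ᵐ x, |f k x - fα x| ≤ ε := by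
  obtain ⟨G, hGc, hG1, -⟩ := exists_continuous_inverse_deriv_youngPsi hα
  obtain ⟨R, hR, hdec⟩ := eventually_decay_lt (Real.sqrt (M ^ 2 + 3 / α)) (half_pos hε)
  have huc := isCompact_Icc.uniformContinuousOn_of_continuous
    (hGc.continuousOn (s := Icc 0 (deriv (youngPsi α) M)))
  obtain ⟨δ, hδ, hG⟩ := Metric.uniformContinuousOn_iff.1 huc ε hε
  obtain ⟨e, he, hconv⟩ := H.exists_tendsto_abs_conv_sub_le hα
  obtain ⟨g2, g3, -⟩ := H.memLp_limit hα
  set B := (eLpNorm (whithamDensity (1 / 2)) (3 / 2) volume).toReal *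
    (eLpNorm fα 3 volume).toReal with hB
  set ck : ℕ → ℝ := fun k => pairingPsi α (f k) / maxSq α (dyadicIcc (n k)) with hck
  have hsmall : Tendsto (fun k => |ck k| * e k + |ck k - c| * B) atTop (𝓝 0) := by
    have h1 := (H.tendsto_multiplier.abs.mul he).add
      (((H.tendsto_multiplier.sub_const c).abs).mul_const B)
    simpa using h1
  have hmem : ∀ y, 0 ≤ y → y ≤ M →
      deriv (youngPsi α) y ∈ Icc 0 (deriv (youngPsi α) M) := fun y h0 h1 =>
    ⟨deriv_youngPsi_nonneg hα h0, (strictMono_deriv_youngPsi hα).monotone h1⟩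
  filter_upwards [hsmall.eventually (gt_mem_nhds hδ),
    H.strictMono.tendsto_atTop.eventually (eventually_lt_two_pow R)] with k hk1 hk2
  filter_upwards [(H.decay hα).1 k, (H.decay hα).2, H.euler_lagrange k, H.abs_le k,
    (H.bell k).nonneg] with x h1 h2 h3 h4 h5
  by_cases hx : R < |x|
  · have := hdec x hx
    have := abs_sub (f k x) (fα x)
    linarith
  · have hxI : x ∈ dyadicIcc (n k) := _root_.abs_le.1 ((not_lt.1 hx).trans hk2.le)
    rw [← hG1 (f k x), ← hG1 (fα x), ← Real.dist_eq]
    refine (hG _ (hmem _ h5 ((le_abs_self _).trans h4)) _ (hmem _ (H.nonneg x) (H.le_bound x))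
      (lt_of_le_of_lt ?_ hk1)).le
    rw [h3 hxI, H.deriv_eq, ← H.conv_limit hα, Real.dist_eq]
    calc |ck k * whithamConv (1 / 2) (f k) x - c * whithamConv (1 / 2) fα x|
        = |ck k * (whithamConv (1 / 2) (f k) x - whithamConv (1 / 2) fα x) +
            (ck k - c) * whithamConv (1 / 2) fα x| := by congr 1; ring
      _ ≤ |ck k| * |whithamConv (1 / 2) (f k) x - whithamConv (1 / 2) fα x| +
            |ck k - c| * |whithamConv (1 / 2) fα x| := by
          rw [← abs_mul, ← abs_mul]; exact abs_add_le _ _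
      _ ≤ |ck k| * e k + |ck k - c| * B := by
          gcongr
          exacts [hconv k x, abs_whithamConv_le g3 x]

theorem tendsto_eLpNorm (hα : 0 < α) (H : ConvergentMaximisers α n f fα u c M)
    {p : ℝ≥0∞} (hp : 1 < p) :
    Tendsto (fun k => eLpNorm (f k - fα) p volume) atTop (𝓝 0) := by
  by_cases hp' : p = ∞
  · subst hp'
    rw [ENNReal.tendsto_atTop_zero]
    intro ε hε
    obtain ⟨ε', hε'0, hε'⟩ := ENNReal.lt_iff_exists_real_btwn.1 hε
    have hpos : 0 < ε' := ENNReal.ofReal_pos.1 hε'.1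
    obtain ⟨N, hN⟩ := eventually_atTop.1 (H.eventually_abs_sub_le hα hpos)
    refine ⟨N, fun k hk => le_trans ?_ hε'.2.le⟩
    rw [eLpNorm_exponent_top]
    exact eLpNormEssSup_le_of_ae_bound (hN k hk)
  · exact H.tendsto_eLpNorm_of_one_lt hα hp hp'

end ConvergentMaximisers

/-! ### The main theorem -/

theorem convolutionExists_whithamKernel_half {f : ℝ → ℝ} (hf : MemLp f 3) :
    ConvolutionExists (whithamKernel (1 / 2)) f (ContinuousLinearMap.mul ℝ ℝ) volume := by
  intro x
  have h1 := (integrable_kernel_mul hf x).comp_sub_left x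
  refine h1.congr ?_
  filter_upwards [whithamKernel_ae_eq half_pos'] with t ht
  rw [sub_sub_cancel, ht, ContinuousLinearMap.mul_apply']

theorem mainTheorem2 (α : ℝ) (hα : 0 < α) (f : ℕ → ℝ → ℝ)
    (hbell : ∀ l, BellShaped (f l))
    (hmax : ∀ l, IsMaximiser (localAdmissible α l) (f l)) :
    ∃ (φ : ℕ → ℕ) (fα : ℝ → ℝ), StrictMono φ ∧
      -- pointwise convergence, at every point for the representatives of `f l` that are
      -- continuous on `(-2^l, 2^l)`, and hence almost everywhere for any representatives
      (∃ g : ℕ → ℝ → ℝ,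
        (∀ l, g l =ᵐ[volume] f l ∧
          ContinuousOn (g l) (Ioo (-(2 : ℝ) ^ l) ((2 : ℝ) ^ l))) ∧
        ∀ x : ℝ, Tendsto (fun k => g (φ k) x) atTop (𝓝 (fα x))) ∧
      (∀ᵐ x : ℝ, Tendsto (fun k => f (φ k) x) atTop (𝓝 (fα x))) ∧
      -- convergence in `L^p` for every `p > 1`
      (∀ p : ℝ≥0∞, 1 < p →
        (∀ k, MemLp (f (φ k)) p volume) ∧ MemLp fα p volume ∧
          Tendsto (fun k => eLpNorm (f (φ k) - fα) p volume) atTop (𝓝 0)) ∧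
      -- the limit is a nontrivial bell-shaped maximiser of the global problem
      ¬ (fα =ᵐ[volume] 0) ∧ BellShaped fα ∧ IsMaximiser (admissible α) fα ∧
      -- the Euler--Lagrange equation
      Integrable (fun x => fα x * deriv (youngPsi α) (fα x)) ∧
      ConvolutionExists (whithamKernel (1 / 2)) fα (ContinuousLinearMap.mul ℝ ℝ) volume ∧
      0 < (supJ (admissible α)).toReal ∧
      ∀ x : ℝ, pairingPsi α fα / (supJ (admissible α)).toReal ^ 2 * whithamConv (1 / 2) fα x
        = deriv (youngPsi α) (fα x) := by
  -- `localAdmissible α l` and `admissibleOn α (dyadicIcc l)` are equal by unfolding, so `hmax`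
  -- applies as it stands.
  obtain ⟨φ, fα, u, c, M, H, g, hg, hgt⟩ := exists_convergentMaximisers hα hbell hmax
  obtain ⟨g2, g3, -⟩ := H.memLp_limit hα
  have hJ : maxSq α univ = (supJ (admissible α)).toReal ^ 2 := by
    rw [maxSq, admissibleOn_univ]
  refine ⟨φ, fα, H.strictMono, ⟨g, hg, hgt⟩, H.tendsto_ae, fun p hp =>
    ⟨fun k => H.memLp_seq hα k p, H.memLp_limit_of_one_lt hα hp, H.tendsto_eLpNorm hα hp⟩,
    fun h0 => ?_, H.bellShaped_limit, ?_, ?_, convolutionExists_whithamKernel_half g3, ?_,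
    fun x => ?_⟩
  · rw [← integral_youngPsi_eq_zero_iff hα g2 g3, (H.integral_youngPsi_limit hα).1] at h0
    exact one_ne_zero h0
  · rw [← admissibleOn_univ]
    exact H.isMaximiser_limit hα
  · simpa only [mul_comm] using integrable_deriv_youngPsi_mul hα g2 g3 g2 g3
  · refine ENNReal.toReal_nonneg.lt_of_ne fun h0 => ?_
    have := ConvergentMaximisers.maxSq_pos hα
    rw [hJ, ← h0] at this
    simp at this
  · rw [← hJ]
    exact H.deriv_limit_eq hα x
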